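/- All graphs are finite and simple. For a graph $G$, the deficiency $\mathrm{def}(G)$ is the number of vertices not saturated by a maximum matching, and the local independence number $\alpha_l(G)$ is the largest $t$ such that $K_{1,t}$ is an induced subgraph of $G$. For $i\ge 2$ the bone $B_i$ is the tree obtained from a path $P_i$ on $i$ vertices by attaching two pendent edges to each of its two end vertices. For a set $A\subseteq\{2,3,\dots\}$ let $\mathcal G(A)$ be the family of connected graphs $G$ such that every bone $B_i$ ($i\ge 2$) that is an induced subgraph of $G$ has $i\in A$. A connected graph $G$ is deficiency-critical if $\mathrm{def}(G')<\mathrm{def}(G)$ for every proper connected induced subgraph $G'$ of $G$. For positive integers $m,p$ let $D_m^p$ be the tree obtained from a path $P_p$ by attaching $m$ pendent edges to one of its end vertices; the other end vertex of $P_p$ is called the end of $D_m^p$. Let $S_m^p$ be the tree obtained from $m$ disjoint copies of $D_{m-1}^p$ by identifying their ends to a single vertex. Let $T_m^p$ be the graph obtained from $K_{2,m}$ and two disjoint copies of $D_m^p$ by identifying the two vertices in the side of size two of $K_{2,m}$ with the ends of the two copies, respectively. **Theorem.** Let $n>3$ be an integer, let $p\ge 3$ be an odd integer, and let $G\in\mathcal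 G(\{p,q\})$ with $\alpha_l(G)<n$. * If $q=2p+1$, then $\mathrm{def}(G)\le 3n-8$. Moreover, if $G$ is deficiency-critical, then $\mathrm{def}(G)=3n-8$ if and only if $G\cong T_{n-2}^p$; and $T_{n-2}^p$ is itself a deficiency-critical graph in $\mathcal G(\{p,2p+1\})$ with $\alpha_l(T_{n-2}^p)<n$. * If $q=2p-1$, then $\mathrm{def}(G)\le n^2-3n+1$. Moreover, if $G$ is deficiency-critical, then $\mathrm{def}(G)=n^2-3n+1$ if and only if $G\cong S_{n-1}^p$; and $S_{n-1}^p$ is itself a deficiency-critical graph in $\mathcal G(\{p,2p-1\})$ with $\alpha_l(S_{n-1}^p)<n$. -/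

import Mathlib

namespace BoneDeficiency

/-- The star `K_{1,t}`. -/
abbrev starK (t : ℕ) : SimpleGraph (Fin 1 ⊕ Fin t) :=
  completeBipartiteGraph (Fin 1) (Fin t)

/-- The local independence number: the largest `t` such that `K_{1,t}` is an induced subgraph
of `G` (for a finite graph the set below is bounded, so the supremum is a maximum). -/
noncomputable def localIndepNum {V : Type*} (G : SimpleGraph V) : ℕ :=
  sSup {t : ℕ | (starK t).IsIndContained G}

/-- The deficiency of `G`: the number of vertices left unsaturated by a maximum matching, i.e.
the least number of vertices left unsaturated by a matching. -/
noncomputable def deficiency {V : Type*} (G : SimpleGraph V) : ℕ :=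
  sInf {k : ℕ | ∃ M : G.Subgraph, M.IsMatching ∧ (M.verts)ᶜ.ncard = k}

/-- The bone `B_i` (for `i ≥ 2`): a path on the `i` vertices `0, 1, …, i - 1`, with two pendent
edges at each of its end vertices. The vertices `(false, k)` hang at `0` and the vertices
`(true, k)` at `i - 1`. -/
def bone (i : ℕ) : SimpleGraph (Fin i ⊕ Bool × Fin 2) :=
  SimpleGraph.fromRel fun x y =>
    match x, y with
    | .inl a, .inl b => a.val + 1 = b.val
    | .inl a, .inr (false, _) => a.val = 0
    | .inl a, .inr (true, _) => a.val + 1 = i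
    | _, _ => False

/-- Membership of `G` in the family `𝒢(A)`: `G` is connected, and every bone `B_i`, `i ≥ 2`,
that is an induced subgraph of `G` has `i ∈ A`. -/
def InBoneClass {V : Type*} (A : Set ℕ) (G : SimpleGraph V) : Prop :=
  G.Connected ∧ ∀ i : ℕ, 2 ≤ i → (bone i).IsIndContained G → i ∈ A

/-- A connected graph is deficiency-critical if each of its proper connected induced subgraphs
has smaller deficiency. -/
def DeficiencyCritical {V : Type*} (G : SimpleGraph V) : Prop :=
  G.Connected ∧
    ∀ s : Set V, s ≠ Set.univ → (G.induce s).Connected → deficiency (G.induce s) < deficiency G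

/-- The vertices of `T_n^p`: two paths of `p` vertices each, the `n` vertices of `K_{2,n}` that
form the side of size `n`, and `n` pendent vertices for each of the two paths. -/
abbrev TVertex (p n : ℕ) : Type :=
  (Bool × Fin p) ⊕ (Fin n ⊕ (Bool × Fin n))

/-- The graph `T_n^p` (for `p ≥ 1`). The vertices `(s, 0)`, `s : Bool`, are the two vertices of
the side of size two of `K_{2,n}`; each of them is the first vertex of a path
`(s, 0), …, (s, p - 1)` whose last vertex carries `n` pendent edges. -/
def T (p n : ℕ) : SimpleGraph (TVertex p n) :=
  SimpleGraph.fromRel fun x y =>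
    match x, y with
    | .inl (s, a), .inl (s', b) => s = s' ∧ a.val + 1 = b.val
    | .inl (_, a), .inr (.inl _) => a.val = 0
    | .inl (s, a), .inr (.inr (s', _)) => s = s' ∧ a.val + 1 = p
    | _, _ => False

/-- The vertices of `S_n^p`: the centre, the `p - 1` further path vertices of each of the `n`
branches, and `n - 1` pendent vertices for each branch. -/
abbrev SVertex (p n : ℕ) : Type :=
  Unit ⊕ ((Fin n × Fin (p - 1)) ⊕ (Fin n × Fin (n - 1)))

/-- The tree `S_n^p` (for `p ≥ 2`): `n` paths on `p` vertices share their first vertex, the centre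
(the vertex `(i, a)` is the vertex number `a + 2` of the path number `i`), and the last vertex of
each path carries `n - 1` pendent edges. -/
def S (p n : ℕ) : SimpleGraph (SVertex p n) :=
  SimpleGraph.fromRel fun x y =>
    match x, y with
    | .inl _, .inr (.inl (_, a)) => a.val = 0
    | .inr (.inl (i, a)), .inr (.inl (j, b)) => i = j ∧ a.val + 1 = b.val
    | .inr (.inl (i, a)), .inr (.inr (j, _)) => i = j ∧ a.val + 2 = p
    | _, _ => False

end BoneDeficiency

/-! By the Tutte–Berge formula (`exists_barrier`), a graph of deficiency at least two has a barrier: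
a set whose removal leaves as many odd components as its size plus the deficiency. Every connected
graph contains a deficiency-critical induced subgraph of no smaller deficiency
(`exists_deficiencyCritical`), so the bounds only need proof for a critical graph `G`, studied
through a barrier `S` of least size.

Criticality applied to a component of `G - s`, `s ∈ S`, or to its complement shows that each side
keeps a surplus of odd components. Hence a component of `G - s` that avoids `S` is a single pendent
vertex (`exists_pendant_of_inter_eq_empty`). A barrier vertex that sees the rest of `S` in at most
one component is a tip and carries two pendent vertices (`IsTip.isEnd`); any other barrier vertex
separates two tips (`exists_two_tips`). Minimality of `S` and parity make every barrier vertex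
adjacent to three odd components, which supplies forks of non-adjacent neighbours
(`exists_fork_outside`).

Suitable forks at the two ends of an induced path form an induced bone, so the number of edges of
such a path is `p - 1` or `q - 1`. Both numbers are even and they hardly ever add up to one another
(`SumRule`); `attach` extracts from this how a third end can meet a path between two ends.

If `q = 2p - 1`, the lengths are `h = p - 1` and `2h`, and all ends sit on a spider with legs of
length `h` (`exists_spider`). The local independence number leaves at most `n - 1` ends
(`card_ends_lt`), and at most one barrier vertex is not a tip (`eq_of_not_isTip`). Counting odd
components around each barrier vertex gives the bound; equality forces `n - 1` tips with `n - 2`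
pendent vertices each, hence an induced copy of `S` (`embeds_S`).

If `q = 2p + 1`, twice `p - 1` is not a length and three ends are impossible (`no_three_ends`).
There are two tips, and every other barrier vertex lies on the path between them at distance `p - 1`
from one and `p + 1` from the other (`Separates`). So the barrier has at most four vertices, and the
count gives the bound, with an induced copy of `T` in the case of equality (`embeds_T`).

The models attain the bounds by a two-colouring argument (`sum_neg_one_pow_le_deficiency`). A
critical graph containing a model of the same deficiency equals it
(`DeficiencyCritical.iso_of_embedding`). The model itself is critical, since otherwise a proper
induced subgraph would contain a copy of the whole model (`deficiencyCritical_of_embeds`). -/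

namespace BoneDeficiency

/-! ### Connectivity inside a vertex set and the components of `G - X`. -/

variable {V : Type*} {G : SimpleGraph V}

/-- Two vertices are joined inside the set `K`. -/
def ConnIn (G : SimpleGraph V) (K : Set V) : V → V → Prop :=
  Relation.ReflTransGen fun x y => G.Adj x y ∧ x ∈ K ∧ y ∈ K

theorem ConnIn.symm {K : Set V} {a b : V} (h : ConnIn G K a b) : ConnIn G K b a := by
  have : Std.Symm fun x y => G.Adj x y ∧ x ∈ K ∧ y ∈ K :=
    ⟨fun _ _ h => ⟨h.1.symm, h.2.2, h.2.1⟩⟩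
  exact Relation.ReflTransGen.stdSymm.symm _ _ h

theorem ConnIn.trans {K : Set V} {a b c : V} (h : ConnIn G K a b) (h' : ConnIn G K b c) :
    ConnIn G K a c :=
  Relation.ReflTransGen.trans h h'

theorem ConnIn.refl {K : Set V} (a : V) : ConnIn G K a a := Relation.ReflTransGen.refl

theorem ConnIn.single {K : Set V} {a b : V} (h : G.Adj a b) (ha : a ∈ K) (hb : b ∈ K) :
    ConnIn G K a b := Relation.ReflTransGen.single ⟨h, ha, hb⟩

theorem ConnIn.mono {K K' : Set V} (hK : K ⊆ K') {a b : V} (h : ConnIn G K a b) :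
    ConnIn G K' a b :=
  Relation.ReflTransGen.mono (fun _ _ h => ⟨h.1, hK h.2.1, hK h.2.2⟩) _ _ h

theorem ConnIn.mem {K : Set V} {a b : V} (h : ConnIn G K a b) (ha : a ∈ K) : b ∈ K := by
  induction h with
  | refl => exact ha
  | tail _ h _ => exact h.2.2

theorem connIn_univ_iff {a b : V} : ConnIn G Set.univ a b ↔ G.Reachable a b := by
  rw [SimpleGraph.reachable_iff_reflTransGen]
  simp [ConnIn]

/-- A set of vertices that induces a connected subgraph (or is empty). -/
def ConnSet (G : SimpleGraph V) (K : Set V) : Prop := ∀ a ∈ K, ∀ b ∈ K, ConnIn G K a b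

theorem connSet_of_forall {K : Set V} (c : V) (h : ∀ a ∈ K, ConnIn G K a c) : ConnSet G K :=
  fun a ha b hb => (h a ha).trans (h b hb).symm

theorem ConnSet.induce {K : Set V} (h : ConnSet G K) (hne : K.Nonempty) :
    (G.induce K).Connected := by
  have key : ∀ (a b : V) (ha : a ∈ K) (hb : b ∈ K), ConnIn G K a b →
      (G.induce K).Reachable ⟨a, ha⟩ ⟨b, hb⟩ := by
    intro a b ha hb hab
    induction hab with
    | refl => exact SimpleGraph.Reachable.refl _
    | tail _ hbc ih =>
      exact (ih hbc.2.1).trans (SimpleGraph.Adj.reachable (by simpa using hbc.1))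
  have : Nonempty K := hne.to_subtype
  exact ⟨fun a b => key a b a.2 b.2 (h a a.2 b b.2)⟩

/-- The component of `G - X` that contains `v` (for `v ∉ X`). -/
def comp (G : SimpleGraph V) (X : Set V) (v : V) : Set V := {w | ConnIn G Xᶜ v w}

theorem mem_comp_self {X : Set V} {v : V} : v ∈ comp G X v := ConnIn.refl v

theorem comp_eq_of_mem {X : Set V} {v w : V} (h : w ∈ comp G X v) : comp G X w = comp G X v := by
  ext u
  exact ⟨fun hu => ConnIn.trans h hu, fun hu => ConnIn.trans (ConnIn.symm h) hu⟩

/-- `K` is (the vertex set of) a component of `G - X`. -/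
def IsComp (G : SimpleGraph V) (X K : Set V) : Prop := ∃ v, v ∉ X ∧ K = comp G X v

theorem isComp_comp {X : Set V} {v : V} (hv : v ∉ X) : IsComp G X (comp G X v) := ⟨v, hv, rfl⟩

theorem IsComp.nonempty {X K : Set V} (h : IsComp G X K) : K.Nonempty := by
  obtain ⟨v, _, rfl⟩ := h
  exact ⟨v, mem_comp_self⟩

theorem IsComp.notMem {X K : Set V} (h : IsComp G X K) {w : V} (hw : w ∈ K) : w ∉ X := by
  obtain ⟨v, hv, rfl⟩ := h
  exact ConnIn.mem (K := Xᶜ) hw hv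

theorem IsComp.eq_comp {X K : Set V} (h : IsComp G X K) {w : V} (hw : w ∈ K) :
    K = comp G X w := by
  obtain ⟨v, hv, rfl⟩ := h
  exact (comp_eq_of_mem hw).symm

theorem IsComp.eq {X K K' : Set V} (h : IsComp G X K) (h' : IsComp G X K') {w : V} (hw : w ∈ K)
    (hw' : w ∈ K') : K = K' := by
  rw [h.eq_comp hw, h'.eq_comp hw']

theorem IsComp.mem_of_adj {X K : Set V} (h : IsComp G X K) {a b : V} (ha : a ∈ K)
    (hab : G.Adj a b) (hb : b ∉ X) : b ∈ K := by
  have := h.notMem ha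
  rw [h.eq_comp ha]
  exact ConnIn.single hab this hb

theorem IsComp.connSet {X K : Set V} (h : IsComp G X K) : ConnSet G K := by
  obtain ⟨v, hv, rfl⟩ := h
  have key : ∀ w, ConnIn G Xᶜ v w → ConnIn G (comp G X v) v w := by
    intro w hw
    induction hw with
    | refl => exact ConnIn.refl v
    | @tail b c hb hbc ih =>
      exact ih.trans (ConnIn.single hbc.1 hb (Relation.ReflTransGen.tail hb hbc))
  exact fun a ha b hb => (key a ha).symm.trans (key b hb)

/-- A connected set that avoids `X` lies in one component of `G - X`. -/
theorem IsComp.subset_of_connSet {X K A : Set V} (h : IsComp G X K) (hA : ConnSet G A)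
    (hAX : ∀ a ∈ A, a ∉ X) {w : V} (hwA : w ∈ A) (hw : w ∈ K) : A ⊆ K := by
  intro a ha
  rw [h.eq_comp hw]
  exact (hA w hwA a ha).mono hAX

theorem isComp_of_connSet {X K : Set V} (hne : K.Nonempty) (hK : ConnSet G K)
    (hX : ∀ a ∈ K, a ∉ X) (hcl : ∀ a ∈ K, ∀ b, G.Adj a b → b ∈ K ∨ b ∈ X) : IsComp G X K := by
  obtain ⟨v, hv⟩ := hne
  refine ⟨v, hX v hv, Set.Subset.antisymm (fun w hw => (hK v hv w hw).mono hX) ?_⟩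
  intro w hw
  induction (show ConnIn G Xᶜ v w from hw) with
  | refl => exact hv
  | tail _ hbc ih => exact (hcl _ (ih (by assumption)) _ hbc.1).resolve_right hbc.2.2

/-- The odd components of `G - X`. -/
def oddComps (G : SimpleGraph V) (X : Set V) : Set (Set V) := {K | IsComp G X K ∧ Odd K.ncard}

/-- The vertices outside `X` are partitioned into components, and a sum of component sizes has the
parity of the number of odd summands. -/
theorem oddComps_parity [Finite V] (G : SimpleGraph V) (X : Set V) :
    Even ((oddComps G X).ncard + X.ncard + Nat.card V) := by
  classical
  cases nonempty_fintype V
  have hpart : (Finset.univ.filter fun v : V => v ∉ X).card =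
      ∑ K ∈ (Finset.univ.filter fun K : Set V => IsComp G X K), K.ncard := by
    have h1 : (Finset.univ.filter fun v : V => v ∉ X) =
        (Finset.univ.filter fun K : Set V => IsComp G X K).biUnion fun K => K.toFinset := by
      ext v
      simp only [Finset.mem_filter, Finset.mem_univ, true_and, Finset.mem_biUnion,
        Set.mem_toFinset]
      exact ⟨fun hv => ⟨comp G X v, isComp_comp hv, mem_comp_self⟩,
        fun ⟨K, hK, hv⟩ => hK.notMem hv⟩
    rw [h1, Finset.card_biUnion]
    · exact Finset.sum_congr rfl fun K _ => (Set.ncard_eq_toFinset_card' K).symm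
    · intro K hK K' hK' hne
      simp only [Finset.coe_filter, Finset.mem_univ, true_and, Set.mem_ofPred_eq] at hK hK'
      rw [Function.onFun, Set.disjoint_toFinset, Set.disjoint_left]
      exact fun w hw hw' => hne (hK.eq hK' hw hw')
  have hodd := Finset.odd_sum_iff_odd_card_odd (s := Finset.univ.filter fun K : Set V =>
    IsComp G X K) (fun K : Set V => K.ncard)
  have hcard : ((Finset.univ.filter fun K : Set V => IsComp G X K).filter
      fun K => Odd K.ncard).card = (oddComps G X).ncard := by
    rw [Set.ncard_eq_toFinset_card' (oddComps G X)]
    congr 1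
    ext K
    rw [Set.mem_toFinset]
    simp [oddComps]
  rw [hcard, ← hpart] at hodd
  have hX : (Finset.univ.filter fun v : V => v ∉ X).card + X.ncard = Nat.card V := by
    rw [Set.ncard_eq_toFinset_card', Nat.card_eq_fintype_card, ← Finset.card_univ,
      ← Finset.card_filter_add_card_filter_not (s := (Finset.univ : Finset V)) (fun v => v ∈ X),
      add_comm]
    congr 2
    ext v
    simp
  rw [← hX]
  rcases Nat.even_or_odd (oddComps G X).ncard with h | h
  · have h2 : Even (Finset.univ.filter fun v : V => v ∉ X).card := by
      rw [← Nat.not_odd_iff_even] at h ⊢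
      exact fun h' => h (hodd.1 h')
    obtain ⟨a, ha⟩ := h
    obtain ⟨b, hb⟩ := h2
    exact ⟨a + b + X.ncard, by omega⟩
  · obtain ⟨b, hb⟩ := hodd.2 h
    obtain ⟨a, ha⟩ := h
    exact ⟨a + b + X.ncard + 1, by omega⟩

/-! ### Deficiency -/

theorem exists_matching_deficiency (G : SimpleGraph V) :
    ∃ M : G.Subgraph, M.IsMatching ∧ (M.verts)ᶜ.ncard = deficiency G :=
  Nat.sInf_mem (s := {k : ℕ | ∃ M : G.Subgraph, M.IsMatching ∧ (M.verts)ᶜ.ncard = k})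
    ⟨_, ⊥, by intro v hv; simp at hv, rfl⟩

theorem deficiency_le {M : G.Subgraph} (hM : M.IsMatching) : deficiency G ≤ (M.verts)ᶜ.ncard :=
  Nat.sInf_le ⟨M, hM, rfl⟩

/-- The easy half of the Tutte–Berge formula. -/
theorem ncard_le_deficiency_add [Finite V] (G : SimpleGraph V) (X : Set V) (C : Set (Set V))
    (hdisj : ∀ K ∈ C, ∀ K' ∈ C, ∀ w, w ∈ K → w ∈ K' → K = K')
    (hodd : ∀ K ∈ C, Odd K.ncard)
    (hcl : ∀ K ∈ C, ∀ a ∈ K, ∀ b, G.Adj a b → b ∈ K ∨ b ∈ X) :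
    C.ncard ≤ deficiency G + X.ncard := by
  classical
  rcases C.eq_empty_or_nonempty with rfl | ⟨K₀, hK₀⟩
  · simp
  have : Nonempty V := by
    obtain ⟨v, -⟩ := (Set.ncard_pos (Set.toFinite _)).1 (hodd K₀ hK₀).pos
    exact ⟨v⟩
  obtain ⟨M, hM, hMd⟩ := exists_matching_deficiency G
  rw [← hMd]
  -- every member of `C` has an unsaturated vertex or a vertex matched into `X`
  have key : ∀ K ∈ C, ∃ a ∈ K, a ∉ M.verts ∨ ∃ x ∈ X, M.Adj a x := by
    intro K hK
    by_contra! hcon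
    -- If all of `K` is saturated and nothing is matched into `X`, then `M` matches `K` within
    -- itself, which its odd size forbids.
    have hK2 : (M.induce K).IsMatching := by
      intro v hv
      have hvK : v ∈ K := by simpa using hv
      obtain ⟨w, hw, huniq⟩ := hM (hcon v hvK).1
      have hwK : w ∈ K := (hcl K hK v hvK w hw.adj_sub).resolve_right
        fun hx => (hcon v hvK).2 w hx hw
      exact ⟨w, by simp [hvK, hwK, hw], fun y hy => huniq y (by simp at hy; exact hy.2.2)⟩
    cases nonempty_fintype V
    have hev := hK2.even_card
    have : (M.induce K).verts.toFinset.card = K.ncard := by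
      rw [Set.ncard_eq_toFinset_card']; simp
    rw [this] at hev
    exact (Nat.not_even_iff_odd.2 (hodd K hK)) hev
  choose! f hfK hf using key
  -- Members of the first kind inject into the unsaturated vertices, those of the second kind into
  -- `X` through the matching partner.
  have hsplit : C = {K ∈ C | f K ∉ M.verts} ∪ {K ∈ C | ∃ x ∈ X, M.Adj (f K) x} := by
    ext K
    constructor
    · intro hK
      rcases hf K hK with h | h
      · exact Or.inl ⟨hK, h⟩
      · exact Or.inr ⟨hK, h⟩
    · rintro (h | h) <;> exact h.1
  rw [hsplit]
  refine (Set.ncard_union_le _ _).trans (Nat.add_le_add ?_ ?_)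
  · refine Set.ncard_le_ncard_of_injOn f (fun K hK => hK.2) ?_ (Set.toFinite _)
    intro K hK K' hK' he
    exact hdisj K hK.1 K' hK'.1 (f K) (hfK K hK.1) (he ▸ hfK K' hK'.1)
  · have hch : ∀ K ∈ {K ∈ C | ∃ x ∈ X, M.Adj (f K) x}, ∃ x ∈ X, M.Adj (f K) x := fun K hK => hK.2
    choose! g hgX hg using hch
    refine Set.ncard_le_ncard_of_injOn g (fun K hK => hgX K hK) ?_ (Set.toFinite _)
    intro K hK K' hK' he
    have h1 := hg K hK
    have h2 := hg K' hK'
    rw [← he] at h2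
    have h3 := hM.eq_of_adj_right h1 h2
    exact hdisj K hK.1 K' hK'.1 (f K) (hfK K hK.1) (h3 ▸ hfK K' hK'.1)

/-- The easy half of the Tutte–Berge formula for the subgraph induced by `W`. -/
theorem ncard_le_deficiency_induce_add [Finite V] (G : SimpleGraph V) (W X : Set V)
    (C : Set (Set V))
    (hW : ∀ K ∈ C, K ⊆ W)
    (hdisj : ∀ K ∈ C, ∀ K' ∈ C, ∀ w, w ∈ K → w ∈ K' → K = K')
    (hodd : ∀ K ∈ C, Odd K.ncard)
    (hcl : ∀ K ∈ C, ∀ a ∈ K, ∀ b ∈ W, G.Adj a b → b ∈ K ∨ b ∈ X) :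
    C.ncard ≤ deficiency (G.induce W) + (X ∩ W).ncard := by
  have hinj : Set.InjOn (fun K : Set V => ((↑) : W → V) ⁻¹' K) C := by
    intro K hK K' hK' he
    have h1 := congrArg (fun A : Set W => ((↑) : W → V) '' A) he
    simp only [Subtype.image_preimage_coe] at h1
    rwa [Set.inter_eq_right.2 (hW K hK), Set.inter_eq_right.2 (hW K' hK')] at h1
  have hnc : ∀ A : Set V, (((↑) : W → V) ⁻¹' A).ncard = (A ∩ W).ncard := by
    intro A
    rw [← Set.ncard_image_of_injective _ Subtype.val_injective, Subtype.image_preimage_coe,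
      Set.inter_comm]
  rw [← hinj.ncard_image, ← hnc X]
  refine ncard_le_deficiency_add (G.induce W) _ _ ?_ ?_ ?_
  · rintro _ ⟨K, hK, rfl⟩ _ ⟨K', hK', rfl⟩ w hw hw'
    rw [hdisj K hK K' hK' w hw hw']
  · rintro _ ⟨K, hK, rfl⟩
    simp only [hnc]
    rw [Set.inter_eq_left.2 (hW K hK)]
    exact hodd K hK
  · rintro _ ⟨K, hK, rfl⟩ a ha b hab
    exact hcl K hK a ha b b.2 (by simpa using hab)

/-! ### The other half of the Tutte–Berge formula -/

/-- The join of `G` and a complete graph on `k` vertices. -/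
def joinTop (G : SimpleGraph V) (k : ℕ) : SimpleGraph (V ⊕ Fin k) where
  Adj x y := x ≠ y ∧ ∀ a b, x = .inl a → y = .inl b → G.Adj a b
  symm := ⟨fun _ _ h => ⟨h.1.symm, fun a b ha hb => (h.2 b a hb ha).symm⟩⟩
  loopless := ⟨fun _ h => h.1 rfl⟩

theorem joinTop_adj_inl {k : ℕ} {a b : V} :
    (joinTop G k).Adj (.inl a) (.inl b) ↔ G.Adj a b := by
  constructor
  · exact fun h => h.2 a b rfl rfl
  · rintro h
    refine ⟨by simpa using h.ne, ?_⟩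
    rintro a' b' ⟨⟩ ⟨⟩
    exact h

theorem joinTop_adj_inr {k : ℕ} {x : V ⊕ Fin k} {j : Fin k} (hx : x ≠ .inr j) :
    (joinTop G k).Adj (.inr j) x := ⟨hx.symm, by simp⟩

/-- Vertices of `G` that the matching does not pair inside `G` are paired with distinct new
vertices, and there are only `k` of those. -/
theorem deficiency_le_of_joinTop [Finite V] {k : ℕ} {M : (joinTop G k).Subgraph}
    (hM : M.IsPerfectMatching) : deficiency G ≤ k := by
  let N : G.Subgraph :=
    { verts := {a | ∃ b, M.Adj (.inl a) (.inl b)}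
      Adj := fun a b => M.Adj (.inl a) (.inl b)
      adj_sub := fun h => joinTop_adj_inl.1 h.adj_sub
      edge_vert := fun {a b} h => ⟨b, h⟩
      symm := ⟨fun _ _ h => h.symm⟩ }
  have hN : N.IsMatching := by
    rintro a ⟨b, hb⟩
    refine ⟨b, hb, fun c hc => ?_⟩
    simpa using hM.1.eq_of_adj_left hc hb
  refine (deficiency_le hN).trans ?_
  have hex : ∀ a ∈ (N.verts)ᶜ, ∃ j : Fin k, M.Adj (.inl a) (.inr j) := by
    intro a ha
    obtain ⟨w, hw, -⟩ := hM.1 (hM.2 (.inl a))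
    rcases w with b | j
    · exact absurd ⟨b, hw⟩ ha
    · exact ⟨j, hw⟩
  rcases Nat.eq_zero_or_pos k with rfl | hk
  · have : (N.verts)ᶜ = ∅ := by
      ext a
      simp only [Set.mem_empty_iff_false, iff_false]
      exact fun ha => (hex a ha).choose.elim0
    simp [this]
  have : Nonempty (Fin k) := ⟨⟨0, hk⟩⟩
  choose! f hf using hex
  calc (N.verts)ᶜ.ncard ≤ (Set.univ : Set (Fin k)).ncard := by
        refine Set.ncard_le_ncard_of_injOn f (fun _ _ => Set.mem_univ _) ?_ (Set.toFinite _)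
        intro a ha b hb hab
        have h1 := hf a ha
        rw [hab] at h1
        simpa using hM.1.eq_of_adj_right h1 (hf b hb)
    _ = k := by simp [Set.ncard_univ]

/-- Transfers the odd components counted in Mathlib's Tutte theorem to the set-based `oddComps`. -/
theorem ncard_oddComponents_le [Finite V] (G : SimpleGraph V) (u : Set V) :
    ((⊤ : G.Subgraph).deleteVerts u).coe.oddComponents.ncard ≤ (oddComps G u).ncard := by
  set H := (⊤ : G.Subgraph).deleteVerts u with hH
  have hreach : ∀ x y : H.verts, H.coe.Reachable x y ↔ ConnIn G uᶜ x y := by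
    intro x y
    constructor
    · intro h
      rw [SimpleGraph.reachable_iff_reflTransGen] at h
      induction h with
      | refl => exact ConnIn.refl _
      | tail _ hbc ih =>
        refine ih.trans (ConnIn.single ?_ ?_ ?_)
        · exact (H.coe_adj_sub _ _ hbc)
        · exact (Subtype.coe_prop _ : _ ∈ H.verts).2
        · exact (Subtype.coe_prop _ : _ ∈ H.verts).2
    · have key : ∀ a b : V, ConnIn G uᶜ a b → ∀ (ha : a ∈ H.verts) (hb : b ∈ H.verts),
          H.coe.Reachable ⟨a, ha⟩ ⟨b, hb⟩ := by
        intro a b hab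
        induction hab with
        | refl => exact fun _ _ => SimpleGraph.Reachable.refl _
        | @tail b c _ hbc ih =>
          intro ha hc
          have hb : b ∈ H.verts := ⟨trivial, hbc.2.1⟩
          refine (ih ha hb).trans (SimpleGraph.Adj.reachable ?_)
          simpa [hH, hbc.1] using hbc.2
      exact fun h => key x y h x.2 y.2
  refine Set.ncard_le_ncard_of_injOn (fun c => ((↑) : H.verts → V) '' c.supp) ?_ ?_
    (Set.toFinite _)
  · intro c hc
    refine ⟨?_, ?_⟩
    · induction c using SimpleGraph.ConnectedComponent.ind with
      | h v =>
        refine ⟨v, v.2.2, ?_⟩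
        ext w
        simp only [Set.mem_image, SimpleGraph.ConnectedComponent.mem_supp_iff,
          SimpleGraph.ConnectedComponent.eq, comp, Set.mem_ofPred_eq]
        constructor
        · rintro ⟨x, hx, rfl⟩
          exact (hreach v x).1 hx.symm
        · intro hw
          have hwH : w ∈ H.verts := ⟨trivial, hw.mem (K := uᶜ) v.2.2⟩
          exact ⟨⟨w, hwH⟩, ((hreach v ⟨w, hwH⟩).2 hw).symm, rfl⟩
    · rw [Set.ncard_image_of_injective _ Subtype.val_injective]
      exact hc
  · intro c _ c' _ h
    exact SimpleGraph.ConnectedComponent.supp_injective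
      (Set.image_injective.2 Subtype.val_injective h)

/-- Once all new vertices are deleted, the join is just `G` again, so a barrier of the join descends
to `G`. -/
theorem IsComp.of_joinTop {k : ℕ} {U : Set (V ⊕ Fin k)} (hU : ∀ j, Sum.inr j ∈ U)
    {K : Set (V ⊕ Fin k)} (hK : IsComp (joinTop G k) U K) :
    ∃ K', IsComp G (Sum.inl ⁻¹' U) K' ∧ K = Sum.inl '' K' := by
  obtain ⟨x, hx, rfl⟩ := hK
  rcases x with v | j
  swap
  · exact absurd (hU j) hx
  refine ⟨comp G (Sum.inl ⁻¹' U) v, isComp_comp hx, ?_⟩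
  have hf : ∀ y, ConnIn (joinTop G k) Uᶜ (.inl v) y →
      ∃ w, y = .inl w ∧ ConnIn G (Sum.inl ⁻¹' U)ᶜ v w := by
    intro y hy
    induction hy with
    | refl => exact ⟨v, rfl, ConnIn.refl _⟩
    | @tail b c _ hbc ih =>
      obtain ⟨w, rfl, hw⟩ := ih
      rcases c with c | j
      · exact ⟨c, rfl, hw.trans (ConnIn.single (joinTop_adj_inl.1 hbc.1) hbc.2.1 hbc.2.2)⟩
      · exact absurd (hU j) hbc.2.2
  ext y
  constructor
  · intro hy
    obtain ⟨w, rfl, hw⟩ := hf y hy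
    exact ⟨w, hw, rfl⟩
  · rintro ⟨w, hw, rfl⟩
    have hw' : ConnIn G (Sum.inl ⁻¹' U)ᶜ v w := hw
    clear hw
    induction hw' with
    | refl => exact mem_comp_self
    | tail _ hbc ih =>
      exact ConnIn.trans ih (ConnIn.single (joinTop_adj_inl.2 hbc.1) hbc.2.1 hbc.2.2)

/-- The hard half of the Tutte–Berge formula, for deficiency at least two. -/
theorem exists_barrier [Finite V] (G : SimpleGraph V) (hd : 2 ≤ deficiency G) :
    ∃ X : Set V, deficiency G + X.ncard ≤ (oddComps G X).ncard := by
  classical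
  cases nonempty_fintype V
  -- parity of the deficiency
  have hpar : Even (deficiency G + Nat.card V) := by
    obtain ⟨M, hM, hMd⟩ := exists_matching_deficiency G
    have h1 := hM.even_card
    rw [← Set.ncard_eq_toFinset_card'] at h1
    have h2 := Set.ncard_add_ncard_compl M.verts
    obtain ⟨a, ha⟩ := h1
    exact ⟨deficiency G + a, by omega⟩
  -- Joining two vertices fewer than the deficiency keeps the order even and still excludes a
  -- perfect matching, so Tutte's theorem applies to the join.
  obtain ⟨k, hk⟩ : ∃ k, deficiency G = k + 2 := ⟨deficiency G - 2, by omega⟩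
  have hcard : Nat.card (V ⊕ Fin k) = Nat.card V + k := by simp
  have hfree : ∀ M : (joinTop G k).Subgraph, ¬ M.IsPerfectMatching := by
    intro M hM
    have := deficiency_le_of_joinTop hM
    omega
  have hev : Even (Nat.card (V ⊕ Fin k)) := by
    rw [hcard]
    obtain ⟨a, ha⟩ := hpar
    exact ⟨a - 1, by omega⟩
  obtain ⟨U, hU⟩ := SimpleGraph.exists_isTutteViolator hfree hev
  -- In a graph of even order the number of odd components has the parity of `U`, so a violation by
  -- one is a violation by two.
  have hU' : U.ncard + 2 ≤ (oddComps (joinTop G k) U).ncard := by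
    have h1 : U.ncard < _ := hU
    have h2 := ncard_oddComponents_le (joinTop G k) U
    have h3 := oddComps_parity (joinTop G k) U
    obtain ⟨a, ha⟩ := h3
    obtain ⟨b, hb⟩ := hev
    omega
  by_cases hall : ∀ j, Sum.inr j ∈ U
  · refine ⟨Sum.inl ⁻¹' U, ?_⟩
    have h1 : (oddComps (joinTop G k) U).ncard ≤ (oddComps G (Sum.inl ⁻¹' U)).ncard := by
      rw [← Set.ncard_image_of_injective (oddComps G (Sum.inl ⁻¹' U))
        (Set.image_injective.2 (Sum.inl_injective (β := Fin k)))]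
      refine Set.ncard_le_ncard ?_ (Set.toFinite _)
      rintro K ⟨hK, hodd⟩
      obtain ⟨K', hK', rfl⟩ := hK.of_joinTop hall
      rw [Set.ncard_image_of_injective _ Sum.inl_injective] at hodd
      exact ⟨K', ⟨hK', hodd⟩, rfl⟩
    have h2 : U.ncard = (Sum.inl ⁻¹' U).ncard + k := by
      have : U = Sum.inl '' (Sum.inl ⁻¹' U) ∪ Set.range (Sum.inr : Fin k → V ⊕ Fin k) := by
        ext x
        rcases x with v | j
        · simp
        · simp [hall j]
      conv_lhs => rw [this]
      rw [Set.ncard_union_eq, Set.ncard_image_of_injective _ Sum.inl_injective]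
      · congr 1
        rw [← Set.image_univ, Set.ncard_image_of_injective _ Sum.inr_injective, Set.ncard_univ]
        simp
      · rw [Set.disjoint_left]
        rintro _ ⟨v, _, rfl⟩ ⟨j, hj⟩
        exact absurd hj (by simp)
    omega
  · push Not at hall
    obtain ⟨j, hj⟩ := hall
    -- A surviving new vertex is adjacent to everything, leaving a single component; a violator has
    -- at least two odd ones.
    have hone : (oddComps (joinTop G k) U).ncard ≤ 1 := by
      rw [Set.ncard_le_one]
      have hmem : ∀ K, IsComp (joinTop G k) U K → Sum.inr j ∈ K := by
        intro K hK
        obtain ⟨x, hx⟩ := hK.nonempty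
        by_cases hxj : x = Sum.inr j
        · exact hxj ▸ hx
        · exact hK.mem_of_adj hx (joinTop_adj_inr hxj).symm hj
      intro K hK K' hK'
      exact hK.1.eq hK'.1 (hmem K hK.1) (hmem K' hK'.1)
    omega

end BoneDeficiency

/-! ### Smallest barriers of deficiency-critical graphs. -/

namespace BoneDeficiency

variable {V : Type*} {G : SimpleGraph V}

theorem IsComp.exists_adj (hG : G.Connected) {X K : Set V} (hK : IsComp G X K) {x₀ : V}
    (hx₀ : x₀ ∈ X) : ∃ a ∈ K, ∃ x ∈ X, G.Adj a x := by
  by_contra! hcon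
  obtain ⟨v, hv⟩ := hK.nonempty
  have h : ConnIn G Set.univ v x₀ := connIn_univ_iff.2 (hG.preconnected v x₀)
  have hmem : x₀ ∈ K := by
    clear hx₀
    induction h with
    | refl => exact hv
    | tail _ hbc ih => exact hK.mem_of_adj ih hbc.1 fun hc => hcon _ ih _ hc hbc.1
  exact hK.notMem hmem hx₀

/-- Each other component of `G - s` is attached to `s`, so it reaches `s` without entering `L`. This
makes `Lᶜ` an admissible test set for criticality. -/
theorem IsComp.connSet_compl (hG : G.Connected) {s : V} {L : Set V} (hL : IsComp G {s} L) :
    ConnSet G Lᶜ := by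
  have hsL : s ∉ L := fun h => hL.notMem h rfl
  refine connSet_of_forall s fun a ha => ?_
  by_cases has : a = s
  · exact has ▸ ConnIn.refl _
  have hK := isComp_comp (G := G) (X := {s}) (v := a) (by simpa using has)
  obtain ⟨b, hb, x, rfl, hbx⟩ := hK.exists_adj hG (x₀ := s) rfl
  have hsub : comp G {x} a ⊆ Lᶜ := by
    intro c hc hcL
    exact ha ((hK.eq hL hc hcL) ▸ mem_comp_self)
  exact ((hK.connSet a mem_comp_self b hb).mono hsub).trans (ConnIn.single hbx (hsub hb) hsL)

/-- `a` is a vertex whose only neighbour is `e`. -/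
def Pendant (G : SimpleGraph V) (e a : V) : Prop := ∀ w, G.Adj a w ↔ w = e

theorem Pendant.adj {e a : V} (h : Pendant G e a) : G.Adj e a := ((h e).2 rfl).symm

/-- `e` has at least two pendent neighbours. -/
def IsEnd (G : SimpleGraph V) (e : V) : Prop := ∃ a b, a ≠ b ∧ Pendant G e a ∧ Pendant G e b

/-- `a` and `b` are two non-adjacent neighbours of `x`. -/
def Fork (G : SimpleGraph V) (x a b : V) : Prop :=
  G.Adj x a ∧ G.Adj x b ∧ a ≠ b ∧ ¬ G.Adj a b

/-- `S` is a smallest set attaining the maximum in the Tutte–Berge formula. -/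
structure MinBarrier (G : SimpleGraph V) (S : Set V) : Prop where
  ge : deficiency G + S.ncard ≤ (oddComps G S).ncard
  min : ∀ X : Set V, deficiency G + X.ncard ≤ (oddComps G X).ncard → S.ncard ≤ X.ncard

theorem exists_minBarrier [Finite V] (hd : 2 ≤ deficiency G) : ∃ S, MinBarrier G S := by
  obtain ⟨X, hX⟩ := exists_barrier G hd
  have hne : {X : Set V | deficiency G + X.ncard ≤ (oddComps G X).ncard}.Nonempty := ⟨X, hX⟩
  obtain ⟨S, hS, hmin⟩ := Set.exists_min_image
    {X : Set V | deficiency G + X.ncard ≤ (oddComps G X).ncard} Set.ncard (Set.toFinite _) hne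
  exact ⟨S, hS, hmin⟩

theorem ncard_oddComps_le [Finite V] (S : Set V) :
    (oddComps G S).ncard ≤ deficiency G + S.ncard := by
  refine ncard_le_deficiency_add G S _ ?_ (fun K hK => hK.2) ?_
  · exact fun K hK K' hK' w hw hw' => hK.1.eq hK'.1 hw hw'
  · intro K hK a ha b hab
    by_cases hb : b ∈ S
    · exact Or.inr hb
    · exact Or.inl (hK.1.mem_of_adj ha hab hb)

theorem IsComp.subset_or_disjoint {s : V} {S K L : Set V} (hs : s ∈ S) (hK : IsComp G S K)
    (hL : IsComp G {s} L) : K ⊆ L ∨ K ⊆ Lᶜ := by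
  by_cases h : ∃ w ∈ K, w ∈ L
  · obtain ⟨w, hwK, hwL⟩ := h
    refine Or.inl (hL.subset_of_connSet hK.connSet (fun a ha => ?_) hwK hwL)
    rintro rfl
    exact hK.notMem ha hs
  · push Not at h
    exact Or.inr h

theorem ncard_split {α : Type*} [Finite α] (A : Set α) (p : α → Prop) :
    A.ncard = {x ∈ A | p x}.ncard + {x ∈ A | ¬ p x}.ncard := by
  rw [← Set.ncard_union_eq]
  · congr 1
    ext x
    by_cases hp : p x <;> simp [hp]
  · rw [Set.disjoint_left]
    exact fun x hx hx' => hx'.2 hx.2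

section Critical

variable [Finite V] {S : Set V}

/-- The easy half of the Tutte–Berge formula for a proper connected induced subgraph of a
deficiency-critical graph. -/
theorem DeficiencyCritical.ncard_lt (hc : DeficiencyCritical G) {W X : Set V}
    (hW : W ≠ Set.univ) (hWc : ConnSet G W) (hWne : W.Nonempty) (C : Set (Set V))
    (hCW : ∀ K ∈ C, K ⊆ W)
    (hdisj : ∀ K ∈ C, ∀ K' ∈ C, ∀ w, w ∈ K → w ∈ K' → K = K')
    (hodd : ∀ K ∈ C, Odd K.ncard)
    (hcl : ∀ K ∈ C, ∀ a ∈ K, ∀ b ∈ W, G.Adj a b → b ∈ K ∨ b ∈ X) :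
    C.ncard < deficiency G + (X ∩ W).ncard := by
  have h1 := ncard_le_deficiency_induce_add G W X C hCW hdisj hodd hcl
  have h2 := hc.2 W hW (hWc.induce hWne)
  omega

/-- With an empty barrier only one component exists, too few for deficiency two. -/
theorem MinBarrier.nonempty (hS : MinBarrier G S) (hG : G.Connected) (hd : 2 ≤ deficiency G) :
    S.Nonempty := by
  rw [Set.nonempty_iff_ne_empty]
  rintro rfl
  have h1 := hS.ge
  have h2 : (oddComps G ∅).ncard ≤ 1 := by
    rw [Set.ncard_le_one]
    intro K hK K' hK'
    obtain ⟨a, ha⟩ := hK.1.nonempty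
    obtain ⟨b, hb⟩ := hK'.1.nonempty
    refine hK.1.eq hK'.1 (w := b) ?_ hb
    rw [hK.1.eq_comp ha]
    have := connIn_univ_iff.2 (hG.preconnected a b)
    simpa [comp] using this
  omega

theorem ncard_inter_add_ncard_inter_compl (S L : Set V) :
    (S ∩ L).ncard + (S ∩ Lᶜ).ncard = S.ncard := by
  rw [← Set.sdiff_eq, Set.ncard_inter_add_ncard_sdiff_eq_ncard]

variable (hc : DeficiencyCritical G) (hd : 2 ≤ deficiency G) (hS : MinBarrier G S)

/-- Criticality applied to the connected proper subgraph `L` gives fewer than `deficiency G + |S ∩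
L|` odd components inside `L`; the rest of the barrier count must lie outside. -/
theorem oddComps_outside_ge (hc : DeficiencyCritical G) (hS : MinBarrier G S)
    {s : V} {L : Set V} (hL : IsComp G {s} L) :
    (S ∩ Lᶜ).ncard + 1 ≤ {K ∈ oddComps G S | ¬ K ⊆ L}.ncard := by
  have hsL : s ∉ L := fun h => hL.notMem h rfl
  have h1 := hc.ncard_lt (W := L) (X := S) (fun h => hsL (h ▸ Set.mem_univ s)) hL.connSet
    hL.nonempty {K ∈ oddComps G S | K ⊆ L} (fun K hK => hK.2)
    (fun K hK K' hK' w hw hw' => hK.1.1.eq hK'.1.1 hw hw') (fun K hK => hK.1.2)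
    (fun K hK a ha b _ hab => by
      by_cases hb : b ∈ S
      · exact Or.inr hb
      · exact Or.inl (hK.1.1.mem_of_adj ha hab hb))
  have h2 := ncard_split (oddComps G S) (fun K => K ⊆ L)
  have h3 := hS.ge
  have h4 := ncard_inter_add_ncard_inter_compl S L
  omega

/-- The mirror image of `oddComps_outside_ge`, testing criticality on `Lᶜ`. Here `s ∈ S` is needed
so that no component of `G - S` crosses between `L` and its complement. -/
theorem oddComps_inside_ge (hc : DeficiencyCritical G) (hS : MinBarrier G S)
    {s : V} (hs : s ∈ S) {L : Set V} (hL : IsComp G {s} L) :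
    (S ∩ L).ncard + 1 ≤ {K ∈ oddComps G S | K ⊆ L}.ncard := by
  have hsL : s ∉ L := fun h => hL.notMem h rfl
  have h1 := hc.ncard_lt (W := Lᶜ) (X := S)
    (fun h => by
      obtain ⟨v, hv⟩ := hL.nonempty
      exact (h ▸ Set.mem_univ v : v ∈ Lᶜ) hv)
    (hL.connSet_compl hc.1) ⟨s, hsL⟩ {K ∈ oddComps G S | ¬ K ⊆ L}
    (fun K hK => (hK.1.1.subset_or_disjoint hs hL).resolve_left hK.2)
    (fun K hK K' hK' w hw hw' => hK.1.1.eq hK'.1.1 hw hw') (fun K hK => hK.1.2)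
    (fun K hK a ha b _ hab => by
      by_cases hb : b ∈ S
      · exact Or.inr hb
      · exact Or.inl (hK.1.1.mem_of_adj ha hab hb))
  have h2 := ncard_split (oddComps G S) (fun K => K ⊆ L)
  have h3 := hS.ge
  have h4 := ncard_inter_add_ncard_inter_compl S L
  omega

/-- A component of `G - s` that does not meet the barrier is a pendent vertex. -/
theorem exists_pendant_of_inter_eq_empty (hc : DeficiencyCritical G) (hS : MinBarrier G S)
    {s : V} (hs : s ∈ S) {L : Set V} (hL : IsComp G {s} L) (hLS : S ∩ L = ∅) :
    ∃ a, L = {a} ∧ Pendant G s a := by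
  have hsL : s ∉ L := fun h => hL.notMem h rfl
  obtain ⟨a, haL, x, hx, hax⟩ := hL.exists_adj hc.1 (x₀ := s) rfl
  obtain rfl : x = s := hx
  have hLa : L = {a} := by
    by_contra hne
    have hex : ∃ b ∈ L, b ≠ a := by
      by_contra! h
      exact hne (Set.eq_singleton_iff_unique_mem.2 ⟨haL, h⟩)
    obtain ⟨b, hbL, hba⟩ := hex
    -- If `L` had a second vertex, shrinking it to the single neighbour `a` of the cut vertex would
    -- leave a proper connected subgraph. The odd component `{a}` stands in for `L`, so the
    -- deficiency does not drop.
    set W : Set V := insert a Lᶜ with hW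
    have hWc : ConnSet G W := by
      refine connSet_of_forall x fun c hc' => ?_
      rcases hc' with rfl | hc'
      · exact ConnIn.single hax (Or.inl rfl) (Or.inr hsL)
      · exact (hL.connSet_compl hc.1 c hc' x hsL).mono (Set.subset_insert _ _)
    have hin := oddComps_inside_ge hc hS hs hL
    have hKL : ∀ K ∈ oddComps G S, K ⊆ L → K = L := by
      intro K hK hKL
      refine Set.Subset.antisymm hKL ?_
      obtain ⟨w, hw⟩ := hK.1.nonempty
      exact hK.1.subset_of_connSet hL.connSet
        (fun c hc' hcS => Set.eq_empty_iff_forall_notMem.1 hLS c ⟨hcS, hc'⟩) (hKL hw) hw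
    have hle : {K ∈ oddComps G S | K ⊆ L}.ncard ≤ 1 := by
      rw [Set.ncard_le_one]
      intro K hK K' hK'
      rw [hKL K hK.1 hK.2, hKL K' hK'.1 hK'.2]
    have h1 := hc.ncard_lt (W := W) (X := S)
      (fun h => by
        rcases (h ▸ Set.mem_univ b : b ∈ W) with h' | h'
        · exact hba h'
        · exact h' hbL)
      hWc ⟨a, Or.inl rfl⟩ (insert {a} {K ∈ oddComps G S | ¬ K ⊆ L})
      (by
        rintro K (rfl | hK)
        · rintro _ rfl; exact Or.inl rfl
        · exact ((hK.1.1.subset_or_disjoint hs hL).resolve_left hK.2).trans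
            (Set.subset_insert _ _))
      (by
        have haux : ∀ K ∈ {K ∈ oddComps G S | ¬ K ⊆ L}, a ∉ K := fun K hK ha =>
          ((hK.1.1.subset_or_disjoint hs hL).resolve_left hK.2) ha haL
        rintro K (rfl | hK) K' (rfl | hK') w hw hw'
        · rfl
        · rw [Set.mem_singleton_iff] at hw; subst hw; exact absurd hw' (haux K' hK')
        · rw [Set.mem_singleton_iff] at hw'; subst hw'; exact absurd hw (haux K hK)
        · exact hK.1.1.eq hK'.1.1 hw hw')
      (by
        rintro K (rfl | hK)
        · simp
        · exact hK.1.2)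
      (by
        rintro K (rfl | hK) c hcK d hdW hcd
        · rw [Set.mem_singleton_iff] at hcK
          subst hcK
          rcases hdW with rfl | hdW
          · exact Or.inl rfl
          · by_cases hds : d = x
            · exact Or.inr (hds ▸ hs)
            · exact absurd (hL.mem_of_adj haL hcd (by simpa using hds)) hdW
        · by_cases hb : d ∈ S
          · exact Or.inr hb
          · exact Or.inl (hK.1.1.mem_of_adj hcK hcd hb))
    rw [Set.ncard_insert_of_notMem (fun h => h.2 (by simpa using haL)) (Set.toFinite _)] at h1
    have h2 := ncard_split (oddComps G S) (fun K => K ⊆ L)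
    have h3 := hS.ge
    have h4 : (S ∩ W).ncard ≤ S.ncard := Set.ncard_le_ncard Set.inter_subset_left (Set.toFinite _)
    omega
  refine ⟨a, hLa, fun w => ⟨fun hw => ?_, fun hw => hw ▸ hax⟩⟩
  by_contra hws
  have := hL.mem_of_adj haL hw (by simpa using hws)
  rw [hLa] at this
  exact hw.ne this.symm

/-- A vertex of the barrier `S` all but at most one of whose components contain no vertex of
`S`. -/
def IsTip (G : SimpleGraph V) (S : Set V) (e : V) : Prop :=
  e ∈ S ∧ ∃ L₀, IsComp G {e} L₀ ∧ ∀ L, IsComp G {e} L → L ≠ L₀ → S ∩ L = ∅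

/-- Outside the exceptional component `L₀` the barrier still contains `e`, so at least two odd
components lie there. Each sits in a component of `G - e` free of barrier vertices, hence is a
pendent vertex at `e`. -/
theorem IsTip.isEnd (hc : DeficiencyCritical G) (hS : MinBarrier G S) {e : V}
    (he : IsTip G S e) : IsEnd G e := by
  obtain ⟨heS, L₀, hL₀, hall⟩ := he
  have h1 := oddComps_outside_ge hc hS hL₀
  have h2 : 1 ≤ (S ∩ L₀ᶜ).ncard :=
    (Set.ncard_pos (Set.toFinite _)).2 ⟨e, heS, fun h => hL₀.notMem h rfl⟩
  have h3 : 1 < {K ∈ oddComps G S | ¬ K ⊆ L₀}.ncard := by omega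
  rw [Set.one_lt_ncard] at h3
  obtain ⟨K, hK, K', hK', hne⟩ := h3
  have key : ∀ K ∈ {K ∈ oddComps G S | ¬ K ⊆ L₀}, ∃ a, K = {a} ∧ Pendant G e a := by
    intro K hK
    obtain ⟨w, hw⟩ := hK.1.1.nonempty
    have hwe : w ∉ ({e} : Set V) := by
      rintro rfl
      exact hK.1.1.notMem hw heS
    have hL := isComp_comp (G := G) hwe
    have hKL : K ⊆ comp G {e} w := by
      rcases hK.1.1.subset_or_disjoint heS hL with h | h
      · exact h
      · exact absurd mem_comp_self (h hw)
    obtain ⟨a, ha, hp⟩ := exists_pendant_of_inter_eq_empty hc hS heS hL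
      (hall _ hL fun h => hK.2 (h ▸ hKL))
    refine ⟨a, ?_, hp⟩
    rw [ha] at hKL
    exact (Set.subset_singleton_iff_eq.1 hKL).resolve_left hK.1.1.nonempty.ne_empty
  obtain ⟨a, rfl, ha⟩ := key K hK
  obtain ⟨b, rfl, hb⟩ := key K' hK'
  exact ⟨a, b, fun h => hne (h ▸ rfl), ha, hb⟩

/-- A component of `G - s` that meets the barrier contains a tip. -/
theorem exists_isTip (hc : DeficiencyCritical G) {s : V} {L : Set V}
    (hL : IsComp G {s} L) (hLS : (S ∩ L).Nonempty) : ∃ e ∈ L, IsTip G S e := by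
  have hsL : s ∉ L := fun h => hL.notMem h rfl
  -- Take the barrier vertex of `L` that is farthest from `s`, in the sense that deleting it leaves
  -- `s` in the largest possible component; that component serves as the exceptional one.
  obtain ⟨t, ht, hmax⟩ := Set.exists_max_image (S ∩ L) (fun t => (comp G {t} s).ncard)
    (Set.toFinite _) hLS
  have hts : s ≠ t := fun h => hsL (h ▸ ht.2)
  refine ⟨t, ht.2, ht.1, comp G {t} s, isComp_comp (by simpa using hts), ?_⟩
  intro L' hL' hne
  by_contra hLS'
  obtain ⟨u, huS, huL'⟩ := Set.nonempty_iff_ne_empty.2 hLS'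
  have hsL' : s ∉ L' := fun h => hne (hL'.eq_comp h)
  have htL' : t ∉ L' := fun h => hL'.notMem h rfl
  obtain ⟨a, haL', x, hx, hax⟩ := hL'.exists_adj hc.1 (x₀ := t) rfl
  obtain rfl : x = t := hx
  -- `L'` together with `x` is connected and avoids `s`
  have hc1 : ConnSet G (insert x L') := by
    refine connSet_of_forall a fun b hb => ?_
    rcases hb with rfl | hb
    · exact ConnIn.single hax.symm (Or.inl rfl) (Or.inr haL')
    · exact (hL'.connSet b hb a haL').mono (Set.subset_insert _ _)
  have huL : u ∈ L := by
    refine hL.subset_of_connSet hc1 ?_ (Set.mem_insert _ _) ht.2 (Or.inr huL')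
    rintro b (rfl | hb) rfl
    · exact hts rfl
    · exact hsL' hb
  -- Deleting a barrier vertex `u` beyond `x` keeps the whole old component of `s` and adds `x` to
  -- it, against the maximal choice.
  have hlt : (comp G {x} s).ncard < (comp G {u} s).ncard := by
    have hxs := isComp_comp (G := G) (X := {x}) (v := s) (by simpa using hts)
    have hus := isComp_comp (G := G) (X := {u}) (v := s) (by
      rintro rfl; exact hsL' huL')
    obtain ⟨b, hb, y, hy, hby⟩ := hxs.exists_adj hc.1 (x₀ := x) rfl
    obtain rfl : y = x := hy
    have hu : u ∉ comp G {y} s := fun h => hne (hL'.eq hxs huL' h)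
    have hsub : comp G {y} s ⊆ comp G {u} s :=
      hus.subset_of_connSet hxs.connSet (fun c hc' hcu => hu (hcu ▸ hc')) mem_comp_self
        mem_comp_self
    refine Set.ncard_lt_ncard ⟨hsub, fun h => ?_⟩ (Set.toFinite _)
    have : y ∈ comp G {u} s := hus.mem_of_adj (hsub hb) hby (by
      rintro rfl; exact htL' huL')
    exact hxs.notMem (h this) rfl
  exact absurd (hmax u ⟨huS, huL⟩) (not_le.2 hlt)

/-- A vertex of the barrier that is not a tip separates two tips. -/
theorem exists_two_tips (hc : DeficiencyCritical G) (hS : MinBarrier G S)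
    (hd : 2 ≤ deficiency G) {s : V} (hs : s ∈ S) (hns : ¬ IsTip G S s) :
    ∃ L L', IsComp G {s} L ∧ IsComp G {s} L' ∧ L ≠ L' ∧ (∃ e ∈ L, IsTip G S e) ∧
      ∃ e ∈ L', IsTip G S e := by
  have hex : ∃ L, IsComp G {s} L := by
    by_contra! h
    have hall : ∀ v, v = s := by
      intro v
      by_contra hv
      exact h _ (isComp_comp (by simpa using hv))
    have h1 := hS.ge
    have h2 : (oddComps G S) = ∅ := by
      ext K
      simp only [Set.mem_empty_iff_false, iff_false]
      intro hK
      obtain ⟨w, hw⟩ := hK.1.nonempty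
      exact hK.1.notMem hw (hall w ▸ hs)
    rw [h2] at h1
    simp at h1
    omega
  obtain ⟨L₁, hL₁⟩ := hex
  have h1 : ∃ L, IsComp G {s} L ∧ (S ∩ L).Nonempty := by
    by_contra! h
    exact hns ⟨hs, L₁, hL₁, fun L hL _ => h L hL⟩
  obtain ⟨L, hL, hLS⟩ := h1
  have h2 : ∃ L', IsComp G {s} L' ∧ L' ≠ L ∧ (S ∩ L').Nonempty := by
    by_contra! h
    exact hns ⟨hs, L, hL, h⟩
  obtain ⟨L', hL', hne, hLS'⟩ := h2
  exact ⟨L, L', hL, hL', hne.symm, exists_isTip hc hL hLS, exists_isTip hc hL' hLS'⟩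

/-- Every vertex of a smallest barrier is adjacent to at least three odd components. -/
theorem three_le_oddComps_adj (hS : MinBarrier G S) {s : V} (hs : s ∈ S) :
    3 ≤ {K ∈ oddComps G S | ∃ a ∈ K, G.Adj s a}.ncard := by
  by_contra! hlt
  -- Returning `s` to the graph merges only the components adjacent to it; all others survive as odd
  -- components.
  have hsub : {K ∈ oddComps G S | ¬ ∃ a ∈ K, G.Adj s a} ⊆ oddComps G (S \ {s}) := by
    rintro K ⟨hK, hna⟩
    refine ⟨isComp_of_connSet hK.1.nonempty hK.1.connSet (fun a ha h => hK.1.notMem ha h.1) ?_,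
      hK.2⟩
    intro a ha b hab
    by_cases hb : b ∈ S
    · exact Or.inr ⟨hb, fun h => hna ⟨a, ha, (Set.mem_singleton_iff.1 h ▸ hab).symm⟩⟩
    · exact Or.inl (hK.1.mem_of_adj ha hab hb)
  have h1 := Set.ncard_le_ncard hsub (Set.toFinite _)
  have h2 := ncard_split (oddComps G S) (fun K => ∃ a ∈ K, G.Adj s a)
  have h3 := Set.ncard_sdiff_singleton_add_one hs (Set.toFinite S)
  have h4 := hS.ge
  have h4' := ncard_oddComps_le (G := G) S
  -- Losing at most two odd components leaves the count for `S \ {s}` at most one short of a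
  -- barrier. Parity removes that one, so `S \ {s}` would be a smaller barrier.
  obtain ⟨a, h5⟩ := oddComps_parity G S
  obtain ⟨b, h6⟩ := oddComps_parity G (S \ {s})
  have h7 := hS.min (S \ {s})
  omega

/-- For all components `L` of `G - s`, with one possible exception, `s` has two non-adjacent
neighbours outside `L`. -/
theorem exists_fork_outside (hS : MinBarrier G S) {s : V} (hs : s ∈ S) :
    ∃ L₂, ∀ L, IsComp G {s} L → L ≠ L₂ → ∃ a b, Fork G s a b ∧ a ∉ L ∧ b ∉ L := by
  have h3 : 2 < {K ∈ oddComps G S | ∃ a ∈ K, G.Adj s a}.ncard := three_le_oddComps_adj hS hs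
  rw [Set.two_lt_ncard (Set.toFinite _)] at h3
  obtain ⟨K₁, ⟨hK₁, a₁, h1, hs1⟩, K₂, ⟨hK₂, a₂, h2, hs2⟩, K₃, ⟨hK₃, a₃, h3, hs3⟩, h12, h13,
    h23⟩ := h3
  have hfork : ∀ K K' : Set V, K ∈ oddComps G S → K' ∈ oddComps G S → K ≠ K' → ∀ a ∈ K,
      ∀ b ∈ K', G.Adj s a → G.Adj s b → Fork G s a b := by
    intro K K' hK hK' hne a ha b hb hsa hsb
    refine ⟨hsa, hsb, fun h => hne (hK.1.eq hK'.1 ha (h ▸ hb)), fun h => ?_⟩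
    exact hne (hK.1.eq hK'.1 (hK.1.mem_of_adj ha h (hK'.1.notMem hb)) hb)
  have f12 := hfork K₁ K₂ hK₁ hK₂ h12 a₁ h1 a₂ h2 hs1 hs2
  have f13 := hfork K₁ K₃ hK₁ hK₃ h13 a₁ h1 a₃ h3 hs1 hs3
  have f23 := hfork K₂ K₃ hK₂ hK₃ h23 a₂ h2 a₃ h3 hs2 hs3
  -- If `a₁` shares its component of `G - s` with another `aᵢ`, any other component misses both. If
  -- not, a component different from that of `a₂` misses `a₂` and at least one of `a₁`, `a₃`.
  by_cases hcase : comp G {s} a₁ = comp G {s} a₂ ∨ comp G {s} a₁ = comp G {s} a₃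
  · refine ⟨comp G {s} a₁, fun L hL hne => ?_⟩
    have ha1 : a₁ ∉ L := fun h => hne (hL.eq_comp h)
    rcases hcase with h | h
    · exact ⟨a₁, a₂, f12, ha1, fun h' => hne ((hL.eq_comp h').trans h.symm)⟩
    · exact ⟨a₁, a₃, f13, ha1, fun h' => hne ((hL.eq_comp h').trans h.symm)⟩
  · push Not at hcase
    refine ⟨comp G {s} a₂, fun L hL hne => ?_⟩
    have ha2 : a₂ ∉ L := fun h => hne (hL.eq_comp h)
    by_cases ha1 : a₁ ∈ L
    · exact ⟨a₂, a₃, f23, ha2, fun h => hcase.2 ((hL.eq_comp ha1).symm.trans (hL.eq_comp h))⟩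
    · exact ⟨a₁, a₂, f12, ha1, ha2⟩

/-- A component of `G - S` is a pendent vertex, or it is adjacent to two vertices of `S`. -/
theorem pendant_or_two_adj (hc : DeficiencyCritical G) (hS : MinBarrier G S)
    (hSne : S.Nonempty) {K : Set V} (hK : IsComp G S K) :
    (∃ s ∈ S, ∃ a, K = {a} ∧ Pendant G s a) ∨
      ∃ s ∈ S, ∃ t ∈ S, s ≠ t ∧ (∃ a ∈ K, G.Adj s a) ∧ ∃ a ∈ K, G.Adj t a := by
  obtain ⟨x₀, hx₀⟩ := hSne
  obtain ⟨a, ha, s, hs, has⟩ := hK.exists_adj hc.1 hx₀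
  by_cases h : ∃ t ∈ S, t ≠ s ∧ ∃ b ∈ K, G.Adj t b
  · obtain ⟨t, ht, hts, b, hb, htb⟩ := h
    exact Or.inr ⟨s, hs, t, ht, hts.symm, ⟨a, ha, has.symm⟩, b, hb, htb⟩
  · push Not at h
    left
    -- With `s` as its only neighbour in the barrier, `K` is already cut off by `s` alone and
    -- contains no barrier vertex, so it is pendent.
    have hK' : IsComp G {s} K := by
      refine isComp_of_connSet hK.nonempty hK.connSet
        (fun b hb hbs => hK.notMem hb (Set.mem_singleton_iff.1 hbs ▸ hs)) ?_
      intro b hb c hbc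
      by_cases hcS : c ∈ S
      · by_cases hcs : c = s
        · exact Or.inr hcs
        · exact absurd hbc.symm (h c hcS hcs b hb)
      · exact Or.inl (hK.mem_of_adj hb hbc hcS)
    obtain ⟨b, hb, hp⟩ := exists_pendant_of_inter_eq_empty hc hS hs hK' (by
      ext w
      simp only [Set.mem_inter_iff, Set.mem_empty_iff_false, iff_false]
      exact fun hw => hK.notMem hw.2 hw.1)
    exact ⟨s, hs, b, hb, hp⟩

end Critical

end BoneDeficiency

/-! ### Induced paths and the bones they produce. -/

namespace BoneDeficiency

variable {V : Type*} {G : SimpleGraph V}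

/-- `P 0, …, P l` is an induced path of `G`. -/
structure IPath (G : SimpleGraph V) (P : ℕ → V) (l : ℕ) : Prop where
  inj : ∀ i j, i ≤ l → j ≤ l → P i = P j → i = j
  adj : ∀ i j, i ≤ l → j ≤ l → (G.Adj (P i) (P j) ↔ i + 1 = j ∨ j + 1 = i)

namespace IPath

variable {P Q : ℕ → V} {l m : ℕ}

theorem const (v : V) : IPath G (fun _ => v) 0 :=
  ⟨fun i j hi hj _ => by omega, fun i j hi hj => by simp; omega⟩

theorem shift (hP : IPath G P l) {a m : ℕ} (h : a + m ≤ l) : IPath G (fun j => P (a + j)) m :=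
  ⟨fun i j hi hj he => by have := hP.inj _ _ (by omega) (by omega) he; omega,
   fun i j hi hj => by rw [hP.adj _ _ (by omega) (by omega)]; omega⟩

theorem down (hP : IPath G P l) {a m : ℕ} (h : m ≤ a) (ha : a ≤ l) :
    IPath G (fun j => P (a - j)) m :=
  ⟨fun i j hi hj he => by have := hP.inj _ _ (by omega) (by omega) he; omega,
   fun i j hi hj => by rw [hP.adj _ _ (by omega) (by omega)]; omega⟩

theorem ne (hP : IPath G P l) {i j : ℕ} (hi : i ≤ l) (hj : j ≤ l) (h : i ≠ j) : P i ≠ P j :=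
  fun he => h (hP.inj i j hi hj he)

theorem adj_succ (hP : IPath G P l) {i : ℕ} (hi : i < l) : G.Adj (P i) (P (i + 1)) :=
  (hP.adj i (i + 1) (by omega) (by omega)).2 (Or.inl rfl)

theorem not_adj (hP : IPath G P l) {i j : ℕ} (hi : i ≤ l) (hj : j ≤ l) (h : i + 1 ≠ j)
    (h' : j + 1 ≠ i) : ¬ G.Adj (P i) (P j) := by
  rw [hP.adj i j hi hj]
  omega

/-- Two induced paths that are joined by the edge from the end of the first to the start of
the second, and by no other edge. -/
theorem join (hP : IPath G P l) (hQ : IPath G Q m) (hadj : G.Adj (P l) (Q 0))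
    (hne : ∀ i j, i ≤ l → j ≤ m → P i ≠ Q j)
    (hno : ∀ i j, i ≤ l → j ≤ m → G.Adj (P i) (Q j) → i = l ∧ j = 0) :
    IPath G (fun k => if k ≤ l then P k else Q (k - l - 1)) (l + m + 1) := by
  refine ⟨fun i j hi hj he => ?_, fun i j hi hj => ?_⟩
  · split_ifs at he with h1 h2 h2
    · exact hP.inj i j h1 h2 he
    · exact absurd he (hne _ _ h1 (by omega))
    · exact absurd he.symm (hne _ _ h2 (by omega))
    · have := hQ.inj _ _ (by omega) (by omega) he
      omega
  · split_ifs with h1 h2 h2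
    · exact hP.adj i j h1 h2
    · constructor
      · intro h
        have := hno _ _ h1 (by omega) h
        omega
      · intro h
        obtain rfl : i = l := by omega
        have : j - i - 1 = 0 := by omega
        rw [this]
        exact hadj
    · constructor
      · intro h
        have := hno _ _ h2 (by omega) h.symm
        omega
      · intro h
        obtain rfl : j = l := by omega
        have : i - j - 1 = 0 := by omega
        rw [this]
        exact hadj.symm
    · rw [hQ.adj _ _ (by omega) (by omega)]
      omega

end IPath

/-- A shortest path inside `K` from `a` to the set `T`. -/
theorem exists_ipath {K T : Set V} {a b : V} (ha : a ∈ K) (h : ConnIn G K a b) (hb : b ∈ T) :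
    ∃ P l, IPath G P l ∧ P 0 = a ∧ P l ∈ T ∧ (∀ i ≤ l, P i ∈ K) ∧ ∀ i < l, P i ∉ T := by
  classical
  have hex : ∃ n, ∃ P : ℕ → V, P 0 = a ∧ P n ∈ T ∧ (∀ i ≤ n, P i ∈ K) ∧
      ∀ i < n, G.Adj (P i) (P (i + 1)) := by
    have : ∃ n, ∃ P : ℕ → V, P 0 = a ∧ P n = b ∧ (∀ i ≤ n, P i ∈ K) ∧
        ∀ i < n, G.Adj (P i) (P (i + 1)) := by
      clear hb
      induction h with
      | refl => exact ⟨0, fun _ => a, rfl, rfl, fun _ _ => ha, fun i hi => absurd hi (by omega)⟩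
      | @tail b c _ hbc ih =>
        obtain ⟨n, P, h0, hn, hK, hadj⟩ := ih
        refine ⟨n + 1, fun k => if k ≤ n then P k else c, by simp [h0], by simp, ?_, ?_⟩
        · intro i hi
          dsimp only
          split_ifs with h'
          · exact hK i h'
          · exact hbc.2.2
        · intro i hi
          have h1 : i ≤ n := by omega
          simp only [h1, if_true]
          split_ifs with h'
          · exact hadj i h'
          · obtain rfl : i = n := by omega
            rw [hn]
            exact hbc.1
    obtain ⟨n, P, h0, hn, h1, h2⟩ := this
    exact ⟨n, P, h0, hn ▸ hb, h1, h2⟩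
  obtain ⟨P, h0, hn, hK, hadj⟩ := Nat.find_spec hex
  set l := Nat.find hex with hl
  have hmin : ∀ n, (∃ P : ℕ → V, P 0 = a ∧ P n ∈ T ∧ (∀ i ≤ n, P i ∈ K) ∧
      ∀ i < n, G.Adj (P i) (P (i + 1))) → l ≤ n := fun n hn => Nat.find_min' hex hn
  -- no shortcuts
  have hshort : ∀ i j, i < j → j ≤ l → ¬ (G.Adj (P i) (P j) ∧ i + 1 < j) := by
    rintro i j hij hj ⟨hA, hlt⟩
    have := hmin (l - (j - i - 1)) ⟨fun k => if k ≤ i then P k else P (k + (j - i - 1)),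
      by simp [h0], ?_, ?_, ?_⟩
    · omega
    · dsimp only
      rw [if_neg (by omega)]
      convert hn using 2
      omega
    · intro k hk
      dsimp only
      split_ifs
      · exact hK _ (by omega)
      · exact hK _ (by omega)
    · intro k hk
      dsimp only
      split_ifs with h1 h2 h2
      · exact hadj k (by omega)
      · obtain rfl : k = i := by omega
        convert hA using 2
        omega
      · omega
      · convert hadj (k + (j - i - 1)) (by omega) using 2
        omega
  have hdist : ∀ i j, i < j → j ≤ l → P i ≠ P j := by
    intro i j hij hj he
    have := hmin (l - (j - i)) ⟨fun k => if k ≤ i then P k else P (k + (j - i)),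
      by simp [h0], ?_, ?_, ?_⟩
    · omega
    · dsimp only
      split_ifs with h1
      · have h2 : l - (j - i) = i := by omega
        rw [h2, he]
        convert hn using 2
        omega
      · convert hn using 2
        omega
    · intro k hk
      dsimp only
      split_ifs
      · exact hK _ (by omega)
      · exact hK _ (by omega)
    · intro k hk
      dsimp only
      split_ifs with h1 h2 h2
      · exact hadj k (by omega)
      · obtain rfl : k = i := by omega
        rw [he]
        convert hadj j (by omega) using 2
        omega
      · omega
      · convert hadj (k + (j - i)) (by omega) using 2
        omega
  refine ⟨P, l, ⟨?_, ?_⟩, h0, hn, hK, ?_⟩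
  · intro i j hi hj he
    rcases lt_trichotomy i j with h | h | h
    · exact absurd he (hdist i j h hj)
    · exact h
    · exact absurd he.symm (hdist j i h hi)
  · intro i j hi hj
    constructor
    · intro hA
      rcases lt_trichotomy i j with h | h | h
      · have := hshort i j h hj
        simp only [hA, true_and] at this
        omega
      · exact absurd (h ▸ hA) (G.loopless.irrefl _)
      · have := hshort j i h hi
        simp only [hA.symm, true_and] at this
        omega
    · rintro (rfl | rfl)
      · exact hadj i (by omega)
      · exact (hadj j (by omega)).symm
  · intro i hi hiT
    have := hmin i ⟨P, h0, hiT, fun k hk => hK k (by omega), fun k hk => hadj k (by omega)⟩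
    omega

/-! ### Bones -/

theorem bone_adj_inl_inl {i : ℕ} {a b : Fin i} :
    (bone i).Adj (.inl a) (.inl b) ↔ a.val + 1 = b.val ∨ b.val + 1 = a.val := by
  simp only [bone, SimpleGraph.fromRel_adj, ne_eq, Sum.inl.injEq]
  constructor
  · exact fun h => h.2
  · intro h
    refine ⟨?_, h⟩
    rintro rfl
    omega

theorem bone_adj_inl_false {i : ℕ} {a : Fin i} {k : Fin 2} :
    (bone i).Adj (.inl a) (.inr (false, k)) ↔ a.val = 0 := by
  simp [bone, SimpleGraph.fromRel_adj]

theorem bone_adj_inl_true {i : ℕ} {a : Fin i} {k : Fin 2} :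
    (bone i).Adj (.inl a) (.inr (true, k)) ↔ a.val + 1 = i := by
  simp [bone, SimpleGraph.fromRel_adj]

theorem not_bone_adj_inr_inr {i : ℕ} {x y : Bool × Fin 2} :
    ¬ (bone i).Adj (.inr x) (.inr y) := by
  rintro ⟨-, h | h⟩ <;> exact h

/-- An induced path with a fork at each end is an induced bone. -/
theorem bone_isIndContained {P : ℕ → V} {l : ℕ} (hP : IPath G P l) (hl : 1 ≤ l) {a b : Fin 2 → V}
    (ha : ∀ k, G.Adj (P 0) (a k)) (ha' : a 0 ≠ a 1) (ha'' : ¬ G.Adj (a 0) (a 1))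
    (hb : ∀ k, G.Adj (P l) (b k)) (hb' : b 0 ≠ b 1) (hb'' : ¬ G.Adj (b 0) (b 1))
    (haP : ∀ k i, 0 < i → i ≤ l → ¬ G.Adj (a k) (P i))
    (hbP : ∀ k i, i < l → ¬ G.Adj (b k) (P i))
    (hab : ∀ k k', ¬ G.Adj (a k) (b k')) : (bone (l + 1)).IsIndContained G := by
  have haa : ∀ k k', ¬ G.Adj (a k) (a k') := by
    intro k k' h
    fin_cases k <;> fin_cases k' <;>
      first | exact G.loopless.irrefl _ h | exact ha'' h | exact ha'' h.symm
  have hbb : ∀ k k', ¬ G.Adj (b k) (b k') := by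
    intro k k' h
    fin_cases k <;> fin_cases k' <;>
      first | exact G.loopless.irrefl _ h | exact hb'' h | exact hb'' h.symm
  have hainj : ∀ k k', a k = a k' → k = k' := by
    intro k k' h
    fin_cases k <;> fin_cases k' <;> first | rfl | exact absurd h ha' | exact absurd h.symm ha'
  have hbinj : ∀ k k', b k = b k' → k = k' := by
    intro k k' h
    fin_cases k <;> fin_cases k' <;> first | rfl | exact absurd h hb' | exact absurd h.symm hb'
  have haneP : ∀ k i, i ≤ l → P i ≠ a k := by
    intro k i hi he
    have h1 := ha k
    rw [← he, hP.adj _ _ (by omega) hi] at h1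
    obtain rfl : i = 1 := by omega
    by_cases h2 : l = 1
    · subst h2
      exact hab k 0 (he ▸ hb 0)
    · exact haP k 2 (by omega) (by omega) (he ▸ hP.adj_succ (i := 1) (by omega))
  have hbneP : ∀ k i, i ≤ l → P i ≠ b k := by
    intro k i hi he
    have h1 := hb k
    rw [← he, hP.adj _ _ (by omega) hi] at h1
    obtain rfl : l = i + 1 := by omega
    by_cases h2 : i = 0
    · subst h2
      exact hab 0 k (he ▸ (ha 0).symm)
    · refine hbP k (i - 1) (by omega) (he ▸ (hP.adj _ _ (by omega) (by omega)).2 (by omega))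
  have habne : ∀ k k', a k ≠ b k' := by
    intro k k' he
    exact hbP k' 0 (by omega) (he ▸ (ha k).symm)
  have hPa : ∀ k i, i ≤ l → (G.Adj (P i) (a k) ↔ i = 0) := by
    intro k i hi
    constructor
    · intro h
      by_contra h0
      exact haP k i (by omega) hi h.symm
    · rintro rfl
      exact ha k
  have hPb : ∀ k i, i ≤ l → (G.Adj (P i) (b k) ↔ i + 1 = l + 1) := by
    intro k i hi
    constructor
    · intro h
      by_contra h0
      exact hbP k i (by omega) h.symm
    · intro h
      obtain rfl : i = l := by omega
      exact hb k
  let f : Fin (l + 1) ⊕ Bool × Fin 2 → V := fun x =>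
    match x with
    | .inl i => P i.val
    | .inr (false, k) => a k
    | .inr (true, k) => b k
  have hinj : Function.Injective f := by
    rintro (i | ⟨_ | _, k⟩) (j | ⟨_ | _, k'⟩) h
    · exact congrArg _ (Fin.ext (hP.inj _ _ (by omega) (by omega) h))
    · exact absurd h (haneP _ _ (by omega))
    · exact absurd h (hbneP _ _ (by omega))
    · exact absurd h.symm (haneP _ _ (by omega))
    · rw [hainj k k' h]
    · exact absurd h (habne _ _)
    · exact absurd h.symm (hbneP _ _ (by omega))
    · exact absurd h.symm (habne _ _)
    · rw [hbinj k k' h]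
  refine ⟨⟨⟨f, hinj⟩, ?_⟩⟩
  rintro (i | ⟨_ | _, k⟩) (j | ⟨_ | _, k'⟩)
  · rw [bone_adj_inl_inl]
    exact hP.adj _ _ (by omega) (by omega)
  · rw [bone_adj_inl_false]
    exact hPa _ _ (by omega)
  · rw [bone_adj_inl_true]
    exact hPb _ _ (by omega)
  · rw [SimpleGraph.adj_comm, SimpleGraph.adj_comm (bone _), bone_adj_inl_false]
    exact hPa _ _ (by omega)
  · exact iff_of_false (haa _ _) not_bone_adj_inr_inr
  · exact iff_of_false (hab _ _) not_bone_adj_inr_inr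
  · rw [SimpleGraph.adj_comm, SimpleGraph.adj_comm (bone _), bone_adj_inl_true]
    exact hPb _ _ (by omega)
  · exact iff_of_false (fun h => hab _ _ h.symm) not_bone_adj_inr_inr
  · exact iff_of_false (hbb _ _) not_bone_adj_inr_inr

/-- All bones `B_i` that are induced subgraphs of `G` have `i ∈ A`. -/
def BonesIn (A : Set ℕ) (G : SimpleGraph V) : Prop :=
  ∀ i : ℕ, 2 ≤ i → (bone i).IsIndContained G → i ∈ A

theorem Pendant.ne_of_isEnd {e a : V} (h : Pendant G e a) : ¬ IsEnd G a := by
  rintro ⟨b, c, hbc, hb, hc⟩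
  exact hbc (((h b).1 hb.adj).trans ((h c).1 hc.adj).symm)

variable {A : Set ℕ} {P Q : ℕ → V} {l m : ℕ}

/-- A path with `l` edges has `l + 1` vertices, which explains the index. Only the fork at the start
has to be kept away from the path; the pendent vertices at the other end see nothing else. -/
theorem IPath.mem_of_fork (hP : IPath G P l) (hA : BonesIn A G) (hl : 1 ≤ l) {a b : V}
    (hf : Fork G (P 0) a b) (hPa : ∀ i, 0 < i → i ≤ l → ¬ G.Adj a (P i))
    (hPb : ∀ i, 0 < i → i ≤ l → ¬ G.Adj b (P i)) (ha : a ≠ P l) (hb : b ≠ P l)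
    (hend : IsEnd G (P l)) : l + 1 ∈ A := by
  obtain ⟨c, d, hcd, hc, hd⟩ := hend
  refine hA _ (by omega) (bone_isIndContained hP hl (a := ![a, b]) (b := ![c, d]) ?_ hf.2.2.1
    hf.2.2.2 ?_ hcd ?_ ?_ ?_ ?_)
  · intro k; fin_cases k
    · exact hf.1
    · exact hf.2.1
  · intro k; fin_cases k
    · exact hc.adj
    · exact hd.adj
  · intro h
    exact hd.adj.ne ((hc d).1 h).symm
  · intro k; fin_cases k
    · exact hPa
    · exact hPb
  · intro k i hi
    fin_cases k
    · intro h
      exact hP.ne (by omega) le_rfl (by omega) ((hc _).1 h)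
    · intro h
      exact hP.ne (by omega) le_rfl (by omega) ((hd _).1 h)
  · intro k k' h
    have h' := h.symm
    fin_cases k <;> fin_cases k'
    · exact ha ((hc _).1 h')
    · exact ha ((hd _).1 h')
    · exact hb ((hc _).1 h')
    · exact hb ((hd _).1 h')

theorem IPath.mem_of_isEnd (hP : IPath G P l) (hA : BonesIn A G) (hl : 1 ≤ l)
    (h0 : IsEnd G (P 0)) (hend : IsEnd G (P l)) : l + 1 ∈ A := by
  obtain ⟨c, d, hcd, hc, hd⟩ := h0
  refine hP.mem_of_fork hA hl (a := c) (b := d)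
    ⟨hc.adj, hd.adj, hcd, fun h => hd.adj.ne ((hc d).1 h).symm⟩ ?_ ?_ ?_ ?_ hend
  · intro i hi hil h
    exact hP.ne hil (by omega) (by omega) ((hc _).1 h)
  · intro i hi hil h
    exact hP.ne hil (by omega) (by omega) ((hd _).1 h)
  · rintro rfl
    exact hc.ne_of_isEnd hend
  · rintro rfl
    exact hd.ne_of_isEnd hend

theorem IPath.mem_of_isEnd_join (hP : IPath G P l) (hQ : IPath G Q m) (hA : BonesIn A G)
    (hadj : G.Adj (P l) (Q 0)) (hne : ∀ i j, i ≤ l → j ≤ m → P i ≠ Q j)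
    (hno : ∀ i j, i ≤ l → j ≤ m → G.Adj (P i) (Q j) → i = l ∧ j = 0)
    (h0 : IsEnd G (P 0)) (hend : IsEnd G (Q m)) : l + m + 1 + 1 ∈ A := by
  refine (hP.join hQ hadj hne hno).mem_of_isEnd hA (by omega) (by simpa using h0) ?_
  rw [if_neg (by omega)]
  convert hend using 2
  omega

theorem IPath.mem_of_fork_join (hP : IPath G P l) (hQ : IPath G Q m) (hA : BonesIn A G)
    (hadj : G.Adj (P l) (Q 0)) (hne : ∀ i j, i ≤ l → j ≤ m → P i ≠ Q j)
    (hno : ∀ i j, i ≤ l → j ≤ m → G.Adj (P i) (Q j) → i = l ∧ j = 0)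
    {a b : V} (hf : Fork G (P 0) a b)
    (hPa : ∀ i, 0 < i → i ≤ l → ¬ G.Adj a (P i)) (hPb : ∀ i, 0 < i → i ≤ l → ¬ G.Adj b (P i))
    (hQa : ∀ i, i ≤ m → ¬ G.Adj a (Q i)) (hQb : ∀ i, i ≤ m → ¬ G.Adj b (Q i))
    (ha : a ≠ Q m) (hb : b ≠ Q m) (hend : IsEnd G (Q m)) : l + m + 1 + 1 ∈ A := by
  have hlast : (if l + m + 1 ≤ l then P (l + m + 1) else Q (l + m + 1 - l - 1)) = Q m := by
    rw [if_neg (by omega)]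
    congr 1
    omega
  refine (hP.join hQ hadj hne hno).mem_of_fork hA (by omega) (a := a) (b := b)
    (by simpa using hf) ?_ ?_ ?_ ?_ ?_
  · intro i hi hil
    split_ifs with h
    · exact hPa i hi h
    · exact hQa _ (by omega)
  · intro i hi hil
    split_ifs with h
    · exact hPb i hi h
    · exact hQb _ (by omega)
  · rw [hlast]; exact ha
  · rw [hlast]; exact hb
  · rw [hlast]; exact hend

end BoneDeficiency

/-! ### The arithmetic of bone lengths, and a third end meeting a path between two ends. -/

namespace BoneDeficiency

variable {V : Type*} {G : SimpleGraph V} {A : Set ℕ} {h : ℕ}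

/-- The arithmetic of the lengths `l` of bones `B_{l+1}` with `l + 1 ∈ A`: they are even and at
least `h`, and the sum of two lengths is a length only if both are `h` and `2 * h` is the largest
length. -/
structure SumRule (A : Set ℕ) (h : ℕ) : Prop where
  two_le : 2 ≤ h
  even : ∀ x, x + 1 ∈ A → Even x
  ge : ∀ x, x + 1 ∈ A → h ≤ x
  sum : ∀ x y, x + 1 ∈ A → y + 1 ∈ A → x + y + 1 ∈ A →
    x = h ∧ y = h ∧ ∀ w, w + 1 ∈ A → w ≤ 2 * h

theorem IPath.take {P : ℕ → V} {l m : ℕ} (hP : IPath G P l) (h : m ≤ l) : IPath G P m :=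
  ⟨fun i j hi hj => hP.inj i j (hi.trans h) (hj.trans h),
   fun i j hi hj => hP.adj i j (hi.trans h) (hj.trans h)⟩

theorem IPath.congr {P P' : ℕ → V} {l : ℕ} (hP : IPath G P l) (h : ∀ i ≤ l, P i = P' i) :
    IPath G P' l :=
  ⟨fun i j hi hj he => hP.inj i j hi hj (by rw [h i hi, h j hj, he]),
   fun i j hi hj => by rw [← h i hi, ← h j hj]; exact hP.adj i j hi hj⟩

/-- How a third end is attached to an induced path between two ends. -/
theorem attach (hA : BonesIn A G) (hr : SumRule A h) {P R : ℕ → V} {L m : ℕ} (hP : IPath G P L)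
    (hR : IPath G R m) (hL : 1 ≤ L) (h0 : IsEnd G (P 0)) (h1 : IsEnd G (P L))
    (hz : IsEnd G (R 0)) (hdisj : ∀ j i, j ≤ m → i ≤ L → R j ≠ P i)
    (hno : ∀ j i, j < m → i ≤ L → ¬ G.Adj (R j) (P i)) (hex : ∃ i ≤ L, G.Adj (R m) (P i)) :
    2 * h + 1 ∈ A ∧
    ((∃ a ≤ L, (∀ i ≤ L, G.Adj (R m) (P i) ↔ i = a) ∧ m + 1 = h ∧
        (a = h ∧ L = 2 * h ∨ a = 0 ∧ L = h ∨ a = L ∧ L = h)) ∨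
      (L = 2 * h ∧ G.Adj (R m) (P (h - 1)) ∧ G.Adj (R m) (P h) ∧ G.Adj (R m) (P (h + 1)) ∧
        (∀ i ≤ L, G.Adj (R m) (P i) → h - 1 ≤ i ∧ i ≤ h + 1) ∧ (m = 0 ∨ m = h))) := by
  classical
  have h2 := hr.two_le
  -- `P a` and `P b` are the first and last neighbours of `R m` on `P`, so that continuing to `P 0`
  -- from `P a`, or to `P L` from `P b`, gives induced paths.
  obtain ⟨a, b, haL, hbL, hra, hrb, hmin, hmax⟩ : ∃ a b, a ≤ L ∧ b ≤ L ∧ G.Adj (R m) (P a) ∧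
      G.Adj (R m) (P b) ∧ (∀ i ≤ L, G.Adj (R m) (P i) → a ≤ i) ∧
      (∀ i ≤ L, G.Adj (R m) (P i) → i ≤ b) := by
    obtain ⟨i₀, hi₀, hri₀⟩ := hex
    set N := (Finset.range (L + 1)).filter fun i => G.Adj (R m) (P i) with hN
    have hmem : ∀ i, i ∈ N ↔ i ≤ L ∧ G.Adj (R m) (P i) := by
      intro i; simp [hN]
    have hne : N.Nonempty := ⟨i₀, (hmem i₀).2 ⟨hi₀, hri₀⟩⟩
    have hmn := (hmem _).1 (N.min'_mem hne)
    have hmx := (hmem _).1 (N.max'_mem hne)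
    exact ⟨N.min' hne, N.max' hne, hmn.1, hmx.1, hmn.2, hmx.2,
      fun i hi hri => N.min'_le _ ((hmem i).2 ⟨hi, hri⟩),
      fun i hi hri => N.le_max' _ ((hmem i).2 ⟨hi, hri⟩)⟩
  have hab : a ≤ b := hmin b hbL hrb
  have hrm : ∀ i j, i ≤ m → j ≤ L → G.Adj (R i) (P j) → i = m := by
    intro i j hi hj hadj
    by_contra hne
    exact hno i j (by omega) hj hadj
  -- paths from the third end to the ends of `P`
  have zu : m + a + 1 + 1 ∈ A := by
    refine hR.mem_of_isEnd_join (hP.down (a := a) (m := a) le_rfl haL) hA (by simpa using hra)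
      (fun i j hi hj => hdisj _ _ hi (by omega)) ?_ hz (by simpa using h0)
    intro i j hi hj hadj
    obtain rfl := hrm i _ hi (by omega) hadj
    have := hmin _ (by omega) hadj
    omega
  have zv : m + (L - b) + 1 + 1 ∈ A := by
    refine hR.mem_of_isEnd_join (hP.shift (a := b) (m := L - b) (by omega)) hA
      (by simpa using hrb) (fun i j hi hj => hdisj _ _ hi (by omega)) ?_ hz ?_
    · intro i j hi hj hadj
      obtain rfl := hrm i _ hi (by omega) hadj
      have := hmax _ (by omega) hadj
      omega
    · convert h1 using 2
      omega
  have uv : L + 1 ∈ A := hP.mem_of_isEnd hA hL h0 h1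
  have hLe := hr.even _ uv
  rcases Nat.lt_or_ge a b with hlt | hge
  swap
  · -- a single neighbour on `P`
    obtain rfl : a = b := le_antisymm hab hge
    have hiff : ∀ i ≤ L, G.Adj (R m) (P i) ↔ i = a := by
      intro i hi
      exact ⟨fun hadj => le_antisymm (hmax i hi hadj) (hmin i hi hadj), fun he => he ▸ hra⟩
    rcases Nat.eq_zero_or_pos a with rfl | hapos
    · have := hr.sum (m + 1) L zu uv (by convert zv using 1; omega)
      refine ⟨by convert zv using 1; omega, Or.inl ⟨0, haL, hiff, this.1, Or.inr (Or.inl ⟨rfl, this.2.1⟩)⟩⟩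
    rcases Nat.lt_or_ge a L with haL' | haL'
    swap
    · obtain rfl : a = L := le_antisymm haL haL'
      have := hr.sum (m + 1) a (by convert zv using 1; omega) uv (by convert zu using 1; omega)
      refine ⟨by convert zu using 1; omega, Or.inl ⟨a, haL, hiff, this.1, Or.inr (Or.inr ⟨rfl, this.2.1⟩)⟩⟩
    have hnr : ∀ i ≤ L, i ≠ a → ¬ G.Adj (R m) (P i) := fun i hi hne hadj => hne ((hiff i hi).1 hadj)
    -- At an interior attachment vertex `P a`, any two of its neighbours `R m`, `P (a - 1)`, `P (a +
    -- 1)` form a fork facing the third direction. So `a`, `L - a` and `m + 1` are all lengths, and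
    -- so are their pairwise sums.
    have hu : a + 1 ∈ A := by
      refine (hP.down (a := a) (m := a) le_rfl haL).mem_of_fork hA hapos (a := R m)
        (b := P (a + 1)) ⟨by simpa using hra.symm, by simpa using hP.adj_succ haL',
          hdisj _ _ le_rfl (by omega), hnr _ (by omega) (by omega)⟩ ?_ ?_
          (hdisj _ _ le_rfl (by omega)) (hP.ne (by omega) (by omega) (by omega)) (by simpa using h0)
      · exact fun i hi hia => hnr _ (by omega) (by omega)
      · exact fun i hi hia => hP.not_adj (by omega) (by omega) (by omega) (by omega)
    have hv : L - a + 1 ∈ A := by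
      refine (hP.shift (a := a) (m := L - a) (by omega)).mem_of_fork hA (by omega) (a := R m)
        (b := P (a - 1)) ⟨by simpa using hra.symm, ?_,
          hdisj _ _ le_rfl (by omega), hnr _ (by omega) (by omega)⟩ ?_ ?_
          (hdisj _ _ le_rfl (by omega)) (hP.ne (by omega) (by omega) (by omega)) ?_
      · exact (hP.adj _ _ (by omega) (by omega)).2 (by omega)
      · exact fun i hi hia => hnr _ (by omega) (by omega)
      · exact fun i hi hia => hP.not_adj (by omega) (by omega) (by omega) (by omega)
      · convert h1 using 2
        omega
    have hs := hr.sum a (L - a) hu hv (by convert uv using 1; omega)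
    have hw : 0 + m + 1 + 1 ∈ A := by
      refine (IPath.const (G := G) (P a)).mem_of_fork_join (hR.down (a := m) (m := m) le_rfl le_rfl)
        hA (by simpa using hra.symm) (fun i j _ hj => (hdisj _ _ (by omega) haL).symm) ?_
        (a := P (a - 1)) (b := P (a + 1)) ⟨(hP.adj _ _ (by omega) (by omega)).2 (by omega),
          hP.adj_succ haL', hP.ne (by omega) (by omega) (by omega),
          hP.not_adj (by omega) (by omega) (by omega) (by omega)⟩
        (fun i hi hi' => absurd hi (by omega)) (fun i hi hi' => absurd hi (by omega)) ?_ ?_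
        (hdisj _ _ (by omega) (by omega)).symm (hdisj _ _ (by omega) (by omega)).symm
        (by simpa using hz)
      · intro i j hi hj hadj
        have := hrm _ _ (by omega) haL hadj.symm
        omega
      · intro i hi hadj
        have := hrm _ _ (by omega) (by omega) hadj.symm
        rw [this] at hadj
        exact hnr _ (by omega) (by omega) hadj.symm
      · intro i hi hadj
        have := hrm _ _ (by omega) (by omega) hadj.symm
        rw [this] at hadj
        exact hnr _ (by omega) (by omega) hadj.symm
    have hs' := hr.sum (m + 1) a (by convert hw using 1; omega) hu (by convert zu using 1; omega)
    exact ⟨by convert uv using 1; omega, Or.inl ⟨a, haL, hiff, hs'.1, Or.inl ⟨hs.1, by omega⟩⟩⟩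
  -- a triangle is impossible by parity
  have hb2 : a + 2 ≤ b := by
    by_contra hcon
    have e1 := hr.even _ zu
    have e2 := hr.even _ zv
    obtain ⟨c1, e1⟩ := e1
    obtain ⟨c2, e2⟩ := e2
    obtain ⟨c3, e3⟩ := hLe
    omega
  have hra' : ∀ i, i < a → ¬ G.Adj (R m) (P i) := fun i hi hadj => by
    have := hmin i (by omega) hadj
    omega
  have hrb' : ∀ i, b < i → i ≤ L → ¬ G.Adj (R m) (P i) := fun i hi hiL hadj => by
    have := hmax i hiL hadj
    omega
  -- With two far apart neighbours on `P`, the vertex `R m` is itself the start of a bone towards `P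
  -- 0`. Its fork is `R (m - 1)`, `P b`; for `m = 0` it is an end already.
  have hu : a + 1 + 1 ∈ A := by
    rcases Nat.eq_zero_or_pos m with hm | hm
    · convert zu using 1; omega
    have := (IPath.const (G := G) (R m)).mem_of_fork_join (hP.down (a := a) (m := a) le_rfl haL)
      hA (by simpa using hra) (fun i j _ hj => hdisj _ _ le_rfl (by omega)) (fun i j hi hj hadj => by
        have := hmin _ (by omega) hadj
        omega)
      (a := R (m - 1)) (b := P b) ⟨(hR.adj _ _ (by omega) (by omega)).2 (by omega), hrb,
        hdisj _ _ (by omega) (by omega), hno _ _ (by omega) (by omega)⟩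
      (fun i hi hi' => absurd hi (by omega)) (fun i hi hi' => absurd hi (by omega))
      (fun i hi => hno _ _ (by omega) (by omega))
      (fun i hi => hP.not_adj (by omega) (by omega) (by omega) (by omega))
      (hdisj _ _ (by omega) (by omega)) (hP.ne (by omega) (by omega) (by omega)) (by simpa using h0)
    convert this using 1
    omega
  have hv : L - b + 1 + 1 ∈ A := by
    rcases Nat.eq_zero_or_pos m with hm | hm
    · convert zv using 1; omega
    have := (IPath.const (G := G) (R m)).mem_of_fork_join
      (hP.shift (a := b) (m := L - b) (by omega))
      hA (by simpa using hrb) (fun i j _ hj => hdisj _ _ le_rfl (by omega)) (fun i j hi hj hadj => by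
        have := hmax _ (by omega) hadj
        omega)
      (a := R (m - 1)) (b := P a) ⟨(hR.adj _ _ (by omega) (by omega)).2 (by omega), hra,
        hdisj _ _ (by omega) (by omega), hno _ _ (by omega) (by omega)⟩
      (fun i hi hi' => absurd hi (by omega)) (fun i hi hi' => absurd hi (by omega))
      (fun i hi => hno _ _ (by omega) (by omega))
      (fun i hi => hP.not_adj (by omega) (by omega) (by omega) (by omega))
      (hdisj _ _ (by omega) (by omega)) (hP.ne (by omega) (by omega) (by omega)) (by
        convert h1 using 2
        omega)
    convert this using 1
    omega
  -- The detour `P 0, …, P a, R m, P b, …, P L` is induced, and its length is the sum of the two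
  -- lengths just found. The sum rule makes both equal to `h`, and `L ≤ 2 * h` then forces `b = a +
  -- 2` and `L = 2 * h`.
  have huv : a + 0 + 1 + (L - b) + 1 + 1 ∈ A := by
    have hj := (hP.take haL).join (IPath.const (G := G) (R m)) hra.symm
      (fun i j hi _ => (hdisj _ _ le_rfl (by omega)).symm) (fun i j hi hj hadj => by
        have := hmin _ (by omega) hadj.symm
        omega)
    refine hj.mem_of_isEnd_join (hP.shift (a := b) (m := L - b) (by omega)) hA ?_ ?_ ?_
      (by simpa using h0) (by convert h1 using 2; omega)
    · simpa using hrb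
    · intro i j hi hj
      split_ifs with hia
      · exact hP.ne (by omega) (by omega) (by omega)
      · exact hdisj _ _ le_rfl (by omega)
    · intro i j hi hj
      split_ifs with hia
      · intro hadj
        exact absurd hadj (hP.not_adj (by omega) (by omega) (by omega) (by omega))
      · intro hadj
        have := hmax _ (by omega) hadj
        omega
  have hs := hr.sum (a + 1) (L - b + 1) hu hv (by convert huv using 1; omega)
  have hL2 := hs.2.2 L uv
  have hLL : L = 2 * h := by omega
  have hbh : b = h + 1 := by omega
  have hah : a = h - 1 := by omega
  refine ⟨by convert uv using 1; omega, Or.inr ⟨hLL, hah ▸ hra, ?_, hbh ▸ hrb, ?_, ?_⟩⟩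
  -- Were the middle vertex not adjacent to `R m`, the two would be a fork at `P a`, giving the
  -- length `h - 1`.
  · by_contra hnot
    have : a + 1 ∈ A := by
      refine (hP.down (a := a) (m := a) le_rfl haL).mem_of_fork hA (by omega) (a := R m)
        (b := P (a + 1)) ⟨by simpa using hra.symm, by simpa using hP.adj_succ (i := a) (by omega),
          hdisj _ _ le_rfl (by omega), ?_⟩ ?_ ?_
          (hdisj _ _ le_rfl (by omega)) (hP.ne (by omega) (by omega) (by omega)) (by simpa using h0)
      · have : a + 1 = h := by omega
        rw [this]
        exact hnot
      · exact fun i hi hia => hra' _ (by omega)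
      · exact fun i hi hia => hP.not_adj (by omega) (by omega) (by omega) (by omega)
    have := hr.ge _ this
    omega
  · intro i hi hadj
    have := hmin i hi hadj
    have := hmax i hi hadj
    omega
  · rcases Nat.eq_zero_or_pos m with hm | hm
    · exact Or.inl hm
    right
    -- `P a` and `P b` form a fork at `R m` facing the third end, so `m` is a length. The path from
    -- the third end to `P 0` has length `m + h`, whence `m = h`.
    have hm' : m + 1 ∈ A := by
      refine (hR.down (a := m) (m := m) le_rfl le_rfl).mem_of_fork hA hm (a := P a) (b := P b)
        ⟨by simpa using hra, by simpa using hrb, hP.ne (by omega) (by omega) (by omega),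
          hP.not_adj (by omega) (by omega) (by omega) (by omega)⟩
        (fun i hi him hadj => hno _ _ (by omega) (by omega) hadj.symm)
        (fun i hi him hadj => hno _ _ (by omega) (by omega) hadj.symm)
        (hdisj _ _ (by omega) (by omega)).symm (hdisj _ _ (by omega) (by omega)).symm
        (by simpa using hz)
    have h3 : h + 1 ∈ A := by convert hu using 1; omega
    exact (hr.sum m h hm' h3 (by convert zu using 1; omega)).1

/-- A shortest path from `z` to the neighbourhood of `M`. -/
theorem exists_path_to_set (hG : G.Connected) {M : Set V} (hM : M.Nonempty) {z : V} (hz : z ∉ M) :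
    ∃ R m, IPath G R m ∧ R 0 = z ∧ (∀ j ≤ m, R j ∉ M) ∧ (∃ y ∈ M, G.Adj (R m) y) ∧
      ∀ j < m, ∀ y ∈ M, ¬ G.Adj (R j) y := by
  obtain ⟨y₀, hy₀⟩ := hM
  have hC := isComp_comp (G := G) hz
  obtain ⟨b, hb, y, hy, hby⟩ := hC.exists_adj hG hy₀
  obtain ⟨R, m, hR, h0, hT, hK, hmin⟩ := exists_ipath (K := Mᶜ) (T := {w | ∃ y ∈ M, G.Adj w y}) hz hb
    ⟨y, hy, hby⟩
  refine ⟨R, m, hR, h0, hK, hT, ?_⟩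
  intro j hj y hy hadj
  exact hmin j hj ⟨y, hy, hadj⟩

/-- Two ends are joined by an induced path inside every connected set that contains them. -/
theorem exists_ipath_of_connSet {K : Set V} (hK : ConnSet G K) {u v : V} (hu : u ∈ K)
    (hv : v ∈ K) : ∃ P l, IPath G P l ∧ P 0 = u ∧ P l = v ∧ ∀ i ≤ l, P i ∈ K := by
  obtain ⟨P, l, hP, h0, h1, h2, -⟩ := exists_ipath (T := {v}) hu (hK u hu v hv) rfl
  exact ⟨P, l, hP, h0, h1, h2⟩

theorem connSet_univ (hG : G.Connected) : ConnSet G Set.univ :=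
  fun a _ b _ => connIn_univ_iff.2 (hG.preconnected a b)

/-- If no length is the double of `h`, there are no three ends. -/
theorem no_three_ends (hG : G.Connected) (hA : BonesIn A G) (hr : SumRule A h)
    (h2 : 2 * h + 1 ∉ A) {u v z : V} (hu : IsEnd G u) (hv : IsEnd G v) (hz : IsEnd G z)
    (huv : u ≠ v) (huz : u ≠ z) (hvz : v ≠ z) : False := by
  obtain ⟨P, L, hP, h0, hL, -⟩ := exists_ipath_of_connSet (connSet_univ hG) (Set.mem_univ u)
    (Set.mem_univ v)
  subst h0 hL
  have hLpos : 1 ≤ L := by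
    by_contra hcon
    exact huv (by congr 1; omega)
  have hLA := hP.mem_of_isEnd hA hLpos hu hv
  -- A third end on the path would split the length `L` into two lengths, which the sum rule allows
  -- only for `L = 2 * h`.
  have hzP : z ∉ {w | ∃ i ≤ L, P i = w} := by
    rintro ⟨i, hi, rfl⟩
    have hi0 : i ≠ 0 := fun he => huz (he ▸ rfl)
    have hiL : i ≠ L := fun he => hvz (he ▸ rfl)
    have e1 := (hP.take hi).mem_of_isEnd hA (by omega) hu hz
    have e2 := (hP.shift (a := i) (m := L - i) (by omega)).mem_of_isEnd hA (by omega) (by simpa using hz)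
      (by convert hv using 2; omega)
    have := hr.sum i (L - i) e1 e2 (by convert hLA using 1; omega)
    exact h2 (by convert hLA using 1; omega)
  obtain ⟨R, m, hR, hR0, hRM, ⟨y, ⟨i, hi, rfl⟩, hy⟩, hno⟩ := exists_path_to_set hG
    (M := {w | ∃ i ≤ L, P i = w}) ⟨_, 0, by omega, rfl⟩ hzP
  refine h2 (attach hA hr hP hR hLpos hu hv (hR0 ▸ hz) ?_ ?_ ⟨i, hi, hy⟩).1
  · exact fun j i hj hi he => hRM j hj ⟨i, hi, he.symm⟩
  · exact fun j i hj hi => hno j hj _ ⟨i, hi, rfl⟩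

end BoneDeficiency

/-! ### Spiders: all ends of the graph lie on legs of length `h` with a common centre. -/

namespace BoneDeficiency

variable {V : Type*} {G : SimpleGraph V} {A : Set ℕ} {h : ℕ}

/-- Induced paths `P f` of length `h` from `x` to the vertices `f ∈ F`, disjoint and not joined
by any edge apart from their common start `x`. -/
structure Spider (G : SimpleGraph V) (h : ℕ) (x : V) (F : Finset V) (P : V → ℕ → V) : Prop where
  path : ∀ f ∈ F, IPath G (P f) h
  start : ∀ f ∈ F, P f 0 = x
  last : ∀ f ∈ F, P f h = f
  ne : ∀ f ∈ F, ∀ g ∈ F, f ≠ g → ∀ i j, 1 ≤ i → i ≤ h → 1 ≤ j → j ≤ h → P f i ≠ P g j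
  not_adj : ∀ f ∈ F, ∀ g ∈ F, f ≠ g → ∀ i j, 1 ≤ i → i ≤ h → 1 ≤ j → j ≤ h →
    ¬ G.Adj (P f i) (P g j)

namespace Spider

variable {x : V} {F : Finset V} {P : V → ℕ → V}

theorem center_notMem (hS : Spider G h x F P) (hh : 1 ≤ h) : x ∉ F := by
  intro hx
  exact (hS.path x hx).ne (Nat.zero_le h) le_rfl (by omega) ((hS.start x hx).trans (hS.last x hx).symm)

/-- The induced path formed by two legs. -/
theorem pair (hS : Spider G h x F P) (hh : 1 ≤ h) {f g : V} (hf : f ∈ F) (hg : g ∈ F)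
    (hfg : f ≠ g) :
    IPath G (fun k => if k ≤ h then P f (h - k) else P g (k - h)) (2 * h) := by
  have h1 := ((hS.path f hf).down (a := h) (m := h) le_rfl le_rfl).join
    ((hS.path g hg).shift (a := 1) (m := h - 1) (by omega)) ?_ ?_ ?_
  · have h2 : h + (h - 1) + 1 = 2 * h := by omega
    rw [h2] at h1
    refine h1.congr fun i hi => ?_
    split_ifs
    · rfl
    · congr 1; omega
  · have := (hS.path g hg).adj_succ (i := 0) (by omega)
    rw [hS.start g hg] at this
    simpa [hS.start f hf] using this
  · intro i j hi hj
    by_cases hih : h - i = 0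
    · rw [hih, hS.start f hf, ← hS.start g hg]
      exact (hS.path g hg).ne (by omega) (by omega) (by omega)
    · exact hS.ne f hf g hg hfg _ _ (by omega) (by omega) (by omega) (by omega)
  · intro i j hi hj hadj
    by_cases hih : h - i = 0
    · rw [hih, hS.start f hf, ← hS.start g hg, (hS.path g hg).adj _ _ (by omega) (by omega)] at hadj
      omega
    · exact absurd hadj (hS.not_adj f hf g hg hfg _ _ (by omega) (by omega) (by omega) (by omega))

/-- Attach a leg to the center. -/
theorem extend_center [DecidableEq V] (hS : Spider G h x F P) {R : ℕ → V} {m : ℕ}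
    (hR : IPath G R m)
    (hm : m + 1 = h) (hxR : ∀ j ≤ m, R j ≠ x) (hx : ∀ j ≤ m, G.Adj (R j) x ↔ j = m)
    (hdisj : ∀ f ∈ F, ∀ i j, i ≤ h → j ≤ m → R j ≠ P f i)
    (hno : ∀ f ∈ F, ∀ i j, 1 ≤ i → i ≤ h → j ≤ m → ¬ G.Adj (R j) (P f i)) :
    ∃ P', Spider G h x (insert (R 0) F) P' := by
  have hRF : R 0 ∉ F := fun hf => hdisj _ hf h 0 le_rfl (by omega) (hS.last _ hf).symm
  have hcast : ∀ f ∈ F, f ≠ R 0 := fun f hf he => hRF (he ▸ hf)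
  refine ⟨fun f => if f = R 0 then fun k => if k = 0 then x else R (h - k) else P f, ?_, ?_, ?_,
    ?_, ?_⟩
  · intro f hf
    rw [Finset.mem_insert] at hf
    rcases hf with rfl | hf
    · simp only [if_true]
      have := (IPath.const (G := G) x).join (hR.down (a := m) (m := m) le_rfl le_rfl)
        ((hx m le_rfl).2 rfl).symm (fun i j _ hj => (hxR _ (by omega)).symm) (fun i j hi hj hadj => by
          have := (hx _ (by omega)).1 hadj.symm
          omega)
      rw [show 0 + m + 1 = h by omega] at this
      refine this.congr fun i hi => ?_
      by_cases hi0 : i = 0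
      · simp [hi0]
      · simp only [Nat.le_zero, hi0, if_false]
        congr 1; omega
    · simpa [hcast f hf] using hS.path f hf
  · intro f hf
    rw [Finset.mem_insert] at hf
    rcases hf with rfl | hf
    · simp
    · simpa [hcast f hf] using hS.start f hf
  · intro f hf
    rw [Finset.mem_insert] at hf
    rcases hf with rfl | hf
    · simp; omega
    · simpa [hcast f hf] using hS.last f hf
  · intro f hf g hg hfg i j hi hih hj hjh
    rw [Finset.mem_insert] at hf hg
    rcases hf with rfl | hf <;> rcases hg with rfl | hg
    · exact absurd rfl hfg
    · simp only [if_true, hcast g hg, if_false, show i ≠ 0 by omega]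
      exact hdisj g hg _ _ hjh (by omega)
    · simp only [if_true, hcast f hf, if_false, show j ≠ 0 by omega]
      exact (hdisj f hf _ _ hih (by omega)).symm
    · simp only [hcast f hf, hcast g hg, if_false]
      exact hS.ne f hf g hg hfg i j hi hih hj hjh
  · intro f hf g hg hfg i j hi hih hj hjh
    rw [Finset.mem_insert] at hf hg
    rcases hf with rfl | hf <;> rcases hg with rfl | hg
    · exact absurd rfl hfg
    · simp only [if_true, hcast g hg, if_false, show i ≠ 0 by omega]
      exact hno g hg _ _ hj hjh (by omega)
    · simp only [if_true, hcast f hf, if_false, show j ≠ 0 by omega]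
      exact fun hadj => hno f hf _ _ hi hih (by omega) hadj.symm
    · simp only [hcast f hf, hcast g hg, if_false]
      exact hS.not_adj f hf g hg hfg i j hi hih hj hjh

/-- Replace the center by another vertex `r` adjacent to the first vertices of all legs. -/
theorem replace_center (hS : Spider G h x F P) (hh : 1 ≤ h) {r : V}
    (hr : ∀ f ∈ F, ∀ i, 1 ≤ i → i ≤ h → (G.Adj r (P f i) ↔ i = 1))
    (hne : ∀ f ∈ F, ∀ i, 1 ≤ i → i ≤ h → r ≠ P f i) :
    Spider G h r F fun f k => if k = 0 then r else P f k := by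
  refine ⟨?_, ?_, ?_, ?_, ?_⟩
  · intro f hf
    have := (IPath.const (G := G) r).join ((hS.path f hf).shift (a := 1) (m := h - 1) (by omega))
      ((hr f hf 1 le_rfl hh).2 rfl) (fun i j _ hj => hne f hf _ (by omega) (by omega))
      (fun i j hi hj hadj => by
        have := (hr f hf _ (by omega) (by omega)).1 hadj
        omega)
    rw [show 0 + (h - 1) + 1 = h by omega] at this
    refine this.congr fun i hi => ?_
    by_cases hi0 : i = 0
    · simp [hi0]
    · simp only [Nat.le_zero, hi0, if_false]
      congr 1; omega
  · intro f hf
    simp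
  · intro f hf
    simp only [show h ≠ 0 by omega, if_false]
    exact hS.last f hf
  · intro f hf g hg hfg i j hi hih hj hjh
    simp only [show i ≠ 0 by omega, show j ≠ 0 by omega, if_false]
    exact hS.ne f hf g hg hfg i j hi hih hj hjh
  · intro f hf g hg hfg i j hi hih hj hjh
    simp only [show i ≠ 0 by omega, show j ≠ 0 by omega, if_false]
    exact hS.not_adj f hf g hg hfg i j hi hih hj hjh

/-- With a single leg, centre and foot are interchangeable; this is used when a new leg attaches at
the foot. -/
theorem swap {f : V} (hS : Spider G h x {f} P) : Spider G h f {x} fun _ k => P f (h - k) := by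
  have hf : f ∈ ({f} : Finset V) := Finset.mem_singleton_self f
  refine ⟨?_, ?_, ?_, ?_, ?_⟩
  · intro g hg
    exact (hS.path f hf).down le_rfl le_rfl
  · intro g hg
    simpa using hS.last f hf
  · intro g hg
    rw [Finset.mem_singleton] at hg
    simpa [hg] using hS.start f hf
  · intro g hg g' hg' hne
    rw [Finset.mem_singleton] at hg hg'
    exact absurd (hg.trans hg'.symm) hne
  · intro g hg g' hg' hne
    rw [Finset.mem_singleton] at hg hg'
    exact absurd (hg.trans hg'.symm) hne

theorem of_path {Q : ℕ → V} (hQ : IPath G Q h) : Spider G h (Q 0) {Q h} fun _ => Q := by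
  refine ⟨?_, ?_, ?_, ?_, ?_⟩
  · intro g hg
    exact hQ
  · intro g hg
    rfl
  · intro g hg
    rw [Finset.mem_singleton] at hg
    exact hg.symm
  · intro g hg g' hg' hne
    rw [Finset.mem_singleton] at hg hg'
    exact absurd (hg.trans hg'.symm) hne
  · intro g hg g' hg' hne
    rw [Finset.mem_singleton] at hg hg'
    exact absurd (hg.trans hg'.symm) hne

end Spider

/-- Two legs together form a path of length `2 * h` between ends, to which `attach` applies. Either
the new path meets every leg only at the centre, and becomes a leg, or its last vertex `R m` sees
the centre and the first vertex of every leg, and can replace the centre. -/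
theorem Spider.extend_aux [DecidableEq V] (hA : BonesIn A G) (hr : SumRule A h)
    {x : V} {F : Finset V} {P : V → ℕ → V} (hS : Spider G h x F P)
    (hF : ∀ f ∈ F, IsEnd G f) (hF2 : 2 ≤ F.card) {R : ℕ → V} {m : ℕ} (hR : IPath G R m)
    (hz : IsEnd G (R 0))
    (hdisj : ∀ f ∈ F, ∀ i j, i ≤ h → j ≤ m → R j ≠ P f i)
    (hno : ∀ f ∈ F, ∀ i j, i ≤ h → j < m → ¬ G.Adj (R j) (P f i))
    {f₀ : V} (hf₀ : f₀ ∈ F) {i₀ : ℕ} (hi₀ : i₀ ≤ h) (hadj : G.Adj (R m) (P f₀ i₀)) :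
    (∃ P', Spider G h x (insert (R 0) F) P') ∨
      (¬ IsEnd G x ∧ ∃ x' F' P', Spider G h x' F' P' ∧ F' ⊆ insert (R 0) F ∧
        insert (R 0) F ⊆ insert x' F') := by
  have h2 := hr.two_le
  set r := R m with hrdef
  -- the possible neighbours of `r` on two legs
  have hpair : ∀ f ∈ F, ∀ g ∈ F, f ≠ g → (∃ i ≤ h, G.Adj r (P f i) ∨ G.Adj r (P g i)) →
      (m + 1 = h ∧ G.Adj r x ∧ ∀ i ≤ h, (G.Adj r (P f i) → i = 0) ∧ (G.Adj r (P g i) → i = 0)) ∨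
      (G.Adj r (P f 1) ∧ G.Adj r x ∧ G.Adj r (P g 1) ∧
        (∀ i ≤ h, (G.Adj r (P f i) → i ≤ 1) ∧ (G.Adj r (P g i) → i ≤ 1)) ∧ (m = 0 ∨ m = h)) := by
    intro f hf g hg hfg ⟨i, hi, hri⟩
    have hPf : ∀ k ≤ h, (if h - k ≤ h then P f (h - (h - k)) else P g (h - k - h)) = P f k := by
      intro k hk
      rw [if_pos (by omega)]
      congr 1; omega
    have hPg : ∀ k ≤ h, (if h + k ≤ h then P f (h - (h + k)) else P g (h + k - h)) = P g k := by
      intro k hk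
      split_ifs with hk0
      · obtain rfl : k = 0 := by omega
        simp [hS.start f hf, hS.start g hg]
      · congr 1; omega
    have hat := (attach hA hr (hS.pair (by omega) hf hg hfg) hR (by omega)
      (by simpa [hS.last f hf] using hF f hf)
      (by
        rw [if_neg (by omega), show 2 * h - h = h by omega, hS.last g hg]
        exact hF g hg) hz
      (fun j i hj hi => by
        split_ifs
        · exact hdisj f hf _ _ (by omega) hj
        · exact hdisj g hg _ _ (by omega) hj)
      (fun j i hj hi => by
        split_ifs
        · exact hno f hf _ _ (by omega) hj
        · exact hno g hg _ _ (by omega) hj)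
      (by
        rcases hri with hri | hri
        · exact ⟨h - i, by omega, by rw [hPf i hi]; exact hri⟩
        · exact ⟨h + i, by omega, by rw [hPg i hi]; exact hri⟩)).2
    rw [← hrdef] at hat
    rcases hat with ⟨a, ha, hiff, hm, hcase⟩ | ⟨-, e1, e2, e3, e4, e5⟩
    · have hah : a = h := by omega
      subst hah
      left
      refine ⟨hm, ?_, fun k hk => ⟨fun hadj => ?_, fun hadj => ?_⟩⟩
      · have := (hiff a (by omega)).2 rfl
        simpa [hS.start f hf] using this
      · have := (hiff (a - k) (by omega)).1 (by rw [hPf k hk]; exact hadj)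
        omega
      · have := (hiff (a + k) (by omega)).1 (by rw [hPg k hk]; exact hadj)
        omega
    · right
      rw [hPf 1 (by omega)] at e1
      rw [hPg 1 (by omega)] at e3
      refine ⟨e1, ?_, e3, fun k hk => ⟨fun hadj => ?_, fun hadj => ?_⟩, e5⟩
      · simpa [hS.start f hf] using e2
      · have := e4 (h - k) (by omega) (by rw [hPf k hk]; exact hadj)
        omega
      · have := e4 (h + k) (by omega) (by rw [hPg k hk]; exact hadj)
        omega
  have hrx : ∀ f ∈ F, (G.Adj r x ↔ G.Adj r (P f 0)) := fun f hf => by rw [hS.start f hf]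
  have hxR : ∀ j ≤ m, R j ≠ x := fun j hj => by
    rw [← hS.start f₀ hf₀]
    exact hdisj f₀ hf₀ 0 j (by omega) hj
  obtain ⟨g₀, hg₀, hfg₀⟩ : ∃ g ∈ F, g ≠ f₀ := Finset.exists_mem_ne (by omega) f₀
  rcases hpair f₀ hf₀ g₀ hg₀ hfg₀.symm ⟨i₀, hi₀, Or.inl hadj⟩ with ⟨hm, hx, hall⟩ | ⟨e1, hx, e3, e4, e5⟩
  · left
    have hzero : ∀ f ∈ F, ∀ i ≤ h, G.Adj r (P f i) → i = 0 := by
      intro f hf i hi hri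
      by_cases hff : f = f₀
      · subst hff
        exact (hall i hi).1 hri
      · rcases hpair f₀ hf₀ f hf (Ne.symm hff) ⟨0, by omega, Or.inl ((hrx f₀ hf₀).1 hx)⟩ with
          ⟨-, -, hall'⟩ | ⟨e1, -⟩
        · exact (hall' i hi).2 hri
        · exact absurd ((hall 1 (by omega)).1 e1) (by omega)
    refine hS.extend_center hR hm hxR ?_ hdisj ?_
    · intro j hj
      constructor
      · intro hjx
        by_contra hjm
        exact hno f₀ hf₀ 0 j (by omega) (by omega) (by rw [hS.start f₀ hf₀]; exact hjx)
      · rintro rfl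
        exact hx
    · intro f hf i j hi hih hj hadj'
      rcases Nat.lt_or_ge j m with hjm | hjm
      · exact hno f hf i j hih hjm hadj'
      · obtain rfl : j = m := by omega
        exact absurd (hzero f hf i hih hadj') (by omega)
  · right
    -- If `x` were an end, `h` and `m + 1` would be lengths, hence even; but `m` is `0` or `h`.
    have hxend : ¬ IsEnd G x := by
      intro hxe
      have hw : 0 + m + 1 + 1 ∈ A := by
        refine (IPath.const (G := G) x).mem_of_isEnd_join
          (hR.down (a := m) (m := m) le_rfl le_rfl) hA (by simpa using hx.symm)
          (fun i j _ hj => (hxR _ (by omega)).symm) (fun i j hi hj hadj' => ?_) hxe (by simpa using hz)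
        by_contra hcon
        exact hno f₀ hf₀ 0 (m - j) (by omega) (by omega) (by rw [hS.start f₀ hf₀]; exact hadj'.symm)
      have h1 := hr.even _ hw
      have h3 : Even h := by
        have := (hS.path f₀ hf₀).mem_of_isEnd hA (by omega) (by rw [hS.start f₀ hf₀]; exact hxe)
          (by rw [hS.last f₀ hf₀]; exact hF f₀ hf₀)
        exact hr.even _ this
      obtain ⟨c, hc⟩ := h1
      obtain ⟨c', hc'⟩ := h3
      omega
    have hone : ∀ f ∈ F, G.Adj r (P f 1) ∧ ∀ i ≤ h, G.Adj r (P f i) → i ≤ 1 := by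
      intro f hf
      by_cases hff : f = f₀
      · subst hff
        exact ⟨e1, fun i hi => (e4 i hi).1⟩
      · rcases hpair f₀ hf₀ f hf (Ne.symm hff) ⟨0, by omega, Or.inl ((hrx f₀ hf₀).1 hx)⟩ with
          ⟨-, -, hall'⟩ | ⟨-, -, e3', e4', -⟩
        · exact absurd ((hall' 1 (by omega)).1 e1) (by omega)
        · exact ⟨e3', fun i hi => (e4' i hi).2⟩
    have hS' := hS.replace_center (by omega) (r := r) (fun f hf i hi hih =>
      ⟨fun hadj' => le_antisymm ((hone f hf).2 i hih hadj') hi, fun he => he ▸ (hone f hf).1⟩)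
      (fun f hf i hi hih => hdisj f hf i m hih le_rfl)
    refine ⟨hxend, ?_⟩
    -- For `m = 0` the new end is itself the new centre. For `m = h` the vertex `r` is the centre,
    -- and the path back to the new end is a further leg.
    rcases e5 with hm | hm
    · refine ⟨r, F, _, hS', Finset.subset_insert _ _, ?_⟩
      rw [hrdef, hm]
    · have hm1 : m - 1 + 1 = m := by omega
      obtain ⟨P', hP'⟩ := hS'.extend_center (hR.take (m := m - 1) (by omega)) (by omega)
        (fun j hj => hR.ne (by omega) le_rfl (by omega)) (fun j hj => by
          rw [hrdef, hR.adj _ _ (by omega) (by omega)]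
          omega) (fun f hf i j hi hj => by
          split_ifs
          · exact hR.ne (by omega) le_rfl (by omega)
          · exact hdisj f hf i j hi (by omega))
        (fun f hf i j hi hih hj => by
          rw [if_neg (by omega)]
          exact hno f hf i j hih (by omega))
      exact ⟨r, _, P', hP', subset_rfl, Finset.subset_insert _ _⟩

/-- Beyond `extend_aux`, this treats one leg whose centre is an end. That leg has length `h` rather
than `2 * h`, so `attach` leaves only attachment at one of its two extremities. -/
theorem Spider.extend [DecidableEq V] (hG : G.Connected) (hA : BonesIn A G) (hr : SumRule A h)
    {x : V} {F : Finset V} {P : V → ℕ → V} (hS : Spider G h x F P)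
    (hF : ∀ f ∈ F, IsEnd G f) (hF2 : 2 ≤ F.card ∨ F.Nonempty ∧ IsEnd G x) {z : V} (hz : IsEnd G z)
    (hzF : z ∉ F) (hzx : z ≠ x) :
    (∃ P', Spider G h x (insert z F) P') ∨
      (∃ f P', F = {f} ∧ Spider G h f {z, x} P') ∨
      (¬ IsEnd G x ∧ ∃ x' F' P', Spider G h x' F' P' ∧ F' ⊆ insert z F ∧
        insert z F ⊆ insert x' F') := by
  have h2 := hr.two_le
  have hFne : F.Nonempty := by
    rcases hF2 with hF2 | hF2
    · exact Finset.card_pos.1 (by omega)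
    · exact hF2.1
  obtain ⟨f₁, hf₁⟩ := hFne
  have hzM : z ∉ {w | ∃ f ∈ F, ∃ i ≤ h, P f i = w} := by
    rintro ⟨f, hf, i, hi, rfl⟩
    have hi0 : i ≠ 0 := fun he => hzx (he ▸ hS.start f hf)
    have hih : i ≠ h := fun he => hzF (by rw [he, hS.last f hf]; exact hf)
    have e1 := ((hS.path f hf).shift (a := i) (m := h - i) (by omega)).mem_of_isEnd hA (by omega)
      (by simpa using hz) (by
        rw [show i + (h - i) = h by omega, hS.last f hf]
        exact hF f hf)
    have := hr.ge _ e1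
    omega
  obtain ⟨R, m, hR, hR0, hRM, ⟨y, ⟨f₀, hf₀, i₀, hi₀, rfl⟩, hy⟩, hno⟩ := exists_path_to_set hG
    (M := {w | ∃ f ∈ F, ∃ i ≤ h, P f i = w}) ⟨_, f₁, hf₁, 0, by omega, rfl⟩ hzM
  subst hR0
  have hdisj : ∀ f ∈ F, ∀ i j, i ≤ h → j ≤ m → R j ≠ P f i :=
    fun f hf i j hi hj he => hRM j hj ⟨f, hf, i, hi, he.symm⟩
  have hno' : ∀ f ∈ F, ∀ i j, i ≤ h → j < m → ¬ G.Adj (R j) (P f i) :=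
    fun f hf i j hi hj => hno j hj _ ⟨f, hf, i, hi, rfl⟩
  by_cases hc2 : 2 ≤ F.card
  · rcases hS.extend_aux hA hr hF hc2 hR hz hdisj hno' hf₀ hi₀ hy with h' | h'
    · exact Or.inl h'
    · exact Or.inr (Or.inr h')
  have hxe : IsEnd G x := (hF2.resolve_left hc2).2
  obtain ⟨f, rfl⟩ : ∃ f, F = {f} := by
    rw [← Finset.card_eq_one]
    have := Finset.card_pos.2 ⟨f₁, hf₁⟩
    omega
  have hff : f ∈ ({f} : Finset V) := Finset.mem_singleton_self f
  obtain rfl : f₀ = f := Finset.mem_singleton.1 hf₀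
  have hat := (attach hA hr (hS.path f₀ hff) hR (by omega) (by rw [hS.start f₀ hff]; exact hxe)
    (by rw [hS.last f₀ hff]; exact hF f₀ hff) hz (fun j i hj hi => hdisj f₀ hff i j hi hj)
    (fun j i hj hi => hno' f₀ hff i j hi hj) ⟨i₀, hi₀, hy⟩).2
  rcases hat with ⟨a, ha, hiff, hm, hcase⟩ | ⟨e, -⟩
  swap
  · omega
  rcases hcase with hcase | hcase | hcase
  · omega
  · left
    obtain ⟨rfl, -⟩ := hcase
    refine hS.extend_center hR hm ?_ ?_ hdisj ?_
    · exact fun j hj => by rw [← hS.start f₀ hff]; exact hdisj f₀ hff 0 j (by omega) hj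
    · intro j hj
      rw [← hS.start f₀ hff]
      constructor
      · intro hjx
        by_contra hjm
        exact hno' f₀ hff 0 j (by omega) (by omega) hjx
      · rintro rfl
        exact (hiff 0 (by omega)).2 rfl
    · intro f hf i j hi hih hj hadj
      rw [Finset.mem_singleton] at hf
      subst hf
      rcases Nat.lt_or_ge j m with hjm | hjm
      · exact hno' f hff i j hih hjm hadj
      · obtain rfl : j = m := by omega
        have := (hiff i hih).1 hadj
        omega
  · right; left
    obtain ⟨rfl, -⟩ := hcase
    obtain ⟨P', hP'⟩ := hS.swap.extend_center hR hm
      (fun j hj => by rw [← hS.last f₀ hff]; exact hdisj f₀ hff a j (by omega) hj)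
      (fun j hj => by
        conv_lhs => rw [← hS.last f₀ hff]
        constructor
        · intro hjx
          by_contra hjm
          exact hno' f₀ hff a j (by omega) (by omega) hjx
        · rintro rfl
          exact (hiff a (by omega)).2 rfl)
      (fun _ _ i j hi hj => hdisj f₀ hff _ j (by omega) hj)
      (fun _ _ i j hi hih hj hadj => by
        rcases Nat.lt_or_ge j m with hjm | hjm
        · exact hno' f₀ hff _ j (by omega) hjm hadj
        · obtain rfl : j = m := by omega
          have := (hiff _ (by omega)).1 hadj
          omega)
    exact ⟨f₀, P', rfl, hP'⟩

/-- Any two or more ends lie on a spider whose legs lead to all of them, except possibly to one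
that is the center. -/
theorem exists_spider (hG : G.Connected) (hA : BonesIn A G) (hr : SumRule A h)
    (hA2 : ∀ x, x + 1 ∈ A → x = h ∨ x = 2 * h) (E : Finset V) (hE2 : 2 ≤ E.card)
    (hE : ∀ e ∈ E, IsEnd G e) :
    ∃ x F P, Spider G h x F P ∧ F ⊆ E ∧ ∀ e ∈ E, e = x ∨ e ∈ F := by
  classical
  have h2 := hr.two_le
  induction E using Finset.induction_on with
  | empty => simp at hE2
  | insert z E hzE ih =>
    rcases Nat.lt_or_ge E.card 2 with hlt | hge
    · -- two ends
      rw [Finset.card_insert_of_notMem hzE] at hE2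
      obtain ⟨u, rfl⟩ := Finset.card_eq_one.1 (by omega : E.card = 1)
      obtain ⟨P, L, hP, h0, hL, -⟩ := exists_ipath_of_connSet (connSet_univ hG) (Set.mem_univ u)
        (Set.mem_univ z)
      have hue : IsEnd G (P 0) := h0 ▸ hE u (by simp)
      have hze : IsEnd G (P L) := hL ▸ hE z (by simp)
      have huz : u ≠ z := fun he => hzE (by simp [he])
      have hLpos : 1 ≤ L := by
        by_contra hcon
        obtain rfl : L = 0 := by omega
        exact huz (h0.symm.trans hL)
      -- A path of length `h` is a spider with one leg centred at an end; a path of length `2 * h`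
      -- is a spider with two legs centred at its middle.
      rcases hA2 L (hP.mem_of_isEnd hA hLpos hue hze) with hLh | hLh
      · subst hLh
        refine ⟨_, _, _, Spider.of_path hP, ?_, ?_⟩
        · rw [hL]; simp
        · rw [hL, h0]; simp [or_comm]
      · have hS := Spider.of_path (G := G) (h := h) (Q := fun k => P (h + k))
          (hP.shift (a := h) (m := h) (by omega))
        have hlast : P (h + h) = z := by rw [← hL, hLh, two_mul]
        obtain ⟨P', hP'⟩ := hS.extend_center (R := P) (m := h - 1) (hP.take (by omega)) (by omega)
          (fun j hj => hP.ne (by omega) (by omega) (by omega)) (fun j hj => by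
            rw [hP.adj _ _ (by omega) (by omega)]
            omega) (fun f _ i j hi hj => hP.ne (by omega) (by omega) (by omega))
          (fun f _ i j hi hih hj => hP.not_adj (by omega) (by omega) (by omega) (by omega))
        refine ⟨_, _, P', hP', ?_, ?_⟩
        · simp only [hlast, h0]
          rw [Finset.pair_comm]
        · simp only [hlast, h0]
          simp
    · obtain ⟨x, F, P, hS, hFE, hcov⟩ := ih hge fun e he => hE e (Finset.mem_insert_of_mem he)
      by_cases hzx : z = x
      · refine ⟨x, F, P, hS, hFE.trans (Finset.subset_insert _ _), fun e he => ?_⟩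
        rw [Finset.mem_insert] at he
        rcases he with rfl | he
        · exact Or.inl hzx
        · exact hcov e he
      have hF : ∀ f ∈ F, IsEnd G f := fun f hf => hE f (Finset.mem_insert_of_mem (hFE hf))
      have hxE : ¬ 2 ≤ F.card → x ∈ E := by
        intro hF1
        by_contra hxE
        exact hF1 (hge.trans (Finset.card_le_card fun e he =>
          (hcov e he).resolve_left fun hex => hxE (hex ▸ he)))
      have hFne : F.Nonempty := by
        rw [Finset.nonempty_iff_ne_empty]
        rintro rfl
        have : E ⊆ {x} := fun e he => by simpa using hcov e he
        have := Finset.card_le_card this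
        simp at this
        omega
      have hFc : 2 ≤ F.card ∨ F.Nonempty ∧ IsEnd G x := by
        by_cases hF1 : 2 ≤ F.card
        · exact Or.inl hF1
        · exact Or.inr ⟨hFne, hE x (Finset.mem_insert_of_mem (hxE hF1))⟩
      rcases hS.extend hG hA hr hF hFc (hE z (Finset.mem_insert_self _ _)) (fun hz => hzE (hFE hz))
        hzx with ⟨P', hP'⟩ | ⟨f, P', rfl, hP'⟩ | ⟨hxend, x', F', P', hP', hF', hcov'⟩
      · refine ⟨x, _, P', hP', Finset.insert_subset_insert _ hFE, fun e he => ?_⟩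
        rw [Finset.mem_insert] at he
        rcases he with rfl | he
        · exact Or.inr (Finset.mem_insert_self _ _)
        · exact (hcov e he).imp_right Finset.mem_insert_of_mem
      · refine ⟨f, _, P', hP', ?_, fun e he => ?_⟩
        · refine Finset.insert_subset_insert _ (Finset.singleton_subset_iff.2 (hxE (by simp)))
        · rw [Finset.mem_insert] at he
          rcases he with rfl | he
          · simp
          · rcases hcov e he with rfl | he
            · simp
            · exact Or.inl (Finset.mem_singleton.1 he)
      · refine ⟨x', F', P', hP', hF'.trans (Finset.insert_subset_insert _ hFE), fun e he => ?_⟩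
        -- The discarded centre is not an end, so the new spider still accounts for all of `E`.
        have hx : x ∉ E := fun hx => hxend (hE x (Finset.mem_insert_of_mem hx))
        have : e ∈ insert z F := by
          rw [Finset.mem_insert] at he ⊢
          refine he.imp_right fun he => (hcov e he).resolve_left ?_
          rintro rfl
          exact hx he
        simpa using hcov' this

end BoneDeficiency

namespace BoneDeficiency

variable {V : Type*} {G : SimpleGraph V} {A : Set ℕ} {h n : ℕ}

/-! ### Local independence number and isomorphisms -/

theorem le_localIndepNum [Finite V] {t : ℕ} (ht : (starK t).IsIndContained G) :
    t ≤ localIndepNum G := by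
  refine le_csSup ⟨Nat.card V, ?_⟩ ht
  rintro t ⟨f⟩
  have := Nat.card_le_card_of_injective (f ∘ Sum.inr) (f.injective.comp Sum.inr_injective)
  simpa using this

theorem card_lt_of_localIndepNum_lt [Finite V] (hα : localIndepNum G < n) {s : V} (I : Finset V)
    (hs : ∀ a ∈ I, G.Adj s a) (hI : ∀ a ∈ I, ∀ b ∈ I, ¬ G.Adj a b) : I.card < n := by
  refine lt_of_le_of_lt (le_localIndepNum ?_) hα
  let e := I.equivFin.symm
  let f : Fin 1 ⊕ Fin I.card → V := Sum.elim (fun _ => s) fun i => e i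
  have hf : Function.Injective f := by
    rintro (i | i) (j | j) hij
    · rw [Subsingleton.elim i j]
    · exact absurd hij (hs _ (e j).2).ne
    · exact absurd hij.symm (hs _ (e i).2).ne
    · exact congrArg _ (e.injective (Subtype.ext hij))
  refine ⟨⟨⟨f, hf⟩, ?_⟩⟩
  rintro (i | i) (j | j)
  · simp [f]
  · simp [f, hs _ (e j).2]
  · simp [f, (hs _ (e i).2).symm]
  · simp [f, hI _ (e i).2 _ (e j).2]

/-- One neighbour of `s` chosen from each member gives an induced star at `s`. -/
theorem card_family_lt [Finite V] (hα : localIndepNum G < n) {s : V} (C : Finset (Set V))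
    (hs : ∀ K ∈ C, ∃ a ∈ K, G.Adj s a)
    (hC : ∀ K ∈ C, ∀ K' ∈ C, K ≠ K' → ∀ a ∈ K, ∀ b ∈ K', a ≠ b ∧ ¬ G.Adj a b) : C.card < n := by
  classical
  have : Nonempty V := ⟨s⟩
  choose! f hfK hf using hs
  have hinj : Set.InjOn f (C : Set (Set V)) := by
    intro K hK K' hK' he
    by_contra hne
    exact (hC K hK K' hK' hne _ (hfK K hK) _ (hfK K' hK')).1 he
  rw [← Finset.card_image_of_injOn hinj]
  refine card_lt_of_localIndepNum_lt hα (s := s) _ ?_ ?_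
  · intro a ha
    obtain ⟨K, hK, rfl⟩ := Finset.mem_image.1 ha
    exact hf K hK
  · intro a ha b hb
    obtain ⟨K, hK, rfl⟩ := Finset.mem_image.1 ha
    obtain ⟨K', hK', rfl⟩ := Finset.mem_image.1 hb
    by_cases hne : K = K'
    · subst hne
      exact G.loopless.irrefl _
    · exact (hC K hK K' hK' hne _ (hfK K hK) _ (hfK K' hK')).2

theorem IsComp.ne_and_not_adj {X K K' : Set V} (hK : IsComp G X K) (hK' : IsComp G X K')
    (hne : K ≠ K') : ∀ a ∈ K, ∀ b ∈ K', a ≠ b ∧ ¬ G.Adj a b := by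
  intro a ha b hb
  refine ⟨?_, fun hadj => hne (hK.eq hK' (hK.mem_of_adj ha hadj (hK'.notMem hb)) hb)⟩
  rintro rfl
  exact hne (hK.eq hK' ha hb)

theorem card_comps_lt [Finite V] (hα : localIndepNum G < n) {s : V} {X : Set V}
    (C : Finset (Set V)) (hs : ∀ K ∈ C, ∃ a ∈ K, G.Adj s a) (hC : ∀ K ∈ C, IsComp G X K) :
    C.card < n :=
  card_family_lt hα C hs fun K hK K' hK' hne => (hC K hK).ne_and_not_adj (hC K' hK') hne

theorem deficiency_le_of_iso {W : Type*} {H : SimpleGraph W} (f : G ≃g H) :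
    deficiency H ≤ deficiency G := by
  obtain ⟨M, hM, hMd⟩ := exists_matching_deficiency G
  rw [← hMd]
  refine (deficiency_le (hM.map f.toEmbedding.toHom f.injective)).trans (le_of_eq ?_)
  have : ((M.map f.toEmbedding.toHom).verts)ᶜ = f '' (M.verts)ᶜ := by
    rw [Set.image_compl_eq f.bijective]
    rfl
  rw [this, Set.ncard_image_of_injective _ f.injective]

theorem deficiency_congr {W : Type*} {H : SimpleGraph W} (f : G ≃g H) :
    deficiency G = deficiency H :=
  le_antisymm (deficiency_le_of_iso f.symm) (deficiency_le_of_iso f)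

/-- The isomorphism of a graph onto its image under an embedding. -/
theorem nonempty_iso_induce_range {W : Type*} {H : SimpleGraph W} (f : H ↪g G) :
    Nonempty (H ≃g G.induce (Set.range f)) :=
  ⟨⟨Equiv.ofInjective f f.injective, by simp⟩⟩

/-- The image of `H` cannot be a proper subset, since it would be a connected induced subgraph
without loss of deficiency. -/
theorem DeficiencyCritical.iso_of_embedding {W : Type*} {H : SimpleGraph W}
    (hc : DeficiencyCritical G) (hH : H.Connected) (f : H ↪g G)
    (hd : deficiency G ≤ deficiency H) : Nonempty (G ≃g H) := by
  obtain ⟨e⟩ := nonempty_iso_induce_range f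
  by_cases hr : Set.range f = Set.univ
  · refine ⟨SimpleGraph.Iso.symm ⟨Equiv.ofBijective f ⟨f.injective, Set.range_eq_univ.1 hr⟩, ?_⟩⟩
    intro a b
    exact f.map_rel_iff
  · have h1 := hc.2 _ hr (e.connected_iff.1 hH)
    rw [← deficiency_congr e] at h1
    omega

/-! ### Paths through a cut vertex -/

theorem IPath.mem_comp {s : V} {L : Set V} (hL : IsComp G {s} L) {P : ℕ → V} {l : ℕ}
    (hP : IPath G P l) (h0 : P 0 = s) {k : ℕ} (hk : 1 ≤ k) (hkl : k ≤ l) (hPL : P k ∈ L) :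
    ∀ i, 1 ≤ i → i ≤ l → P i ∈ L := by
  have hstep : ∀ i, 1 ≤ i → i + 1 ≤ l → (P i ∈ L ↔ P (i + 1) ∈ L) := by
    intro i hi hil
    have hne : ∀ j, 1 ≤ j → j ≤ l → P j ∉ ({s} : Set V) := by
      intro j hj hjl he
      exact hP.ne hjl (Nat.zero_le _) (by omega) ((Set.mem_singleton_iff.1 he).trans h0.symm)
    have hadj := hP.adj_succ (i := i) (by omega)
    exact ⟨fun hm => hL.mem_of_adj hm hadj (hne _ (by omega) hil),
      fun hm => hL.mem_of_adj hm hadj.symm (hne _ hi (by omega))⟩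
  have h1 : ∀ i, 1 ≤ i → i ≤ l → (P i ∈ L ↔ P 1 ∈ L) := by
    intro i hi
    induction i, hi using Nat.le_induction with
    | base => exact fun _ => Iff.rfl
    | succ i hi ih => exact fun hil => (hstep i hi hil).symm.trans (ih (by omega))
  exact fun i hi hil => (h1 i hi hil).2 ((h1 k hk hkl).1 hPL)

/-- After leaving `s` each path stays in its own component of `G - s`, and no edge joins two
components, so the concatenation is induced. -/
theorem exists_concat {s : V} {L L' : Set V} (hL : IsComp G {s} L) (hL' : IsComp G {s} L')
    (hne : L ≠ L') {P P' : ℕ → V} {l l' : ℕ} (hP : IPath G P l) (hP' : IPath G P' l')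
    (h0 : P 0 = s) (h0' : P' 0 = s) (hl : 1 ≤ l) (hl' : 1 ≤ l') (hPL : P l ∈ L)
    (hPL' : P' l' ∈ L') : ∃ Q, IPath G Q (l + l') ∧ Q 0 = P l ∧ Q (l + l') = P' l' := by
  have hm := hP.mem_comp hL h0 hl le_rfl hPL
  have hm' := hP'.mem_comp hL' h0' hl' le_rfl hPL'
  have hcross := hL.ne_and_not_adj hL' hne
  have hs' : ∀ j, 1 ≤ j → j ≤ l' → s ≠ P' j := fun j hj hjl => by
    rw [← h0']; exact hP'.ne (by omega) hjl (by omega)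
  have hj := (hP.down (a := l) (m := l) le_rfl le_rfl).join
    (hP'.shift (a := 1) (m := l' - 1) (by omega)) (by
      have := hP'.adj_succ (i := 0) (by omega)
      simpa [h0, h0'] using this) (fun i j hi hj => by
      by_cases hi0 : l - i = 0
      · rw [hi0, h0]
        exact hs' _ (by omega) (by omega)
      · exact (hcross _ (hm _ (by omega) (by omega)) _ (hm' _ (by omega) (by omega))).1)
    (fun i j hi hj hadj => by
      by_cases hi0 : l - i = 0
      · rw [hi0, h0, ← h0', hP'.adj _ _ (by omega) (by omega)] at hadj
        omega
      · exact absurd hadj (hcross _ (hm _ (by omega) (by omega)) _ (hm' _ (by omega) (by omega))).2)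
  rw [show l + (l' - 1) + 1 = l + l' by omega] at hj
  refine ⟨_, hj, by simp, ?_⟩
  rw [if_neg (by omega)]
  congr 1
  omega

/-- A path from `s` to an end, where `s` has two non-adjacent neighbours outside the component
that contains the end. -/
theorem IPath.mem_of_fork_outside (hA : BonesIn A G) {s : V} {L : Set V} (hL : IsComp G {s} L)
    {P : ℕ → V} {l : ℕ} (hP : IPath G P l) (h0 : P 0 = s) (hl : 1 ≤ l) (hPL : P l ∈ L)
    (he : IsEnd G (P l)) {a b : V} (hf : Fork G s a b) (ha : a ∉ L) (hb : b ∉ L) : l + 1 ∈ A := by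
  have hm := hP.mem_comp hL h0 hl le_rfl hPL
  have key : ∀ c, G.Adj s c → c ∉ L → ∀ i, 0 < i → i ≤ l → ¬ G.Adj c (P i) := by
    intro c hsc hc i hi hil hadj
    exact hc (hL.mem_of_adj (hm i hi hil) hadj.symm fun h => hsc.ne (Set.mem_singleton_iff.1 h).symm)
  exact hP.mem_of_fork hA hl (h0 ▸ hf) (key a hf.1 ha) (key b hf.2.1 hb)
    (fun h => ha (h ▸ hPL)) (fun h => hb (h ▸ hPL)) he

/-- The interior of a path that avoids `X` lies in one component of `G - X`. -/
theorem IPath.connIn {P : ℕ → V} {l : ℕ} {K : Set V} (hP : IPath G P l) {i j : ℕ} (hij : i ≤ j)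
    (hj : j ≤ l) (hK : ∀ k, i ≤ k → k ≤ j → P k ∈ K) : ConnIn G K (P i) (P j) := by
  induction j, hij using Nat.le_induction with
  | base => exact ConnIn.refl _
  | succ j hij ih =>
    exact (ih (by omega) fun k hk hkj => hK k hk (by omega)).trans
      (ConnIn.single (hP.adj_succ (by omega)) (hK j hij (by omega)) (hK _ (by omega) le_rfl))

/-! ### Embedding `S` -/

theorem S_adj_center_leg {p m : ℕ} {i : Fin m} {a : Fin (p - 1)} :
    (S p m).Adj (.inl ()) (.inr (.inl (i, a))) ↔ a.val = 0 := by
  simp [S, SimpleGraph.fromRel_adj]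

theorem S_adj_leg_leg {p m : ℕ} {i j : Fin m} {a b : Fin (p - 1)} :
    (S p m).Adj (.inr (.inl (i, a))) (.inr (.inl (j, b))) ↔
      i = j ∧ (a.val + 1 = b.val ∨ b.val + 1 = a.val) := by
  simp only [S, SimpleGraph.fromRel_adj, ne_eq, Sum.inr.injEq, Sum.inl.injEq, Prod.mk.injEq]
  constructor
  · rintro ⟨-, h | h⟩
    · exact ⟨h.1, Or.inl h.2⟩
    · exact ⟨h.1.symm, Or.inr h.2⟩
  · rintro ⟨rfl, h⟩
    refine ⟨?_, h.imp (fun h => ⟨rfl, h⟩) fun h => ⟨rfl, h⟩⟩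
    rintro ⟨-, rfl⟩
    omega

theorem S_adj_leg_leaf {p m : ℕ} {i j : Fin m} {a : Fin (p - 1)} {k : Fin (m - 1)} :
    (S p m).Adj (.inr (.inl (i, a))) (.inr (.inr (j, k))) ↔ i = j ∧ a.val + 2 = p := by
  simp [S, SimpleGraph.fromRel_adj]

theorem not_S_adj_center_leaf {p m : ℕ} {i : Fin m} {k : Fin (m - 1)} :
    ¬ (S p m).Adj (.inl ()) (.inr (.inr (i, k))) := by
  simp [S, SimpleGraph.fromRel_adj]

theorem not_S_adj_leaf_leaf {p m : ℕ} {x y : Fin m × Fin (m - 1)} :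
    ¬ (S p m).Adj (.inr (.inr x)) (.inr (.inr y)) := by
  simp [S, SimpleGraph.fromRel_adj]

/-- A spider whose feet are ends with enough pendent neighbours contains `S`. -/
theorem Spider.embed_S {p m : ℕ} (hp : 3 ≤ p) {x : V} {F : Finset V} {P : V → ℕ → V}
    (hS : Spider G (p - 1) x F P) (hF : F.card = m) (hend : ∀ f ∈ F, IsEnd G f)
    (hpd : ∀ f ∈ F, ∃ g : Fin (m - 1) → V, Function.Injective g ∧ ∀ k, Pendant G f (g k)) :
    Nonempty (S p m ↪g G) := by
  obtain ⟨e⟩ : Nonempty (Fin m ≃ F) := ⟨(F.equivFinOfCardEq hF).symm⟩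
  choose! g hginj hg using hpd
  have hxF := hS.center_notMem (by omega)
  have hx : ∀ f ∈ F, ∀ k, 1 ≤ k → k ≤ p - 1 → x ≠ P f k := fun f hf k hk hkp => by
    rw [← hS.start f hf]
    exact (hS.path f hf).ne (by omega) hkp (by omega)
  -- a vertex of a leg equals a foot only at the end of the leg
  have hfoot : ∀ f ∈ F, ∀ f' ∈ F, ∀ k, k ≤ p - 1 → (P f k = f' ↔ f = f' ∧ k = p - 1) := by
    intro f hf f' hf' k hk
    constructor
    · intro he
      have hk0 : 1 ≤ k := by
        by_contra hcon
        obtain rfl : k = 0 := by omega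
        rw [hS.start f hf] at he
        exact hxF (he ▸ hf')
      have hff : f = f' := by
        by_contra hne
        exact hS.ne f hf f' hf' hne k (p - 1) hk0 hk (by omega) le_rfl
          (he.trans (hS.last f' hf').symm)
      refine ⟨hff, ?_⟩
      subst hff
      exact (hS.path f hf).inj _ _ hk le_rfl (he.trans (hS.last f hf).symm)
    · rintro ⟨rfl, rfl⟩
      exact hS.last f hf
  -- A pendent vertex on a leg would have a foot as its neighbour nearer to the centre, or, at `k =
  -- 0`, as the first vertex of the leg. The former is out of range and the latter needs `p = 2`.
  have hpleg : ∀ f ∈ F, ∀ f' ∈ F, ∀ a, Pendant G f a → ∀ k, k ≤ p - 1 → P f' k ≠ a := by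
    rintro f hf f' hf' a ha k hk rfl
    rcases Nat.eq_zero_or_pos k with rfl | hk0
    · have h1 := (hS.path f' hf').adj_succ (i := 0) (by omega)
      have h2 := ((hfoot f' hf' f hf _ (by omega)).1 ((ha _).1 h1)).2
      omega
    · have h1 := (hS.path f' hf').adj_succ (i := k - 1) (by omega)
      rw [show k - 1 + 1 = k by omega] at h1
      have h2 := ((hfoot f' hf' f hf _ (by omega)).1 ((ha _).1 h1.symm)).2
      omega
  let φ : SVertex p m → V := fun v =>
    match v with
    | .inl _ => x
    | .inr (.inl (i, a)) => P (e i) (a.val + 1)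
    | .inr (.inr (i, k)) => g (e i) k
  have hlegle : ∀ a : Fin (p - 1), a.val + 1 ≤ p - 1 := fun a => a.2
  have hφ : Function.Injective φ := by
    rintro (u | ⟨i, a⟩ | ⟨i, k⟩) (v | ⟨j, b⟩ | ⟨j, l⟩) he
    · rfl
    · exact absurd he (hx _ (e j).2 _ (by omega) (hlegle b))
    · exact absurd ((hS.start _ (e j).2).trans he)
        (hpleg _ (e j).2 _ (e j).2 _ (hg _ (e j).2 l) 0 (by omega))
    · exact absurd he.symm (hx _ (e i).2 _ (by omega) (hlegle a))
    · have hij : i = j := by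
        by_contra hne
        exact hS.ne _ (e i).2 _ (e j).2 (fun h => hne (e.injective (Subtype.ext h))) _ _ (by omega)
          (hlegle a) (by omega) (hlegle b) he
      subst hij
      have := (hS.path _ (e i).2).inj _ _ (hlegle a) (hlegle b) he
      have hab : a = b := Fin.ext (by omega)
      rw [hab]
    · exact absurd he (hpleg _ (e j).2 _ (e i).2 _ (hg _ (e j).2 l) _ (hlegle a))
    · exact absurd ((hS.start _ (e i).2).trans he.symm)
        (hpleg _ (e i).2 _ (e i).2 _ (hg _ (e i).2 k) 0 (by omega))
    · exact absurd he.symm (hpleg _ (e i).2 _ (e j).2 _ (hg _ (e i).2 k) _ (hlegle b))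
    · have h1 : G.Adj (g (e i) k) (e i) := (hg _ (e i).2 k).adj.symm
      have he' : g (e i) k = g (e j) l := he
      rw [he'] at h1
      have h2 := (hg _ (e j).2 l _).1 h1
      have hij : i = j := e.injective (Subtype.ext h2)
      subst hij
      rw [hginj _ (e i).2 he']
  have hcl : ∀ i (a : Fin (p - 1)), G.Adj x (P (e i) (a.val + 1)) ↔ a.val = 0 := by
    intro i a
    rw [← hS.start _ (e i).2, (hS.path _ (e i).2).adj _ _ (by omega) (hlegle a)]
    omega
  have hlf : ∀ i j (a : Fin (p - 1)) k, G.Adj (P (e i) (a.val + 1)) (g (e j) k) ↔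
      i = j ∧ a.val + 2 = p := by
    intro i j a k
    rw [SimpleGraph.adj_comm, hg _ (e j).2 k, hfoot _ (e i).2 _ (e j).2 _ (hlegle a)]
    refine and_congr ⟨fun h => e.injective (Subtype.ext h), fun h => h ▸ rfl⟩ ?_
    omega
  have hcf : ∀ i k, ¬ G.Adj x (g (e i) k) := by
    intro i k hadj
    exact hxF (((hg _ (e i).2 k _).1 hadj.symm) ▸ (e i).2)
  refine ⟨⟨⟨φ, hφ⟩, ?_⟩⟩
  rintro (u | ⟨i, a⟩ | ⟨i, k⟩) (v | ⟨j, b⟩ | ⟨j, l⟩)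
  · exact iff_of_false (G.loopless.irrefl _) ((S p m).loopless.irrefl _)
  · rw [S_adj_center_leg]
    exact hcl j b
  · exact iff_of_false (hcf j l) not_S_adj_center_leaf
  · rw [SimpleGraph.adj_comm, SimpleGraph.adj_comm (S p m), S_adj_center_leg]
    exact hcl i a
  · rw [S_adj_leg_leg]
    by_cases hij : i = j
    · subst hij
      simp only [true_and]
      refine ((hS.path _ (e i).2).adj _ _ (hlegle a) (hlegle b)).trans ?_
      omega
    · refine iff_of_false ?_ fun h => hij h.1
      exact hS.not_adj _ (e i).2 _ (e j).2 (fun h => hij (e.injective (Subtype.ext h))) _ _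
        (by omega) (hlegle a) (by omega) (hlegle b)
  · rw [S_adj_leg_leaf]
    exact hlf i j a l
  · rw [SimpleGraph.adj_comm, SimpleGraph.adj_comm (S p m)]
    exact iff_of_false (hcf i k) not_S_adj_center_leaf
  · rw [SimpleGraph.adj_comm, SimpleGraph.adj_comm (S p m), S_adj_leg_leaf]
    exact hlf j i b k
  · refine iff_of_false ?_ not_S_adj_leaf_leaf
    intro hadj
    have hl : g (e j) l = e i := (hg _ (e i).2 k _).1 hadj
    exact (hg _ (e j).2 l).ne_of_isEnd (hl ▸ hend _ (e i).2)

end BoneDeficiency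

/-! ### Tips of the barrier when the lengths are `h` and `2 * h`, and counting tools. -/

namespace BoneDeficiency

variable {V : Type*} {G : SimpleGraph V} {A : Set ℕ} {h n : ℕ}

theorem exists_ipath_ne (hG : G.Connected) {u v : V} (huv : u ≠ v) :
    ∃ P l, IPath G P l ∧ P 0 = u ∧ P l = v ∧ 1 ≤ l := by
  obtain ⟨P, l, hP, h0, hl, -⟩ := exists_ipath_of_connSet (connSet_univ hG) (Set.mem_univ u)
    (Set.mem_univ v)
  refine ⟨P, l, hP, h0, hl, ?_⟩
  by_contra hcon
  obtain rfl : l = 0 := by omega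
  exact huv (h0.symm.trans hl)

section Tips

variable [Finite V] {S : Set V}

/-- If all lengths are `h` and `2 * h`, a barrier vertex that is not a tip is at distance `h` from
all tips. -/
theorem length_eq_of_not_isTip (hc : DeficiencyCritical G) (hd : 2 ≤ deficiency G)
    (hS : MinBarrier G S) (hA : BonesIn A G) (hA2 : ∀ x, x + 1 ∈ A → x = h ∨ x = 2 * h)
    {s : V} (hs : s ∈ S) (hns : ¬ IsTip G S s)
    {P : ℕ → V} {l : ℕ} (hP : IPath G P l) (h0 : P 0 = s) (he : IsTip G S (P l)) : l = h := by
  have hnes : ∀ e, IsTip G S e → e ∉ ({s} : Set V) := by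
    intro e he hes
    exact hns (Set.mem_singleton_iff.1 hes ▸ he)
  have hlpos : ∀ {P : ℕ → V} {l : ℕ}, P 0 = s → IsTip G S (P l) → 1 ≤ l := by
    intro P l h0 he
    by_contra hcon
    obtain rfl : l = 0 := by omega
    exact hns (h0 ▸ he)
  obtain ⟨L₂, hL₂⟩ := exists_fork_outside hS hs
  obtain ⟨L, L', hL, hL', hLL, ⟨e₁, he₁L, he₁⟩, ⟨e₂, he₂L, he₂⟩⟩ := exists_two_tips hc hS hd hs hns
  -- the claim for paths to a component other than `L₂`
  have key : ∀ {P P' : ℕ → V} {l l' : ℕ}, IPath G P l → IPath G P' l' → P 0 = s → P' 0 = s →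
      IsTip G S (P l) → IsTip G S (P' l') → comp G {s} (P l) ≠ L₂ →
      comp G {s} (P l) ≠ comp G {s} (P' l') → l = h ∧ l' = h := by
    intro P P' l l' hP hP' h0 h0' he he' hne hne'
    have hl := hlpos h0 he
    have hl' := hlpos h0' he'
    have hC := isComp_comp (G := G) (hnes _ he)
    have hC' := isComp_comp (G := G) (hnes _ he')
    obtain ⟨a, b, hf, ha, hb⟩ := hL₂ _ hC hne
    have h1 := hP.mem_of_fork_outside hA hC h0 hl mem_comp_self (he.isEnd hc hS) hf ha hb
    obtain ⟨Q, hQ, hQ0, hQl⟩ := exists_concat hC hC' hne' hP hP' h0 h0' hl hl' mem_comp_self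
      mem_comp_self
    have h2 := hQ.mem_of_isEnd hA (by omega) (hQ0 ▸ he.isEnd hc hS) (hQl ▸ he'.isEnd hc hS)
    have h3 := hA2 _ h1
    have h4 := hA2 _ h2
    omega
  have hpath : ∀ e, IsTip G S e → ∃ P l, IPath G P l ∧ P 0 = s ∧ P l = e := by
    intro e he
    obtain ⟨P, l, hP, h0, hl, -⟩ := exists_ipath_ne hc.1 (u := s) (v := e)
      (fun h => hns (h ▸ he))
    exact ⟨P, l, hP, h0, hl⟩
  obtain ⟨P₁, l₁, hP₁, h₁0, h₁l⟩ := hpath e₁ he₁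
  obtain ⟨P₂, l₂, hP₂, h₂0, h₂l⟩ := hpath e₂ he₂
  subst h₁l h₂l
  have hc1 := hL.eq_comp he₁L
  have hc2 := hL'.eq_comp he₂L
  have hne12 : comp G {s} (P₁ l₁) ≠ comp G {s} (P₂ l₂) := by rw [← hc1, ← hc2]; exact hLL
  -- Pair the given tip with one of the two known tips in another component. If its own component is
  -- the exceptional `L₂`, the fork is taken on behalf of its partner.
  by_cases hX : comp G {s} (P l) = comp G {s} (P₁ l₁)
  · have hX2 : comp G {s} (P l) ≠ comp G {s} (P₂ l₂) := by rw [hX]; exact hne12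
    by_cases hX3 : comp G {s} (P l) = L₂
    · exact (key hP₂ hP h₂0 h0 he₂ he (fun h' => hX2 (hX3.trans h'.symm)) hX2.symm).2
    · exact (key hP hP₂ h0 h₂0 he he₂ hX3 hX2).1
  · by_cases hX3 : comp G {s} (P l) = L₂
    · exact (key hP₁ hP h₁0 h0 he₁ he (fun h' => hX (hX3.trans h'.symm)) (Ne.symm hX)).2
    · exact (key hP hP₁ h0 h₁0 he he₁ hX3 hX).1

/-- There is at most one barrier vertex that is not a tip. -/
theorem eq_of_not_isTip (hc : DeficiencyCritical G) (hd : 2 ≤ deficiency G)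
    (hS : MinBarrier G S) (hA : BonesIn A G) (hA2 : ∀ x, x + 1 ∈ A → x = h ∨ x = 2 * h)
    {s t : V} (hs : s ∈ S) (hns : ¬ IsTip G S s) (ht : t ∈ S) (hnt : ¬ IsTip G S t) : s = t := by
  by_contra hne
  obtain ⟨L, L', hL, hL', hLL, h₁, h₂⟩ := exists_two_tips hc hS hd ht hnt
  have hC := isComp_comp (G := G) (X := {t}) (v := s) (by simpa using hne)
  obtain ⟨M, e, hM, hMs, he, hte⟩ : ∃ M e, IsComp G {t} M ∧ M ≠ comp G {t} s ∧ e ∈ M ∧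
      IsTip G S e := by
    by_cases hcase : L = comp G {t} s
    · obtain ⟨e, he, hte⟩ := h₂
      exact ⟨L', e, hL', fun h' => hLL (hcase.trans h'.symm), he, hte⟩
    · obtain ⟨e, he, hte⟩ := h₁
      exact ⟨L, e, hL, hcase, he, hte⟩
  obtain ⟨P, l, hP, h0, hl, hlpos⟩ := exists_ipath_ne hc.1 (u := t) (v := s) (Ne.symm hne)
  obtain ⟨P', l', hP', h0', hl', hlpos'⟩ := exists_ipath_ne hc.1 (u := t) (v := e)
    (fun h' => hM.notMem he h'.symm)
  subst hl'
  -- The path from `t` to `e` has length `h`, and so has the longer path from `s` through `t` to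
  -- `e`.
  have e1 := length_eq_of_not_isTip hc hd hS hA hA2 ht hnt hP' h0' hte
  obtain ⟨Q, hQ, hQ0, hQl⟩ := exists_concat hC hM (Ne.symm hMs) hP hP' h0 h0' hlpos hlpos'
    (hl ▸ mem_comp_self) he
  have e2 := length_eq_of_not_isTip hc hd hS hA hA2 hs hns hQ (hQ0.trans hl) (hQl ▸ hte)
  omega

end Tips

/-- The number of ends is less than the bound on the local independence number; in the extreme
case the ends are the feet of a spider. -/
theorem card_ends_lt [Finite V] (hG : G.Connected) (hA : BonesIn A G) (hr : SumRule A h)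
    (hA2 : ∀ x, x + 1 ∈ A → x = h ∨ x = 2 * h) (hα : localIndepNum G < n) (E : Finset V)
    (hE2 : 2 ≤ E.card) (hE : ∀ e ∈ E, IsEnd G e) :
    E.card < n ∧ (E.card + 1 = n → ∃ x P, Spider G h x E P) := by
  classical
  have h2 := hr.two_le
  obtain ⟨x, F, P, hS, hFE, hcov⟩ := exists_spider hG hA hr hA2 E hE2 hE
  have hxF := hS.center_notMem (by omega)
  have hinj : Set.InjOn (fun f => P f 1) (F : Set V) := by
    intro f hf g hg he
    by_contra hne
    exact hS.ne f hf g hg hne 1 1 le_rfl (by omega) le_rfl (by omega) he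
  have hadj : ∀ f ∈ F, G.Adj x (P f 1) := by
    intro f hf
    rw [← hS.start f hf]
    exact (hS.path f hf).adj_succ (by omega)
  have hnadj : ∀ a ∈ F.image fun f => P f 1, ∀ b ∈ F.image fun f => P f 1, ¬ G.Adj a b := by
    intro a ha b hb
    obtain ⟨f, hf, rfl⟩ := Finset.mem_image.1 ha
    obtain ⟨g, hg, rfl⟩ := Finset.mem_image.1 hb
    by_cases hfg : f = g
    · subst hfg
      exact G.loopless.irrefl _
    · exact hS.not_adj f hf g hg hfg 1 1 le_rfl (by omega) le_rfl (by omega)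
  by_cases hxE : x ∈ E
  · have hEF : E = insert x F := by
      ext e
      rw [Finset.mem_insert]
      exact ⟨hcov e, fun he => he.elim (fun h' => h' ▸ hxE) fun h' => hFE h'⟩
    have hcard : E.card = F.card + 1 := by rw [hEF, Finset.card_insert_of_notMem hxF]
    obtain ⟨a, b, hab, ha, hb⟩ := hE x hxE
    have hleg : ∀ c, Pendant G x c → ∀ f ∈ F, ¬ G.Adj c (P f 1) ∧ c ≠ P f 1 := by
      intro c hcp f hf
      constructor
      · intro hadj'
        have := (hcp _).1 hadj'
        exact (hadj f hf).ne this.symm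
      · rintro rfl
        have h1 := (hcp _).1 ((hS.path f hf).adj_succ (i := 1) (by omega))
        rw [← hS.start f hf] at h1
        exact (hS.path f hf).ne (by omega) (by omega) (by omega) h1
    -- A centre that is an end adds two pendent vertices to the star but only one to the ends, so
    -- this case misses the extreme value.
    have := card_lt_of_localIndepNum_lt hα (s := x) (insert a (insert b (F.image fun f => P f 1)))
      (by
        intro c hc
        simp only [Finset.mem_insert, Finset.mem_image] at hc
        rcases hc with rfl | rfl | ⟨f, hf, rfl⟩
        · exact ha.adj
        · exact hb.adj
        · exact hadj f hf)
      (by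
        have hpp : ∀ c, Pendant G x c → ∀ d, (d = a ∨ d = b) → ¬ G.Adj c d := by
          intro c hcp d hd hcd
          have hdx := (hcp d).1 hcd
          rcases hd with rfl | rfl
          · exact ha.adj.ne hdx.symm
          · exact hb.adj.ne hdx.symm
        intro c hc d hd
        simp only [Finset.mem_insert] at hc hd
        rcases hc with rfl | rfl | hc <;> rcases hd with rfl | rfl | hd
        · exact hpp _ ha _ (Or.inl rfl)
        · exact hpp _ ha _ (Or.inr rfl)
        · obtain ⟨f, hf, rfl⟩ := Finset.mem_image.1 hd
          exact (hleg _ ha f hf).1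
        · exact hpp _ hb _ (Or.inl rfl)
        · exact hpp _ hb _ (Or.inr rfl)
        · obtain ⟨f, hf, rfl⟩ := Finset.mem_image.1 hd
          exact (hleg _ hb f hf).1
        · obtain ⟨f, hf, rfl⟩ := Finset.mem_image.1 hc
          exact fun h' => (hleg _ ha f hf).1 h'.symm
        · obtain ⟨f, hf, rfl⟩ := Finset.mem_image.1 hc
          exact fun h' => (hleg _ hb f hf).1 h'.symm
        · exact hnadj c hc d hd)
    rw [Finset.card_insert_of_notMem, Finset.card_insert_of_notMem,
      Finset.card_image_of_injOn hinj] at this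
    · omega
    · intro hm
      obtain ⟨f, hf, he⟩ := Finset.mem_image.1 hm
      exact (hleg _ hb f hf).2 he.symm
    · intro hm
      rcases Finset.mem_insert.1 hm with hm | hm
      · exact hab hm
      · obtain ⟨f, hf, he⟩ := Finset.mem_image.1 hm
        exact (hleg _ ha f hf).2 he.symm
  · have hEF : F = E := Finset.Subset.antisymm hFE fun e he =>
      (hcov e he).resolve_left fun h' => hxE (h' ▸ he)
    subst hEF
    have := card_lt_of_localIndepNum_lt hα (s := x) (F.image fun f => P f 1)
      (by
        intro c hc
        obtain ⟨f, hf, rfl⟩ := Finset.mem_image.1 hc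
        exact hadj f hf) hnadj
    rw [Finset.card_image_of_injOn hinj] at this
    exact ⟨this, fun _ => ⟨x, P, hS⟩⟩

/-- The odd components of `G - S` that are pendent vertices at `e`. -/
def pendantComps (G : SimpleGraph V) (S : Set V) (e : V) : Set (Set V) :=
  {K ∈ oddComps G S | ∃ a, K = {a} ∧ Pendant G e a}

theorem exists_pendants_of_ncard [Finite V] {S : Set V} {e : V} {k : ℕ}
    (hk : k ≤ (pendantComps G S e).ncard) :
    ∃ g : Fin k → V, Function.Injective g ∧ ∀ i, Pendant G e (g i) := by
  classical
  have hex : ∀ K : pendantComps G S e, ∃ a, K.1 = {a} ∧ Pendant G e a := fun K => K.2.2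
  choose f hf hp using hex
  have hfin : Nonempty (Fin k ↪ pendantComps G S e) := by
    have := Fintype.ofFinite (pendantComps G S e)
    refine Function.Embedding.nonempty_of_card_le ?_
    rw [Fintype.card_fin, Fintype.card_eq_nat_card, Nat.card_coe_set_eq]
    exact hk
  obtain ⟨φ⟩ := hfin
  refine ⟨fun i => f (φ i), fun i j hij => ?_, fun i => hp _⟩
  refine φ.injective (Subtype.ext ?_)
  rw [hf (φ i), hf (φ j)]
  exact congrArg _ hij

/-- Two vertices of a family adjacent to every member give twice as many incidences. -/
theorem two_mul_card_le_sum {α β : Type*} (E : Finset α) (O : Finset β) (r : α → β → Prop)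
    [∀ a b, Decidable (r a b)] (hO : ∀ b ∈ O, ∃ x ∈ E, ∃ y ∈ E, x ≠ y ∧ r x b ∧ r y b) :
    2 * O.card ≤ ∑ a ∈ E, (O.filter fun b => r a b).card := by
  have h := Finset.sum_card_bipartiteAbove_eq_sum_card_bipartiteBelow (s := E) (t := O) r
  rw [show (∑ a ∈ E, (O.filter fun b => r a b).card) = ∑ b ∈ O, (E.filter fun a => r a b).card
    from h, mul_comm, ← smul_eq_mul]
  refine Finset.card_nsmul_le_sum _ _ _ fun b hb => ?_
  obtain ⟨x, hx, y, hy, hxy, h1, h2⟩ := hO b hb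
  have : 1 < (E.filter fun a => r a b).card := by
    rw [Finset.one_lt_card]
    exact ⟨x, by simp [hx, h1], y, by simp [hy, h2], hxy⟩
  exact this

/-- The non-pendent neighbour `w` extends the star formed by the pendent vertices at `e`. -/
theorem pendantComps_lt [Finite V] {S : Set V} (hα : localIndepNum G < n) {e w : V}
    (hw : G.Adj e w) {w' : V} (hw' : G.Adj w w') (hne : w' ≠ e) :
    (pendantComps G S e).ncard + 1 < n := by
  classical
  cases nonempty_fintype V
  have hwp : ∀ K ∈ pendantComps G S e, ∀ a ∈ K, a ≠ w ∧ ¬ G.Adj a w := by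
    rintro K ⟨hK, a, rfl, ha⟩ b hb
    obtain rfl : b = a := hb
    refine ⟨?_, fun hadj => ?_⟩
    · rintro rfl
      exact hne ((ha _).1 hw')
    · exact hw.ne ((ha w).1 hadj).symm
  have := card_family_lt hα (s := e) (insert {w} (pendantComps G S e).toFinset) ?_ ?_
  · rwa [Finset.card_insert_of_notMem, ← Set.ncard_eq_toFinset_card'] at this
    rw [Set.mem_toFinset]
    exact fun hm => (hwp _ hm w rfl).1 rfl
  · intro K hK
    rw [Finset.mem_insert, Set.mem_toFinset] at hK
    rcases hK with rfl | ⟨hK, a, rfl, ha⟩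
    · exact ⟨w, rfl, hw⟩
    · exact ⟨a, rfl, ha.adj⟩
  · intro K hK K' hK' hKK
    rw [Finset.mem_insert, Set.mem_toFinset] at hK hK'
    rcases hK with rfl | hK <;> rcases hK' with rfl | hK'
    · exact absurd rfl hKK
    · rintro a rfl b hb
      exact ⟨(hwp _ hK' b hb).1.symm, fun h' => (hwp _ hK' b hb).2 h'.symm⟩
    · rintro a ha b rfl
      exact hwp _ hK a ha
    · exact hK.1.1.ne_and_not_adj hK'.1.1 hKK

end BoneDeficiency

/-! ### The case `q = 2p - 1`: critical graphs of large deficiency contain `S`. -/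

namespace BoneDeficiency

variable {V : Type*} {G : SimpleGraph V} {n p : ℕ}

theorem sumRule_two_mul_sub_one (hp : 3 ≤ p) (hodd : Odd p) :
    SumRule {p, 2 * p - 1} (p - 1) ∧
      ∀ x, x + 1 ∈ ({p, 2 * p - 1} : Set ℕ) → x = p - 1 ∨ x = 2 * (p - 1) := by
  have hmem : ∀ x, x + 1 ∈ ({p, 2 * p - 1} : Set ℕ) → x = p - 1 ∨ x = 2 * (p - 1) := by
    intro x hx
    simp only [Set.mem_insert_iff, Set.mem_singleton_iff] at hx
    omega
  obtain ⟨c, hc⟩ := hodd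
  refine ⟨⟨by omega, ?_, ?_, ?_⟩, hmem⟩
  · intro x hx
    rcases hmem x hx with h | h
    · exact ⟨c, by omega⟩
    · exact ⟨2 * c, by omega⟩
  · intro x hx
    have := hmem x hx
    omega
  · intro x y hx hy hxy
    have h1 := hmem x hx
    have h2 := hmem y hy
    have h3 := hmem (x + y) hxy
    refine ⟨by omega, by omega, fun w hw => ?_⟩
    have := hmem w hw
    omega

theorem sq_sub_eq (m : ℕ) : (m + 4) ^ 2 - 3 * (m + 4) + 1 = m ^ 2 + 5 * m + 5 := by
  have : (m + 4) ^ 2 = m ^ 2 + 5 * m + 4 + 3 * (m + 4) := by ring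
  omega

/-- A pendent vertex that is an odd component hangs at a vertex of the barrier. -/
theorem mem_of_pendant_isComp {S : Set V} {a e : V} (hK : IsComp G S {a}) (ha : Pendant G e a) :
    e ∈ S := by
  by_contra he
  have := hK.mem_of_adj rfl ha.adj.symm he
  exact ha.adj.ne this

/-- Critical graphs of the largest possible deficiency contain `S`. -/
theorem embeds_S [Finite V] (hn : 3 < n) (hp : 3 ≤ p) (hodd : Odd p) (hc : DeficiencyCritical G)
    (hA : BonesIn {p, 2 * p - 1} G) (hα : localIndepNum G < n)
    (hd : n ^ 2 - 3 * n + 1 ≤ deficiency G) :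
    deficiency G ≤ n ^ 2 - 3 * n + 1 ∧ Nonempty (S p (n - 1) ↪g G) := by
  classical
  cases nonempty_fintype V
  obtain ⟨hr, hA2⟩ := sumRule_two_mul_sub_one hp hodd
  -- Avoids truncated subtraction: the bound becomes `m ^ 2 + 5 * m + 5`, stars have at most `m + 3`
  -- leaves, and there are at most `m + 3` ends.
  obtain ⟨m, rfl⟩ : ∃ m, n = m + 4 := ⟨n - 4, by omega⟩
  rw [sq_sub_eq] at hd ⊢
  have hd2 : 2 ≤ deficiency G := by omega
  obtain ⟨B, hB⟩ := exists_minBarrier hd2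
  have hBne := hB.nonempty hc.1 hd2
  set E : Finset V := Finset.univ.filter fun e => IsTip G B e with hEdef
  have hE : ∀ e, e ∈ E ↔ IsTip G B e := fun e => by simp [hEdef]
  have hend : ∀ e ∈ E, IsEnd G e := fun e he => ((hE e).1 he).isEnd hc hB
  set O : Finset (Set V) := (oddComps G B).toFinset with hOdef
  have hO : ∀ K, K ∈ O ↔ K ∈ oddComps G B := fun K => by rw [hOdef, Set.mem_toFinset]
  have hOcard : deficiency G + B.ncard ≤ O.card := by
    rw [hOdef, ← Set.ncard_eq_toFinset_card']
    exact hB.ge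
  set Pd : V → Finset (Set V) := fun e => (pendantComps G B e).toFinset with hPddef
  have hPd : ∀ e K, K ∈ Pd e ↔ K ∈ pendantComps G B e := fun e K => by rw [hPddef, Set.mem_toFinset]
  have hPdcard : ∀ e, (Pd e).card = (pendantComps G B e).ncard := fun e =>
    (Set.ncard_eq_toFinset_card' _).symm
  -- paths between tips, and from other barrier vertices to tips, are long
  have hlong : ∀ {P : ℕ → V} {l : ℕ}, IPath G P l → 1 ≤ l → IsTip G B (P 0) → IsTip G B (P l) →
      p - 1 ≤ l := fun hP hl h0 h1 =>
    hr.ge _ (hP.mem_of_isEnd hA hl (h0.isEnd hc hB) (h1.isEnd hc hB))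
  by_cases hs : ∃ s ∈ B, ¬ IsTip G B s
  · obtain ⟨s, hsB, hs⟩ := hs
    have hBE : ∀ t ∈ B, t = s ∨ t ∈ E := by
      intro t ht
      by_cases hte : IsTip G B t
      · exact Or.inr ((hE t).2 hte)
      · exact Or.inl (eq_of_not_isTip hc hd2 hB hA hA2 ht hte hsB hs)
    have hsE : s ∉ E := fun h => hs ((hE s).1 h)
    have hBcard : B.ncard = E.card + 1 := by
      have : B = ↑(insert s E) := by
        ext t
        simp only [Finset.coe_insert, Set.mem_insert_iff, Finset.mem_coe]
        exact ⟨hBE t, fun h => h.elim (fun h => h ▸ hsB) fun h => ((hE t).1 h).1⟩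
      rw [this, Set.ncard_coe_finset, Finset.card_insert_of_notMem hsE]
    have hE2 : 2 ≤ E.card := by
      obtain ⟨L, L', hL, hL', hLL, ⟨e, heL, he⟩, ⟨e', heL', he'⟩⟩ := exists_two_tips hc hB hd2 hsB hs
      have : 1 < E.card := by
        rw [Finset.one_lt_card]
        refine ⟨e, (hE e).2 he, e', (hE e').2 he', ?_⟩
        rintro rfl
        exact hLL (hL.eq hL' heL heL')
      exact this
    obtain ⟨hk, hspider⟩ := card_ends_lt hc.1 hA hr hA2 hα E hE2 hend
    -- Odd components are sorted into those adjacent to the unique non-tip `s`, the pendent vertices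
    -- at tips, and the remaining `O'`, each adjacent to two tips.
    set Os := O.filter fun K => ∃ a ∈ K, G.Adj s a with hOs
    set O' := O.filter fun K => (¬ ∃ e a, K = {a} ∧ Pendant G e a) ∧ ¬ ∃ a ∈ K, G.Adj s a with hO'
    have hOscard : Os.card < m + 4 := by
      refine card_comps_lt hα (s := s) (X := B) Os ?_ ?_
      · exact fun K hK => (Finset.mem_filter.1 hK).2
      · exact fun K hK => ((hO K).1 (Finset.mem_filter.1 hK).1).1
    have hcover : O ⊆ Os ∪ E.biUnion Pd ∪ O' := by
      intro K hK
      by_cases h1 : ∃ a ∈ K, G.Adj s a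
      · exact Finset.mem_union_left _ (Finset.mem_union_left _ (Finset.mem_filter.2 ⟨hK, h1⟩))
      by_cases h2 : ∃ e a, K = {a} ∧ Pendant G e a
      · obtain ⟨e, a, rfl, ha⟩ := h2
        have heB := mem_of_pendant_isComp ((hO _).1 hK).1 ha
        have hes : e ≠ s := by
          rintro rfl
          exact h1 ⟨a, rfl, ha.adj⟩
        refine Finset.mem_union_left _ (Finset.mem_union_right _ ?_)
        rw [Finset.mem_biUnion]
        exact ⟨e, (hBE e heB).resolve_left hes, (hPd _ _).2 ⟨(hO _).1 hK, a, rfl, ha⟩⟩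
      · exact Finset.mem_union_right _ (Finset.mem_filter.2 ⟨hK, h2, h1⟩)
    have hsum1 : O.card ≤ Os.card + ∑ e ∈ E, (Pd e).card + O'.card :=
      (Finset.card_le_card hcover).trans ((Finset.card_union_le _ _).trans (Nat.add_le_add_right
        ((Finset.card_union_le _ _).trans (Nat.add_le_add_left Finset.card_biUnion_le _)) _))
    have hdouble : 2 * O'.card ≤
        ∑ e ∈ E, (O'.filter fun K => ∃ a ∈ K, G.Adj e a).card := by
      refine two_mul_card_le_sum E O' (fun e K => ∃ a ∈ K, G.Adj e a) ?_
      intro K hK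
      obtain ⟨hKO, hKp, hKs⟩ := Finset.mem_filter.1 hK
      rcases pendant_or_two_adj hc hB hBne ((hO K).1 hKO).1 with ⟨t, ht, a, hKa, hp⟩ |
        ⟨t, ht, t', ht', htt, h1, h2⟩
      · exact absurd ⟨t, a, hKa, hp⟩ hKp
      · refine ⟨t, (hBE t ht).resolve_left ?_, t', (hBE t' ht').resolve_left ?_, htt, h1, h2⟩
        · rintro rfl; exact hKs h1
        · rintro rfl; exact hKs h2
    -- The summand `1` is the component of `G - B` containing the interior of a path from `s` to
    -- `e`. No barrier vertex lies inside, since all paths from `s` to tips have the same length.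
    -- This component is adjacent to `s`, hence not in `O'`.
    have hlocal : ∀ e ∈ E, (Pd e).card + 1 + (O'.filter fun K => ∃ a ∈ K, G.Adj e a).card ≤ m + 3 := by
      intro e he
      have hte := (hE e).1 he
      obtain ⟨P, l, hP, h0, hl, hlpos⟩ := exists_ipath_ne hc.1 (u := s) (v := e)
        (fun h => hsE (h ▸ he))
      subst hl
      have hlh := length_eq_of_not_isTip hc hd2 hB hA hA2 hsB hs hP h0 hte
      have hint : ∀ i, 1 ≤ i → i ≤ l - 1 → P i ∉ B := by
        intro i hi hil hiB
        rcases hBE _ hiB with h | h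
        · exact hP.ne (by omega) (Nat.zero_le _) (by omega) (h.trans h0.symm)
        · have := length_eq_of_not_isTip hc hd2 hB hA hA2 hsB hs
            (hP.take (m := i) (by omega)) h0 ((hE _).1 h)
          omega
      have hK0 := isComp_comp (G := G) (hint 1 le_rfl (by omega))
      have hlast : P (l - 1) ∈ comp G B (P 1) :=
        hP.connIn (by omega) (by omega) fun i hi hil => hint i hi hil
      have hel : G.Adj (P l) (P (l - 1)) := (hP.adj _ _ le_rfl (by omega)).2 (by omega)
      have hs1 : G.Adj s (P 1) := h0 ▸ hP.adj_succ (by omega)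
      have hK0P : comp G B (P 1) ∉ Pd (P l) := by
        intro hm
        obtain ⟨-, a, ha, hpa⟩ := (hPd _ _).1 hm
        have : P 1 ∈ ({a} : Set V) := ha ▸ mem_comp_self
        obtain rfl : P 1 = a := this
        exact hsE (((hpa s).1 hs1.symm) ▸ he)
      have hK0O : comp G B (P 1) ∉ O'.filter fun K => ∃ a ∈ K, G.Adj (P l) a := by
        intro hm
        exact (Finset.mem_filter.1 (Finset.mem_filter.1 hm).1).2.2 ⟨_, mem_comp_self, hs1⟩
      have hdis : Disjoint (Pd (P l)) (O'.filter fun K => ∃ a ∈ K, G.Adj (P l) a) := by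
        rw [Finset.disjoint_left]
        intro K hK hK'
        obtain ⟨-, a, ha, hpa⟩ := (hPd _ _).1 hK
        exact (Finset.mem_filter.1 (Finset.mem_filter.1 hK').1).2.1 ⟨_, a, ha, hpa⟩
      have := card_comps_lt hα (s := P l) (X := B) (insert (comp G B (P 1))
        (Pd (P l) ∪ O'.filter fun K => ∃ a ∈ K, G.Adj (P l) a)) ?_ ?_
      · rw [Finset.card_insert_of_notMem, Finset.card_union_of_disjoint hdis] at this
        · omega
        · rw [Finset.mem_union]
          exact fun h => h.elim hK0P hK0O
      · intro K hK
        rw [Finset.mem_insert, Finset.mem_union] at hK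
        rcases hK with rfl | hK | hK
        · exact ⟨_, hlast, hel⟩
        · obtain ⟨-, a, rfl, hpa⟩ := (hPd _ _).1 hK
          exact ⟨a, rfl, hpa.adj⟩
        · exact (Finset.mem_filter.1 hK).2
      · intro K hK
        rw [Finset.mem_insert, Finset.mem_union] at hK
        rcases hK with rfl | hK | hK
        · exact hK0
        · exact ((hPd _ _).1 hK).1.1
        · exact ((hO K).1 (Finset.mem_filter.1 (Finset.mem_filter.1 hK).1).1).1
    have hsum2 : ∑ e ∈ E, (Pd e).card + E.card +
        ∑ e ∈ E, (O'.filter fun K => ∃ a ∈ K, G.Adj e a).card ≤ E.card * (m + 3) := by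
      have := Finset.sum_le_sum hlocal
      rw [Finset.sum_add_distrib, Finset.sum_add_distrib, Finset.sum_const, Finset.sum_const] at this
      simpa using this
    -- The counts give `deficiency G ≤ m + 2 + E.card * (m + 1)`, which is below the bound when
    -- there are fewer than `m + 3` tips.
    have hk' : E.card = m + 3 := by
      by_contra hne
      have h1 : E.card ≤ m + 2 := by omega
      have h2 : E.card * (m + 1) ≤ (m + 2) * (m + 1) := Nat.mul_le_mul_right _ h1
      have h3 : E.card * (m + 3) = E.card * (m + 1) + 2 * E.card := by ring
      have h4 : (m + 2) * (m + 1) = m ^ 2 + 3 * m + 2 := by ring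
      omega
    -- Members of `O'` count twice in the local sums but once in the barrier inequality, so equality
    -- leaves no room for them. All of the weight is on pendent vertices, `m + 2` at every tip.
    have hsP : (m + 3) * (m + 2) ≤ ∑ e ∈ E, (Pd e).card := by
      rw [hk'] at hsum2 hBcard
      have h3 : (m + 3) * (m + 3) = m ^ 2 + 6 * m + 9 := by ring
      have h4 : (m + 3) * (m + 2) = m ^ 2 + 5 * m + 6 := by ring
      omega
    have hall : ∀ e ∈ E, m + 2 ≤ (Pd e).card := by
      intro e he
      by_contra hlt
      have : ∑ e ∈ E, (Pd e).card < ∑ e ∈ E, (m + 2) :=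
        Finset.sum_lt_sum (fun e he => by have := hlocal e he; omega) ⟨e, he, by omega⟩
      rw [Finset.sum_const, smul_eq_mul, hk'] at this
      omega
    obtain ⟨x, P, hS⟩ := hspider (by omega)
    refine ⟨?_, hS.embed_S hp (by omega) hend ?_⟩
    · rw [hk'] at hsum2 hBcard
      have h3 : (m + 3) * (m + 3) = m ^ 2 + 6 * m + 9 := by ring
      omega
    intro e he
    refine exists_pendants_of_ncard (S := B) ?_
    rw [← hPdcard]
    have := hall e he
    omega
  · exfalso
    push Not at hs
    have hBE : ∀ t, t ∈ B ↔ t ∈ E := fun t => ⟨fun h => (hE t).2 (hs t h), fun h => ((hE t).1 h).1⟩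
    have hBcard : B.ncard = E.card := by
      rw [← Set.ncard_coe_finset]
      congr 1
      ext t
      exact hBE t
    rcases Nat.lt_or_ge E.card 2 with hlt | hE2
    · obtain ⟨e, he⟩ := hBne
      have hone : ∀ t ∈ B, t = e := by
        intro t ht
        exact Finset.card_le_one.1 (by omega) t ((hBE t).1 ht) e ((hBE e).1 he)
      have := card_comps_lt hα (s := e) (X := B) O ?_ fun K hK => ((hO K).1 hK).1
      · nlinarith
      · intro K hK
        obtain ⟨a, ha, t, ht, hat⟩ := ((hO K).1 hK).1.exists_adj hc.1 he
        exact ⟨a, ha, hone t ht ▸ hat.symm⟩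
    obtain ⟨hk, -⟩ := card_ends_lt hc.1 hA hr hA2 hα E hE2 hend
    set O' := O.filter fun K => ¬ ∃ e a, K = {a} ∧ Pendant G e a with hO'
    have hcover : O ⊆ E.biUnion Pd ∪ O' := by
      intro K hK
      by_cases h2 : ∃ e a, K = {a} ∧ Pendant G e a
      · obtain ⟨e, a, rfl, ha⟩ := h2
        have heB := mem_of_pendant_isComp ((hO _).1 hK).1 ha
        refine Finset.mem_union_left _ ?_
        rw [Finset.mem_biUnion]
        exact ⟨e, (hBE e).1 heB, (hPd _ _).2 ⟨(hO _).1 hK, a, rfl, ha⟩⟩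
      · exact Finset.mem_union_right _ (Finset.mem_filter.2 ⟨hK, h2⟩)
    have hsum1 : O.card ≤ ∑ e ∈ E, (Pd e).card + O'.card :=
      (Finset.card_le_card hcover).trans ((Finset.card_union_le _ _).trans (Nat.add_le_add_right
        Finset.card_biUnion_le _))
    have hdouble : 2 * O'.card ≤
        ∑ e ∈ E, (O'.filter fun K => ∃ a ∈ K, G.Adj e a).card := by
      refine two_mul_card_le_sum E O' (fun e K => ∃ a ∈ K, G.Adj e a) ?_
      intro K hK
      obtain ⟨hKO, hKp⟩ := Finset.mem_filter.1 hK
      rcases pendant_or_two_adj hc hB hBne ((hO K).1 hKO).1 with ⟨t, ht, a, hKa, hp⟩ |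
        ⟨t, ht, t', ht', htt, h1, h2⟩
      · exact absurd ⟨t, a, hKa, hp⟩ hKp
      · exact ⟨t, (hBE t).1 ht, t', (hBE t').1 ht', htt, h1, h2⟩
    have hlocal : ∀ e ∈ E, (Pd e).card + (O'.filter fun K => ∃ a ∈ K, G.Adj e a).card ≤ m + 3 := by
      intro e he
      have hdis : Disjoint (Pd e) (O'.filter fun K => ∃ a ∈ K, G.Adj e a) := by
        rw [Finset.disjoint_left]
        intro K hK hK'
        obtain ⟨-, a, ha, hpa⟩ := (hPd _ _).1 hK
        exact (Finset.mem_filter.1 (Finset.mem_filter.1 hK').1).2 ⟨_, a, ha, hpa⟩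
      have := card_comps_lt hα (s := e) (X := B)
        (Pd e ∪ O'.filter fun K => ∃ a ∈ K, G.Adj e a) ?_ ?_
      · rw [Finset.card_union_of_disjoint hdis] at this
        omega
      · intro K hK
        rcases Finset.mem_union.1 hK with hK | hK
        · obtain ⟨-, a, rfl, hpa⟩ := (hPd _ _).1 hK
          exact ⟨a, rfl, hpa.adj⟩
        · exact (Finset.mem_filter.1 hK).2
      · intro K hK
        rcases Finset.mem_union.1 hK with hK | hK
        · exact ((hPd _ _).1 hK).1.1
        · exact ((hO K).1 (Finset.mem_filter.1 (Finset.mem_filter.1 hK).1).1).1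
    -- The first step towards another tip uses up one leaf of the star at `e`.
    have hpd : ∀ e ∈ E, (Pd e).card ≤ m + 2 := by
      intro e he
      obtain ⟨e', he', hne⟩ := Finset.exists_mem_ne (s := E) (by omega) e
      obtain ⟨P, l, hP, h0, hl, hlpos⟩ := exists_ipath_ne hc.1 (Ne.symm hne)
      subst hl
      have hll := hlong hP hlpos (h0 ▸ (hE e).1 he) ((hE _).1 he')
      have := pendantComps_lt (S := B) hα (e := e) (w := P 1) (w' := P 2)
        (h0 ▸ hP.adj_succ (by omega)) (hP.adj_succ (by omega))
        (h0 ▸ hP.ne (by omega) (by omega) (by omega))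
      rw [← hPdcard] at this
      omega
    have hsum2 : ∑ e ∈ E, (Pd e).card +
        ∑ e ∈ E, (O'.filter fun K => ∃ a ∈ K, G.Adj e a).card ≤ E.card * (m + 3) := by
      rw [← Finset.sum_add_distrib, ← smul_eq_mul]
      exact Finset.sum_le_card_nsmul _ _ _ hlocal
    have hsum3 : ∑ e ∈ E, (Pd e).card ≤ E.card * (m + 2) := by
      rw [← smul_eq_mul]
      exact Finset.sum_le_card_nsmul _ _ _ hpd
    -- Adding the two sums gives `2 * deficiency G ≤ E.card * (2 * m + 3)`, which falls short of
    -- twice the bound. A barrier consisting of tips only is thus never extremal.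
    have h1 : E.card * (2 * m + 3) ≤ (m + 3) * (2 * m + 3) := Nat.mul_le_mul_right _ (by omega)
    have h2 : E.card * (m + 3) + E.card * (m + 2) = E.card * (2 * m + 3) + 2 * E.card := by ring
    have h3 : (m + 3) * (2 * m + 3) = 2 * m ^ 2 + 9 * m + 9 := by ring
    omega

end BoneDeficiency

namespace BoneDeficiency

variable {V : Type*} {G : SimpleGraph V} {n p m : ℕ}

/-! ### The graph `T` -/

/-- The position of a path vertex of `T_m^p` when the two paths are put in line, with the place
`p` between them for the vertices in the side of size `m`. -/
def armPos (p : ℕ) (x : Bool × Fin p) : ℕ := if x.1 then p + 1 + x.2 else p - 1 - x.2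

theorem armPos_false (a : Fin p) : armPos p (false, a) = p - 1 - a := rfl

theorem armPos_true (a : Fin p) : armPos p (true, a) = p + 1 + a := rfl

theorem armPos_le (x : Bool × Fin p) : armPos p x ≤ 2 * p := by
  rcases x with ⟨_ | _, a⟩
  · rw [armPos_false]; omega
  · rw [armPos_true]; omega

theorem armPos_ne (x : Bool × Fin p) : armPos p x ≠ p := by
  rcases x with ⟨_ | _, a⟩
  · rw [armPos_false]; omega
  · rw [armPos_true]; omega

theorem armPos_injective : Function.Injective (armPos p) := by
  rintro ⟨_ | _, a⟩ ⟨_ | _, b⟩ h <;> simp only [armPos_false, armPos_true] at h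
  · have : a = b := Fin.ext (by omega)
    rw [this]
  · omega
  · omega
  · have : a = b := Fin.ext (by omega)
    rw [this]

theorem T_adj_arm_arm {x y : Bool × Fin p} :
    (T p m).Adj (.inl x) (.inl y) ↔
      armPos p x + 1 = armPos p y ∨ armPos p y + 1 = armPos p x := by
  rcases x with ⟨s, a⟩
  rcases y with ⟨t, b⟩
  simp only [T, SimpleGraph.fromRel_adj, ne_eq, Sum.inl.injEq, Prod.mk.injEq]
  have h : ¬ (s = t ∧ a = b) ∧ (s = t ∧ a.val + 1 = b.val ∨ t = s ∧ b.val + 1 = a.val) ↔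
      s = t ∧ (a.val + 1 = b.val ∨ b.val + 1 = a.val) := by
    constructor
    · rintro ⟨-, ⟨h, h'⟩ | ⟨h, h'⟩⟩
      · exact ⟨h, Or.inl h'⟩
      · exact ⟨h.symm, Or.inr h'⟩
    · rintro ⟨rfl, h⟩
      refine ⟨?_, h.imp (fun h => ⟨rfl, h⟩) fun h => ⟨rfl, h⟩⟩
      rintro ⟨-, rfl⟩
      omega
  rw [h]
  cases s <;> cases t <;> simp only [armPos_false, armPos_true] <;> simp <;> omega

theorem T_adj_arm_mid {x : Bool × Fin p} {j : Fin m} :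
    (T p m).Adj (.inl x) (.inr (.inl j)) ↔ armPos p x + 1 = p ∨ armPos p x = p + 1 := by
  rcases x with ⟨_ | _, a⟩ <;> simp [T, SimpleGraph.fromRel_adj, armPos_false, armPos_true] <;> omega

theorem T_adj_arm_leaf_false {x : Bool × Fin p} {j : Fin m} :
    (T p m).Adj (.inl x) (.inr (.inr (false, j))) ↔ armPos p x = 0 := by
  rcases x with ⟨_ | _, a⟩ <;> simp [T, SimpleGraph.fromRel_adj, armPos_false, armPos_true]
  omega

theorem T_adj_arm_leaf_true {x : Bool × Fin p} {j : Fin m} :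
    (T p m).Adj (.inl x) (.inr (.inr (true, j))) ↔ armPos p x = 2 * p := by
  rcases x with ⟨_ | _, a⟩ <;> simp [T, SimpleGraph.fromRel_adj, armPos_false, armPos_true] <;>
    omega

theorem not_T_adj_inr_inr {x y : Fin m ⊕ Bool × Fin m} :
    ¬ (T p m).Adj (.inr x) (.inr y) := by
  simp [T, SimpleGraph.fromRel_adj]

/-- An induced path with enough common neighbours of its two vertices next to the middle and
enough pendent neighbours of its ends contains `T`. -/
theorem IPath.embed_T (hp : 2 ≤ p) {P : ℕ → V} (hP : IPath G P (2 * p)) {w g g' : Fin m → V}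
    (hw : Function.Injective w) (hg : Function.Injective g) (hg' : Function.Injective g')
    (hwP : ∀ j i, i ≤ 2 * p → i ≠ p → P i ≠ w j ∧ (G.Adj (P i) (w j) ↔ i + 1 = p ∨ i = p + 1))
    (hww : ∀ i j, ¬ G.Adj (w i) (w j))
    (hgp : ∀ j, Pendant G (P 0) (g j)) (hgp' : ∀ j, Pendant G (P (2 * p)) (g' j)) :
    Nonempty (T p m ↪g G) := by
  have hpend : ∀ i, 1 ≤ i → i < 2 * p → ∀ e, ¬ Pendant G e (P i) := by
    intro i hi hip e he
    have h1 := (he _).1 (hP.adj_succ (i := i) hip)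
    have h2 := (he _).1 ((hP.adj i (i - 1) (by omega) (by omega)).2 (by omega))
    exact hP.ne (by omega) (by omega) (by omega) (h1.trans h2.symm)
  have hgP : ∀ j i, i ≤ 2 * p → P i ≠ g j ∧ (G.Adj (P i) (g j) ↔ i = 0) := by
    intro j i hi
    constructor
    · intro he
      have hpd : Pendant G (P 0) (P i) := he ▸ hgp j
      by_cases h0 : i = 0
      · subst h0; exact hpd.adj.ne rfl
      · by_cases h1 : i = 2 * p
        · have := (hpd _).1 ((hP.adj i (i - 1) (by omega) (by omega)).2 (by omega))
          exact hP.ne (by omega) (by omega) (by omega) this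
        · exact hpend i (by omega) (by omega) _ hpd
    · rw [SimpleGraph.adj_comm, hgp j]
      exact ⟨fun he => hP.inj _ _ hi (by omega) he, fun he => he ▸ rfl⟩
  have hgP' : ∀ j i, i ≤ 2 * p → P i ≠ g' j ∧ (G.Adj (P i) (g' j) ↔ i = 2 * p) := by
    intro j i hi
    constructor
    · intro he
      have hpd : Pendant G (P (2 * p)) (P i) := he ▸ hgp' j
      by_cases h0 : i = 2 * p
      · subst h0; exact hpd.adj.ne rfl
      · by_cases h1 : i = 0
        · subst h1
          have := (hpd _).1 (hP.adj_succ (i := 0) (by omega))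
          exact hP.ne (by omega) (by omega) (by omega) this
        · exact hpend i (by omega) (by omega) _ hpd
    · rw [SimpleGraph.adj_comm, hgp' j]
      exact ⟨fun he => hP.inj _ _ hi (by omega) he, fun he => he ▸ rfl⟩
  have hgw : ∀ i j, g i ≠ w j ∧ ¬ G.Adj (g i) (w j) := by
    intro i j
    have h1 := ((hwP j (p - 1) (by omega) (by omega)).2).2 (by omega)
    constructor
    · intro he
      rw [← he] at h1
      have := ((hgP i (p - 1) (by omega)).2).1 h1
      omega
    · intro hadj
      exact (hwP j 0 (by omega) (by omega)).1 ((hgp i _).1 hadj).symm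
  have hgw' : ∀ i j, g' i ≠ w j ∧ ¬ G.Adj (g' i) (w j) := by
    intro i j
    have h1 := ((hwP j (p - 1) (by omega) (by omega)).2).2 (by omega)
    constructor
    · intro he
      rw [← he] at h1
      have := ((hgP' i (p - 1) (by omega)).2).1 h1
      omega
    · intro hadj
      exact (hwP j (2 * p) (by omega) (by omega)).1 ((hgp' i _).1 hadj).symm
  have hgg : ∀ i j, ¬ G.Adj (g i) (g j) := fun i j hadj =>
    (hgP j 0 (by omega)).1 ((hgp i _).1 hadj).symm
  have hgg' : ∀ i j, ¬ G.Adj (g' i) (g' j) := fun i j hadj =>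
    (hgP' j (2 * p) (by omega)).1 ((hgp' i _).1 hadj).symm
  have hcross : ∀ i j, g i ≠ g' j ∧ ¬ G.Adj (g i) (g' j) := by
    intro i j
    constructor
    · intro he
      have h1 := (hgp i).adj
      rw [he] at h1
      have := ((hgP' j 0 (by omega)).2).1 h1
      omega
    · intro hadj
      exact (hgP' j 0 (by omega)).1 ((hgp i _).1 hadj).symm
  -- The arms skip position `p`: the vertex `P p` is not required as such, its place being taken by
  -- the vertices `w j`, one of which may be `P p`.
  let φ : TVertex p m → V := fun v =>
    match v with
    | .inl x => P (armPos p x)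
    | .inr (.inl j) => w j
    | .inr (.inr (false, j)) => g j
    | .inr (.inr (true, j)) => g' j
  have hle := armPos_le (p := p)
  have hne := armPos_ne (p := p)
  have hφ : Function.Injective φ := by
    rintro (x | i | ⟨_ | _, i⟩) (y | j | ⟨_ | _, j⟩) he
    · exact congrArg _ (armPos_injective (hP.inj _ _ (hle x) (hle y) he))
    · exact absurd he (hwP j _ (hle x) (hne x)).1
    · exact absurd he (hgP j _ (hle x)).1
    · exact absurd he (hgP' j _ (hle x)).1
    · exact absurd he.symm (hwP i _ (hle y) (hne y)).1
    · rw [hw he]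
    · exact absurd he.symm (hgw j i).1
    · exact absurd he.symm (hgw' j i).1
    · exact absurd he.symm (hgP i _ (hle y)).1
    · exact absurd he (hgw i j).1
    · rw [hg he]
    · exact absurd he (hcross i j).1
    · exact absurd he.symm (hgP' i _ (hle y)).1
    · exact absurd he (hgw' i j).1
    · exact absurd he.symm (hcross j i).1
    · rw [hg' he]
  refine ⟨⟨⟨φ, hφ⟩, ?_⟩⟩
  rintro (x | i | ⟨_ | _, i⟩) (y | j | ⟨_ | _, j⟩)
  · rw [T_adj_arm_arm]
    exact hP.adj _ _ (hle x) (hle y)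
  · rw [T_adj_arm_mid]
    exact (hwP j _ (hle x) (hne x)).2
  · rw [T_adj_arm_leaf_false]
    exact (hgP j _ (hle x)).2
  · rw [T_adj_arm_leaf_true]
    exact (hgP' j _ (hle x)).2
  · rw [SimpleGraph.adj_comm, SimpleGraph.adj_comm (T p m), T_adj_arm_mid]
    exact (hwP i _ (hle y) (hne y)).2
  · exact iff_of_false (hww i j) not_T_adj_inr_inr
  · exact iff_of_false (fun h => (hgw j i).2 h.symm) not_T_adj_inr_inr
  · exact iff_of_false (fun h => (hgw' j i).2 h.symm) not_T_adj_inr_inr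
  · rw [SimpleGraph.adj_comm, SimpleGraph.adj_comm (T p m), T_adj_arm_leaf_false]
    exact (hgP i _ (hle y)).2
  · exact iff_of_false (hgw i j).2 not_T_adj_inr_inr
  · exact iff_of_false (hgg i j) not_T_adj_inr_inr
  · exact iff_of_false (hcross i j).2 not_T_adj_inr_inr
  · rw [SimpleGraph.adj_comm, SimpleGraph.adj_comm (T p m), T_adj_arm_leaf_true]
    exact (hgP' i _ (hle y)).2
  · exact iff_of_false (hgw' i j).2 not_T_adj_inr_inr
  · exact iff_of_false (fun h => (hcross j i).2 h.symm) not_T_adj_inr_inr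
  · exact iff_of_false (hgg' i j) not_T_adj_inr_inr

/-! ### The case of the lengths `p - 1` and `2 * p` -/

theorem length_of_two_mul_add_one {x : ℕ} (hp : 3 ≤ p)
    (hx : x + 1 ∈ ({p, 2 * p + 1} : Set ℕ)) : x = p - 1 ∨ x = 2 * p := by
  simp only [Set.mem_insert_iff, Set.mem_singleton_iff] at hx
  omega

/-- No two of the lengths `p - 1` and `2 * p` add up to a length, so the `sum` condition holds
vacuously. -/
theorem sumRule_two_mul_add_one (hp : 3 ≤ p) (hodd : Odd p) :
    SumRule {p, 2 * p + 1} (p - 1) := by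
  obtain ⟨c, hc⟩ := hodd
  refine ⟨by omega, ?_, ?_, ?_⟩
  · intro x hx
    rcases length_of_two_mul_add_one hp hx with h | h
    · exact ⟨c, by omega⟩
    · exact ⟨p, by omega⟩
  · intro x hx
    have := length_of_two_mul_add_one hp hx
    omega
  · intro x y hx hy hxy
    have h1 := length_of_two_mul_add_one hp hx
    have h2 := length_of_two_mul_add_one hp hy
    have h3 := length_of_two_mul_add_one hp hxy
    omega

/-- A connected set that avoids `s` and is adjacent to a vertex `c ≠ s` lies in the component
of `c`. -/
theorem subset_comp_of_adj {K : Set V} (hK : ConnSet G K) {s c : V}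
    (hs : s ∉ K) (hcs : c ≠ s) (hadj : ∃ a ∈ K, G.Adj c a) : K ⊆ comp G {s} c := by
  obtain ⟨a, ha, hca⟩ := hadj
  have hC := isComp_comp (G := G) (X := {s}) (v := c) (by simpa using hcs)
  have hKs : ∀ b ∈ K, b ∉ ({s} : Set V) := fun b hb hbs => hs (Set.mem_singleton_iff.1 hbs ▸ hb)
  exact hC.subset_of_connSet hK hKs ha (hC.mem_of_adj mem_comp_self hca (hKs a ha))

/-- `s` separates `u` and `v`, at distance `p - 1` from `u` and `p + 1` from `v`. -/
structure Separates (G : SimpleGraph V) (p : ℕ) (s u v : V) : Prop where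
  left_ne : u ≠ s
  right_ne : v ≠ s
  ne : comp G {s} u ≠ comp G {s} v
  left : ∀ P l, IPath G P l → P 0 = s → P l = u → l = p - 1
  right : ∀ P l, IPath G P l → P 0 = s → P l = v → l = p + 1

namespace Separates

variable {s u v : V}

theorem isComp_left (h : Separates G p s u v) : IsComp G {s} (comp G {s} u) :=
  isComp_comp (by simpa using h.left_ne)

theorem isComp_right (h : Separates G p s u v) : IsComp G {s} (comp G {s} v) :=
  isComp_comp (by simpa using h.right_ne)

/-- There is no fork outside the component of the far end. -/
theorem not_fork (h : Separates G p s u v) (hG : G.Connected) (hp : 3 ≤ p)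
    (hA : BonesIn {p, 2 * p + 1} G) (hv : IsEnd G v) {a b : V} (hf : Fork G s a b)
    (ha : a ∉ comp G {s} v) (hb : b ∉ comp G {s} v) : False := by
  obtain ⟨P, l, hP, h0, hl, hlpos⟩ := exists_ipath_ne hG h.right_ne.symm
  have h1 := h.right P l hP h0 hl
  subst hl
  have := hP.mem_of_fork_outside hA h.isComp_right h0 hlpos mem_comp_self hv hf ha hb
  have := length_of_two_mul_add_one hp this
  omega

/-- A neighbour of `s` on the side of `u` that is not pendent. -/
theorem exists_adj_left (h : Separates G p s u v) (hG : G.Connected) (hp : 3 ≤ p) :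
    ∃ a ∈ comp G {s} u, G.Adj s a ∧ ¬ Pendant G s a := by
  obtain ⟨P, l, hP, h0, hl, hlpos⟩ := exists_ipath_ne hG h.left_ne.symm
  have h1 := h.left P l hP h0 hl
  subst hl h0
  refine ⟨P 1, hP.mem_comp h.isComp_left rfl hlpos le_rfl mem_comp_self 1 le_rfl (by omega),
    hP.adj_succ (by omega), fun hpd => ?_⟩
  have := (hpd _).1 (hP.adj_succ (i := 1) (by omega))
  exact hP.ne (by omega) (by omega) (by omega) this

/-- A pendent vertex at `s` and the neighbour of `s` towards `u` would form a fork on the wrong side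
of `v`. -/
theorem not_pendant (h : Separates G p s u v) (hG : G.Connected) (hp : 3 ≤ p)
    (hA : BonesIn {p, 2 * p + 1} G) (hv : IsEnd G v) {a : V} (ha : Pendant G s a) : False := by
  obtain ⟨b, hb, hsb, hnb⟩ := h.exists_adj_left hG hp
  have hab : a ≠ b := by
    rintro rfl
    exact hnb ha
  refine h.not_fork hG hp hA hv ⟨ha.adj, hsb, hab, fun hadj => hsb.ne ((ha b).1 hadj).symm⟩ ?_ ?_
  · intro hav
    have hC : IsComp G {s} {a} := by
      refine isComp_of_connSet ⟨a, rfl⟩ ?_ ?_ ?_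
      · rintro _ rfl _ rfl
        exact ConnIn.refl _
      · rintro _ rfl hs
        exact ha.adj.ne (Set.mem_singleton_iff.1 hs).symm
      · rintro _ rfl c hc
        exact Or.inr ((ha c).1 hc)
    have : v ∈ ({a} : Set V) := (hC.eq h.isComp_right rfl hav) ▸ mem_comp_self
    rw [Set.mem_singleton_iff] at this
    subst this
    exact ha.ne_of_isEnd hv
  · exact fun hbv => h.ne (h.isComp_left.eq h.isComp_right hb hbv)

end Separates

/-- A non-tip separates two tips, which must be `u` and `v`. Of their two components at most one is
the exception in `exists_fork_outside`; for the other, a fork at `s` fixes the distance. -/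
theorem not_isTip_separates [Finite V] {B : Set V} (hp : 3 ≤ p) (hc : DeficiencyCritical G)
    (hd : 2 ≤ deficiency G) (hB : MinBarrier G B) (hA : BonesIn {p, 2 * p + 1} G) {u v : V}
    (htip : ∀ e, IsTip G B e → e = u ∨ e = v) (hu : IsTip G B u) (hv : IsTip G B v)
    {s : V} (hs : s ∈ B) (hns : ¬ IsTip G B s) : Separates G p s u v ∨ Separates G p s v u := by
  have hus : u ≠ s := fun h => hns (h ▸ hu)
  have hvs : v ≠ s := fun h => hns (h ▸ hv)
  have hCu := isComp_comp (G := G) (X := {s}) (v := u) (by simpa using hus)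
  have hCv := isComp_comp (G := G) (X := {s}) (v := v) (by simpa using hvs)
  have hne : comp G {s} u ≠ comp G {s} v := by
    obtain ⟨L, L', hL, hL', hLL, ⟨e, he, hte⟩, ⟨e', he', hte'⟩⟩ := exists_two_tips hc hB hd hs hns
    rcases htip e hte with rfl | rfl <;> rcases htip e' hte' with rfl | rfl
    · exact absurd (hL.eq hL' he he') hLL
    · rwa [← hL.eq_comp he, ← hL'.eq_comp he']
    · rw [← hL.eq_comp he, ← hL'.eq_comp he']; exact hLL.symm
    · exact absurd (hL.eq hL' he he') hLL
  have hpos : ∀ {P : ℕ → V} {l : ℕ} {e : V}, P 0 = s → P l = e → e ≠ s → 1 ≤ l := by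
    intro P l e h0 hl he
    by_contra hcon
    obtain rfl : l = 0 := by omega
    exact he (hl.symm.trans h0)
  -- the lengths are determined by a fork on one side
  have key : ∀ x y, IsTip G B x → IsTip G B y → x ≠ s → y ≠ s → comp G {s} x ≠ comp G {s} y →
      (∃ a b, Fork G s a b ∧ a ∉ comp G {s} x ∧ b ∉ comp G {s} x) → Separates G p s x y := by
    rintro x y hx hy hxs hys hxy ⟨a, b, hf, ha, hb⟩
    have hCx := isComp_comp (G := G) (X := {s}) (v := x) (by simpa using hxs)
    have hCy := isComp_comp (G := G) (X := {s}) (v := y) (by simpa using hys)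
    have hlen : ∀ P l P' l', IPath G P l → IPath G P' l' → P 0 = s → P l = x → P' 0 = s →
        P' l' = y → l = p - 1 ∧ l' = p + 1 := by
      intro P l P' l' hP hP' h0 hl h0' hl'
      have hlp := hpos h0 hl hxs
      have hlp' := hpos h0' hl' hys
      subst hl hl'
      have h1 := hP.mem_of_fork_outside hA hCx h0 hlp mem_comp_self (hx.isEnd hc hB) hf ha hb
      obtain ⟨Q, hQ, hQ0, hQl⟩ := exists_concat hCx hCy hxy hP hP' h0 h0' hlp hlp' mem_comp_self
        mem_comp_self
      have h2 := hQ.mem_of_isEnd hA (by omega) (hQ0 ▸ hx.isEnd hc hB) (hQl ▸ hy.isEnd hc hB)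
      -- `l` and `l + l'` are both in `{p - 1, 2 * p}` with `l' ≥ 1`, so `l = p - 1` and `l' = p +
      -- 1`.
      have h3 := length_of_two_mul_add_one hp h1
      have h4 := length_of_two_mul_add_one hp h2
      omega
    obtain ⟨P₁, l₁, hP₁, h₁, h₁', -⟩ := exists_ipath_ne hc.1 hxs.symm
    obtain ⟨P₂, l₂, hP₂, h₂, h₂', -⟩ := exists_ipath_ne hc.1 hys.symm
    exact ⟨hxs, hys, hxy, fun P l hP h0 hl => (hlen P l P₂ l₂ hP hP₂ h0 hl h₂ h₂').1,
      fun P l hP h0 hl => (hlen P₁ l₁ P l hP₁ hP h₁ h₁' h0 hl).2⟩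
  obtain ⟨L₂, hL₂⟩ := exists_fork_outside hB hs
  by_cases hcase : comp G {s} u = L₂
  · exact Or.inr (key v u hv hu hvs hus hne.symm (hL₂ _ hCv fun h => hne (hcase.trans h.symm)))
  · exact Or.inl (key u v hu hv hus hvs hne (hL₂ _ hCu hcase))

end BoneDeficiency

/-! ### The case `q = 2p + 1`: critical graphs of large deficiency contain `T`. -/

namespace BoneDeficiency

variable {V : Type*} {G : SimpleGraph V} {n p : ℕ}

namespace Separates

variable {s u v : V} {B : Set V}

/-- Components of `G - B` next to `s` on the side of the far end. -/
theorem card_far_lt [Finite V] (h : Separates G p s u v) (hG : G.Connected) (hp : 3 ≤ p)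
    (hα : localIndepNum G < n) (hsB : s ∈ B) {c : V} (hc : c ∈ comp G {s} v)
    (C : Finset (Set V)) (hC : ∀ K ∈ C, IsComp G B K) (hs : ∀ K ∈ C, ∃ a ∈ K, G.Adj s a)
    (hcC : ∀ K ∈ C, ∃ a ∈ K, G.Adj c a) : C.card + 1 < n := by
  classical
  obtain ⟨a, ha, hsa, -⟩ := h.exists_adj_left hG hp
  -- All members lie on the side of `v`, so the neighbour `a` of `s` on the side of `u` adds one
  -- more leaf to the star at `s`.
  have hsub : ∀ K ∈ C, K ⊆ comp G {s} v := by
    intro K hK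
    have := subset_comp_of_adj (hC K hK).connSet (fun hs => (hC K hK).notMem hs hsB)
      (fun hcs : c = s => h.isComp_right.notMem hc hcs) (hcC K hK)
    rwa [← h.isComp_right.eq_comp hc] at this
  have hcr := h.isComp_left.ne_and_not_adj h.isComp_right h.ne
  have hna : {a} ∉ C := fun hm => (hcr a ha a (hsub _ hm rfl)).1 rfl
  rw [← Finset.card_insert_of_notMem hna]
  refine card_family_lt hα (s := s) _ ?_ ?_
  · intro K hK
    rcases Finset.mem_insert.1 hK with rfl | hK
    · exact ⟨a, rfl, hsa⟩
    · exact hs K hK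
  · intro K hK K' hK' hne
    rcases Finset.mem_insert.1 hK with hKa | hKC <;>
      rcases Finset.mem_insert.1 hK' with hKa' | hKC'
    · exact absurd (hKa.trans hKa'.symm) hne
    · intro b hb c hc
      rw [hKa, Set.mem_singleton_iff] at hb
      exact hb ▸ hcr _ ha c (hsub _ hKC' hc)
    · intro b hb c hc
      rw [hKa', Set.mem_singleton_iff] at hc
      have := hcr _ ha b (hsub _ hKC hb)
      exact hc ▸ ⟨this.1.symm, fun h => this.2 h.symm⟩
    · exact (hC K hKC).ne_and_not_adj (hC K' hKC') hne

/-- All but one of the components at the near end are pendent vertices. -/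
theorem ncard_le_pendantComps [Finite V] (h : Separates G p s u v) (hc : DeficiencyCritical G)
    (hB : MinBarrier G B) (hp : 3 ≤ p) (hA : BonesIn {p, 2 * p + 1} G) (hv : IsEnd G v)
    (hsB : s ∈ B) (hBu : ∀ t ∈ B, t ∈ comp G {s} u → t = u) :
    {K ∈ oddComps G B | ∃ a ∈ K, G.Adj u a}.ncard ≤ (pendantComps G B u).ncard + 1 := by
  -- A non-pendent component next to `u` needs a second barrier neighbour, and only `s` is available
  -- on this side. Two such components would give a fork at `s` outside the component of `v`.
  set N := {K ∈ oddComps G B | (∃ a ∈ K, G.Adj u a) ∧ ∃ a ∈ K, G.Adj s a} with hN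
  have hsub : {K ∈ oddComps G B | ∃ a ∈ K, G.Adj u a} ⊆ pendantComps G B u ∪ N := by
    rintro K ⟨hK, a, haK, hua⟩
    have hsK : s ∉ K := fun hs => hK.1.notMem hs hsB
    have hKu := subset_comp_of_adj hK.1.connSet hsK h.left_ne ⟨a, haK, hua⟩
    have hadj : ∀ t ∈ B, (∃ b ∈ K, G.Adj t b) → t = s ∨ t = u := by
      rintro t ht ⟨b, hb, htb⟩
      by_cases hts : t = s
      · exact Or.inl hts
      · exact Or.inr (hBu t ht (h.isComp_left.mem_of_adj (hKu hb) htb.symm (by simpa using hts)))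
    rcases pendant_or_two_adj hc hB ⟨s, hsB⟩ hK.1 with ⟨t, ht, b, rfl, hb⟩ |
      ⟨t, ht, t', ht', htt, h1, h2⟩
    · obtain rfl : a = b := haK
      obtain rfl := (hb u).1 hua.symm
      exact Or.inl ⟨hK, a, rfl, hb⟩
    · refine Or.inr ⟨hK, ⟨a, haK, hua⟩, ?_⟩
      rcases hadj t ht h1 with rfl | rfl
      · exact h1
      · rcases hadj t' ht' h2 with rfl | rfl
        · exact h2
        · exact absurd rfl htt
  have hone : N.ncard ≤ 1 := by
    rw [Set.ncard_le_one (Set.toFinite _)]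
    rintro K ⟨hK, hKu, a, ha, hsa⟩ K' ⟨hK', hKu', a', ha', hsa'⟩
    by_contra hne
    have hd := hK.1.ne_and_not_adj hK'.1 hne a ha a' ha'
    have hside : ∀ L ∈ oddComps G B, (∃ a ∈ L, G.Adj u a) → ∀ b ∈ L, b ∉ comp G {s} v := by
      intro L hL hLu b hb hbv
      have := subset_comp_of_adj hL.1.connSet (fun hs => hL.1.notMem hs hsB) h.left_ne hLu hb
      exact h.ne (h.isComp_left.eq h.isComp_right this hbv)
    exact h.not_fork hc.1 hp hA hv ⟨hsa, hsa', hd.1, hd.2⟩ (hside K hK hKu a ha)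
      (hside K' hK' hKu' a' ha')
  have h1 := Set.ncard_le_ncard hsub (Set.toFinite _)
  have h2 := Set.ncard_union_le (pendantComps G B u) N
  omega

/-- A connected set next to both separating vertices contains a common neighbour of them. -/
theorem exists_common_adj {t : V} (h : Separates G p s u v) (h' : Separates G p t v u)
    (hG : G.Connected) (ht : t ∈ comp G {s} v) {K : Set V} (hK : ConnSet G K)
    (hs : ∃ a ∈ K, G.Adj s a) (hta : ∃ a ∈ K, G.Adj t a) : ∃ a ∈ K, G.Adj s a ∧ G.Adj t a := by
  obtain ⟨a, ha, hsa⟩ := hs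
  obtain ⟨b, hb, htb⟩ := hta
  have hts : t ≠ s := fun hts => h.isComp_right.notMem ht hts
  have hKsub : K ⊆ insert s (insert t K) := fun c hc => Or.inr (Or.inr hc)
  have hconn : ConnSet G (insert s (insert t K)) := by
    refine connSet_of_forall a ?_
    rintro c (rfl | rfl | hc)
    · exact ConnIn.single hsa (Or.inl rfl) (hKsub ha)
    · exact (ConnIn.single htb (Or.inr (Or.inl rfl)) (hKsub hb)).trans
        ((hK b hb a ha).mono hKsub)
    · exact (hK c hc a ha).mono hKsub
  obtain ⟨Q, l, hQ, hQ0, hQl, hQK⟩ := exists_ipath_of_connSet hconn (Or.inl rfl)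
    (Or.inr (Or.inl rfl) : t ∈ insert s (insert t K))
  have hl : 1 ≤ l := by
    by_contra hcon
    obtain rfl : l = 0 := by omega
    exact hts (hQl.symm.trans hQ0)
  obtain ⟨P, k, hP, hP0, hPk, hk⟩ := exists_ipath_ne hG h.left_ne.symm
  have hkp := h.left P k hP hP0 hPk
  obtain ⟨R, hR, hR0, hRl⟩ := exists_concat h.isComp_left h.isComp_right h.ne hP hQ hP0 hQ0 hk hl
    (hPk ▸ mem_comp_self) (hQl ▸ ht)
  -- The path from `u` to `t` through `s` has length `p - 1 + l`, and `t` is at distance `p + 1`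
  -- from `u`; hence `l = 2`, and the middle vertex of `Q` is the common neighbour.
  have := h'.right _ _ (hR.down le_rfl le_rfl) (by simpa [hQl] using hRl)
    (by simpa [hPk] using hR0)
  obtain rfl : l = 2 := by omega
  refine ⟨Q 1, ?_, hQ0 ▸ hQ.adj_succ (by omega), hQl ▸ (hQ.adj_succ (i := 1) (by omega)).symm⟩
  rcases hQK 1 (by omega) with h1 | h1 | h1
  · exact absurd (h1.trans hQ0.symm) (hQ.ne (by omega) (by omega) (by omega))
  · exact absurd (h1.trans hQl.symm) (hQ.ne (by omega) (by omega) (by omega))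
  · exact h1

end Separates

/-- There are exactly two tips, or the deficiency is small. -/
theorem exists_two_tips_of_le_deficiency [Finite V] {B : Set V} (hn : 3 < n) (hp : 3 ≤ p)
    (hodd : Odd p) (hc : DeficiencyCritical G) (hA : BonesIn {p, 2 * p + 1} G)
    (hα : localIndepNum G < n) (hd : n ≤ deficiency G) (hB : MinBarrier G B) :
    ∃ u v, u ≠ v ∧ IsTip G B u ∧ IsTip G B v ∧ ∀ e, IsTip G B e → e = u ∨ e = v := by
  classical
  cases nonempty_fintype V
  have hex : ∃ u v, u ≠ v ∧ IsTip G B u ∧ IsTip G B v := by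
    by_cases hs : ∃ s ∈ B, ¬ IsTip G B s
    · obtain ⟨s, hs, hns⟩ := hs
      obtain ⟨L, L', hL, hL', hLL, ⟨e, he, hte⟩, ⟨e', he', hte'⟩⟩ :=
        exists_two_tips hc hB (by omega) hs hns
      refine ⟨e, e', ?_, hte, hte'⟩
      rintro rfl
      exact hLL (hL.eq hL' he he')
    · push Not at hs
      obtain ⟨u, hu⟩ := hB.nonempty hc.1 (by omega)
      by_cases hv : ∃ v ∈ B, v ≠ u
      · obtain ⟨v, hv, hvu⟩ := hv
        exact ⟨u, v, hvu.symm, hs u hu, hs v hv⟩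
      · push Not at hv
        exfalso
        have := card_comps_lt hα (s := u) (X := B) (oddComps G B).toFinset ?_ ?_
        · rw [← Set.ncard_eq_toFinset_card'] at this
          have := hB.ge
          omega
        · intro K hK
          rw [Set.mem_toFinset] at hK
          obtain ⟨a, ha, t, ht, hat⟩ := hK.1.exists_adj hc.1 hu
          exact ⟨a, ha, hv t ht ▸ hat.symm⟩
        · intro K hK
          exact (Set.mem_toFinset.1 hK).1
  obtain ⟨u, v, huv, hu, hv⟩ := hex
  refine ⟨u, v, huv, hu, hv, fun e he => ?_⟩
  by_contra! hcon
  -- Here `2 * (p - 1) + 1` is `2 * p - 1`, which is neither `p` nor `2 * p + 1`.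
  refine no_three_ends hc.1 hA (sumRule_two_mul_add_one hp hodd) ?_ (hu.isEnd hc hB)
    (hv.isEnd hc hB) (he.isEnd hc hB) huv hcon.1.symm hcon.2.symm
  simp only [Set.mem_insert_iff, Set.mem_singleton_iff]
  omega

/-- The place of a separating vertex on a path. -/
theorem Separates.eq_of_path {s : V} {P : ℕ → V} {L : ℕ} (hP : IPath G P L)
    (h : Separates G p s (P 0) (P L)) : L = 2 * p ∧ s = P (p - 1) ∧ 1 ≤ p := by
  have hex : ∃ i ≤ L, P i = s := by
    by_contra! hcon
    refine h.ne (comp_eq_of_mem (v := P L) ?_)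
    exact ConnIn.symm (hP.connIn (Nat.zero_le _) le_rfl fun k _ hk => by simpa using hcon k hk)
  obtain ⟨i, hi, rfl⟩ := hex
  have h1 := h.left _ i (hP.down le_rfl hi) (by simp) (by simp)
  have h2 := h.right _ (L - i) (hP.shift (a := i) (by omega)) (by simp)
    (by rw [Nat.add_sub_cancel' hi])
  have h3 : i ≠ 0 := by
    rintro rfl
    exact h.left_ne rfl
  subst h1
  exact ⟨by omega, rfl, by omega⟩


/-- Critical graphs of the largest possible deficiency contain `T`. -/
theorem embeds_T [Finite V] (hn : 3 < n) (hp : 3 ≤ p) (hodd : Odd p) (hc : DeficiencyCritical G)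
    (hA : BonesIn {p, 2 * p + 1} G) (hα : localIndepNum G < n) (hd : 3 * n - 8 ≤ deficiency G) :
    deficiency G ≤ 3 * n - 8 ∧ Nonempty (T p (n - 2) ↪g G) := by
  classical
  cases nonempty_fintype V
  obtain ⟨B, hB⟩ := exists_minBarrier (G := G) (by omega)
  obtain ⟨u, v, huv, hu, hv, htip⟩ :=
    exists_two_tips_of_le_deficiency hn hp hodd hc hA hα (by omega) hB
  have heu := hu.isEnd hc hB
  have hev := hv.isEnd hc hB
  obtain ⟨P, L, hP, rfl, rfl, hL⟩ := exists_ipath_ne hc.1 huv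
  have hL2 : p - 1 ≤ L := by
    have := length_of_two_mul_add_one hp (hP.mem_of_isEnd hA hL heu hev)
    omega
  set u := P 0 with hudef
  set v := P L with hvdef
  set O : Finset (Set V) := (oddComps G B).toFinset with hOdef
  have hO : ∀ K, K ∈ O ↔ K ∈ oddComps G B := fun K => by rw [hOdef, Set.mem_toFinset]
  have hOcard : deficiency G + B.ncard ≤ O.card := by
    rw [hOdef, ← Set.ncard_eq_toFinset_card']
    exact hB.ge
  set Ku := O.filter fun K => ∃ a ∈ K, G.Adj u a with hKu
  set Kv := O.filter fun K => ∃ a ∈ K, G.Adj v a with hKv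
  set W := O.filter fun K => (¬ ∃ a ∈ K, G.Adj u a) ∧ ¬ ∃ a ∈ K, G.Adj v a with hW
  have hKucard : Ku.card < n := card_comps_lt hα (s := u) (X := B) Ku
    (fun K hK => (Finset.mem_filter.1 hK).2) fun K hK => ((hO K).1 (Finset.mem_filter.1 hK).1).1
  have hKvcard : Kv.card < n := card_comps_lt hα (s := v) (X := B) Kv
    (fun K hK => (Finset.mem_filter.1 hK).2) fun K hK => ((hO K).1 (Finset.mem_filter.1 hK).1).1
  have hcover : O.card ≤ Ku.card + Kv.card + W.card := by
    refine (Finset.card_le_card (t := Ku ∪ Kv ∪ W) ?_).trans ((Finset.card_union_le _ _).trans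
      (Nat.add_le_add_right (Finset.card_union_le _ _) _))
    intro K hK
    simp only [hKu, hKv, hW, Finset.mem_union, Finset.mem_filter]
    by_cases h1 : ∃ a ∈ K, G.Adj u a
    · exact Or.inl (Or.inl ⟨hK, h1⟩)
    · by_cases h2 : ∃ a ∈ K, G.Adj v a
      · exact Or.inl (Or.inr ⟨hK, h2⟩)
      · exact Or.inr ⟨hK, h1, h2⟩
  -- Every path between the two tips passes through a non-tip, and the distances place it at `p - 1`
  -- or `p + 1`. So there are at most two non-tips.
  have hnontip : ∀ s ∈ B, ¬ IsTip G B s → L = 2 * p ∧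
      (s = P (p - 1) ∧ Separates G p s u v ∨ s = P (p + 1) ∧ Separates G p s v u) := by
    intro s hs hns
    rcases not_isTip_separates hp hc (by omega) hB hA htip hu hv hs hns with h | h
    · obtain ⟨h1, h2, -⟩ := Separates.eq_of_path hP h
      exact ⟨h1, Or.inl ⟨h2, h⟩⟩
    · have hrev : IPath G (fun j => P (L - j)) L := hP.down le_rfl le_rfl
      obtain ⟨h1, h2, -⟩ := Separates.eq_of_path (s := s) (p := p) hrev (by simpa using h)
      refine ⟨h1, Or.inr ⟨h2.trans ?_, h⟩⟩
      show P _ = P _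
      congr 1
      omega
  have hWadj : ∀ K ∈ W, ∃ y ∈ B, ∃ x ∈ B, ¬ IsTip G B y ∧ ¬ IsTip G B x ∧ y = P (p - 1) ∧
      x = P (p + 1) ∧ Separates G p y u v ∧ Separates G p x v u ∧ (∃ a ∈ K, G.Adj y a) ∧
      ∃ a ∈ K, G.Adj x a := by
    intro K hK
    obtain ⟨hKO, hKu, hKv⟩ := Finset.mem_filter.1 hK
    have hnt : ∀ t, (∃ a ∈ K, G.Adj t a) → ¬ IsTip G B t := by
      rintro t ht hti
      rcases htip t hti with rfl | rfl
      · exact hKu ht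
      · exact hKv ht
    rcases pendant_or_two_adj hc hB ⟨u, hu.1⟩ ((hO K).1 hKO).1 with ⟨t, ht, a, rfl, ha⟩ |
      ⟨t, ht, t', ht', htt, h1, h2⟩
    · exfalso
      rcases hnontip t ht (hnt t ⟨a, rfl, ha.adj⟩) with ⟨-, ⟨-, h⟩ | ⟨-, h⟩⟩
      · exact h.not_pendant hc.1 hp hA hev ha
      · exact h.not_pendant hc.1 hp hA heu ha
    · rcases hnontip t ht (hnt t h1) with ⟨-, ⟨e, h⟩ | ⟨e, h⟩⟩ <;>
        rcases hnontip t' ht' (hnt t' h2) with ⟨-, ⟨e', h'⟩ | ⟨e', h'⟩⟩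
      · exact absurd (e.trans e'.symm) htt
      · exact ⟨t, ht, t', ht', hnt t h1, hnt t' h2, e, e', h, h', h1, h2⟩
      · exact ⟨t', ht', t, ht, hnt t' h2, hnt t h1, e', e, h', h, h2, h1⟩
      · exact absurd (e.trans e'.symm) htt
  -- Without `W` the deficiency is at most `2 * n - 5`, below `3 * n - 8` because `n > 3`: either
  -- the barrier has a third vertex, or all odd components not adjacent to `u` are pendent vertices
  -- at `v`.
  rcases W.eq_empty_or_nonempty with hW0 | ⟨K₀, hK₀⟩
  · exfalso
    rw [hW0, Finset.card_empty] at hcover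
    by_cases hs : ∃ s ∈ B, ¬ IsTip G B s
    · obtain ⟨s, hs, hns⟩ := hs
      have : 2 < B.ncard := by
        rw [Set.two_lt_ncard (Set.toFinite _)]
        exact ⟨u, hu.1, v, hv.1, s, hs, huv, fun h => hns (h ▸ hu), fun h => hns (h ▸ hv)⟩
      omega
    · push Not at hs
      have hB2 : 1 < B.ncard := by
        rw [Set.one_lt_ncard (Set.toFinite _)]
        exact ⟨u, hu.1, v, hv.1, huv⟩
      have hpd := pendantComps_lt (S := B) hα (e := v) (w := P (L - 1)) (w' := P (L - 2))
        ((hP.adj _ _ le_rfl (by omega)).2 (by omega))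
        ((hP.adj _ _ (by omega) (by omega)).2 (by omega))
        (hP.ne (by omega) (by omega) (by omega))
      have hcov : O ⊆ Ku ∪ (pendantComps G B v).toFinset := by
        intro K hK
        rw [Finset.mem_union, Set.mem_toFinset]
        by_cases hKu' : ∃ a ∈ K, G.Adj u a
        · exact Or.inl (Finset.mem_filter.2 ⟨hK, hKu'⟩)
        · right
          have hto : ∀ t ∈ B, (∃ a ∈ K, G.Adj t a) → t = v := by
            intro t ht h
            rcases htip t (hs t ht) with rfl | rfl
            · exact absurd h hKu'
            · rfl
          rcases pendant_or_two_adj hc hB ⟨u, hu.1⟩ ((hO K).1 hK).1 with ⟨t, ht, a, hKa, ha⟩ |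
            ⟨t, ht, t', ht', htt, h1, h2⟩
          · obtain rfl := hto t ht ⟨a, by rw [hKa]; rfl, ha.adj⟩
            exact ⟨(hO K).1 hK, a, hKa, ha⟩
          · exact absurd ((hto t ht h1).trans (hto t' ht' h2).symm) htt
      have h1 := (Finset.card_le_card hcov).trans (Finset.card_union_le _ _)
      rw [← Set.ncard_eq_toFinset_card' (pendantComps G B v)] at h1
      omega
  · obtain ⟨y, hy, x, hx, hny, hnx, hyP, hxP, hys, hxs, -⟩ := hWadj K₀ hK₀
    obtain rfl : L = 2 * p := (hnontip y hy hny).1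
    have hWadj' : ∀ K ∈ W, (∃ a ∈ K, G.Adj y a) ∧ ∃ a ∈ K, G.Adj x a := by
      intro K hK
      obtain ⟨y', -, x', -, -, -, hyP', hxP', -, -, h1, h2⟩ := hWadj K hK
      rw [hyP, hxP]
      exact ⟨hyP' ▸ h1, hxP' ▸ h2⟩
    have hWc : ∀ K ∈ W, IsComp G B K := fun K hK => ((hO K).1 (Finset.mem_filter.1 hK).1).1
    have hright : ∀ i, p - 1 < i → i ≤ 2 * p → P i ∈ comp G {y} v := by
      intro i hi hil
      refine ConnIn.symm (hP.connIn hil le_rfl fun k hik hk => ?_)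
      rw [hyP]
      exact fun h => hP.ne hk (by omega) (by omega) (Set.mem_singleton_iff.1 h)
    have hleft : ∀ i, i < p + 1 → P i ∈ comp G {x} u := by
      intro i hi
      refine hP.connIn (Nat.zero_le _) (by omega) fun k _ hk => ?_
      rw [hxP]
      exact fun h => hP.ne (by omega) (by omega) (by omega) (Set.mem_singleton_iff.1 h)
    have hxv : x ∈ comp G {y} v := hxP ▸ hright (p + 1) (by omega) (by omega)
    have hyu : y ∈ comp G {x} u := hyP ▸ hleft (p - 1) (by omega)
    have hyx : y ≠ x := fun h => hys.isComp_right.notMem hxv h.symm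
    have hB4 : 4 ≤ B.ncard := by
      have hsub : ((({u, v, y, x} : Finset V)) : Set V) ⊆ B := by
        intro t ht
        simp only [Finset.coe_insert, Finset.coe_singleton, Set.mem_insert_iff,
          Set.mem_singleton_iff] at ht
        rcases ht with rfl | rfl | rfl | rfl
        · exact hu.1
        · exact hv.1
        · exact hy
        · exact hx
      have := Set.ncard_le_ncard hsub (Set.toFinite _)
      rw [Set.ncard_coe_finset] at this
      rwa [Finset.card_insert_of_notMem, Finset.card_insert_of_notMem,
        Finset.card_insert_of_notMem, Finset.card_singleton] at this
      · simpa using hyx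
      · simp only [Finset.mem_insert, Finset.mem_singleton, not_or]
        exact ⟨hys.right_ne, hxs.left_ne⟩
      · simp only [Finset.mem_insert, Finset.mem_singleton, not_or]
        exact ⟨huv, hys.left_ne, hxs.right_ne⟩
    -- Together with `4 ≤ B.ncard` the count is `2 * (n - 1) + (n - 2) - 4 = 3 * n - 8`.
    have hWcard := hys.card_far_lt hc.1 hp hα hy hxv W hWc (fun K hK => (hWadj' K hK).1)
      fun K hK => (hWadj' K hK).2
    refine ⟨by omega, ?_⟩
    have hBeq : ∀ t ∈ B, t = u ∨ t = v ∨ t = y ∨ t = x := by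
      intro t ht
      by_cases hti : IsTip G B t
      · rcases htip t hti with h | h
        · exact Or.inl h
        · exact Or.inr (Or.inl h)
      · rcases (hnontip t ht hti).2 with ⟨h, -⟩ | ⟨h, -⟩
        · exact Or.inr (Or.inr (Or.inl (h.trans hyP.symm)))
        · exact Or.inr (Or.inr (Or.inr (h.trans hxP.symm)))
    have hnu : ∀ t, t ∈ comp G {y} u → t ∈ comp G {y} v → False := fun t h h' =>
      hys.ne (hys.isComp_left.eq hys.isComp_right h h')
    have hnv : ∀ t, t ∈ comp G {x} v → t ∈ comp G {x} u → False := fun t h h' =>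
      hxs.ne (hxs.isComp_left.eq hxs.isComp_right h h')
    have hpu := hys.ncard_le_pendantComps hc hB hp hA hev hy fun t ht htu => by
      rcases hBeq t ht with rfl | rfl | rfl | rfl
      · rfl
      · exact (hnu _ htu mem_comp_self).elim
      · exact absurd rfl (hys.isComp_left.notMem htu)
      · exact (hnu _ htu hxv).elim
    have hpv := hxs.ncard_le_pendantComps hc hB hp hA heu hx fun t ht htv => by
      rcases hBeq t ht with rfl | rfl | rfl | rfl
      · exact (hnv _ htv mem_comp_self).elim
      · rfl
      · exact (hnv _ htv hyu).elim
      · exact absurd rfl (hxs.isComp_left.notMem htv)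
    have hKuc : {K ∈ oddComps G B | ∃ a ∈ K, G.Adj u a}.ncard = Ku.card := by
      rw [← Set.ncard_coe_finset]
      congr 1
      ext K
      simp [hKu, hO]
    have hKvc : {K ∈ oddComps G B | ∃ a ∈ K, G.Adj v a}.ncard = Kv.card := by
      rw [← Set.ncard_coe_finset]
      congr 1
      ext K
      simp [hKv, hO]
    -- Equality makes all three estimates sharp: `n - 1` odd components at `u` and at `v`, all but
    -- at most one of them pendent, and `n - 2` members of `W`, each with a common neighbour of `y`
    -- and `x`.
    obtain ⟨g, hg, hgp⟩ := exists_pendants_of_ncard (G := G) (k := n - 2) (S := B) (e := u) (by omega)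
    obtain ⟨g', hg', hgp'⟩ := exists_pendants_of_ncard (G := G) (k := n - 2) (S := B) (e := v) (by omega)
    have hcommon : ∀ K : W, ∃ a ∈ K.1, G.Adj y a ∧ G.Adj x a := fun K =>
      hys.exists_common_adj hxs hc.1 hxv (hWc K.1 K.2).connSet (hWadj' K.1 K.2).1 (hWadj' K.1 K.2).2
    choose f hfK hfy hfx using hcommon
    obtain ⟨φ⟩ : Nonempty (Fin (n - 2) ↪ W) := by
      refine Function.Embedding.nonempty_of_card_le ?_
      rw [Fintype.card_fin, Fintype.card_coe]
      omega
    have hfne : ∀ K K' : W, K ≠ K' → f K ≠ f K' ∧ ¬ G.Adj (f K) (f K') := fun K K' hne =>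
      (hWc K.1 K.2).ne_and_not_adj (hWc K'.1 K'.2) (fun h => hne (Subtype.ext h)) _ (hfK K) _ (hfK K')
    have hfv : ∀ K : W, f K ∈ comp G {y} v := fun K => by
      have := subset_comp_of_adj (hWc K.1 K.2).connSet (fun h => (hWc K.1 K.2).notMem h hy)
        hyx.symm (hWadj' K.1 K.2).2 (hfK K)
      rwa [← hys.isComp_right.eq_comp hxv] at this
    have hfu : ∀ K : W, f K ∈ comp G {x} u := fun K => by
      have := subset_comp_of_adj (hWc K.1 K.2).connSet (fun h => (hWc K.1 K.2).notMem h hx)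
        hyx (hWadj' K.1 K.2).1 (hfK K)
      rwa [← hxs.isComp_right.eq_comp hyu] at this
    refine hP.embed_T (by omega) (w := fun j => f (φ j)) ?_ hg hg' ?_ ?_ hgp hgp'
    · intro i j hij
      by_contra hne
      exact (hfne _ _ fun h => hne (φ.injective h)).1 hij
    · intro j i hi hip
      rcases lt_or_ge (i + 1) p with h1 | h1
      · have hPi : P i ∈ comp G {y} u := hP.connIn (Nat.zero_le _) hi fun k _ hk => by
          rw [hyP]
          exact fun h => hP.ne (by omega) (by omega) (by omega) (Set.mem_singleton_iff.1 h)
        have := hys.isComp_left.ne_and_not_adj hys.isComp_right hys.ne _ hPi _ (hfv (φ j))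
        exact ⟨this.1, iff_of_false this.2 (by omega)⟩
      rcases Nat.eq_or_lt_of_le h1 with h1 | h1
      · have hPi : P i = y := by rw [hyP]; congr 1; omega
        rw [hPi]
        exact ⟨(hfy _).ne, iff_of_true (hfy _) (by omega)⟩
      rcases Nat.eq_or_lt_of_le (show p + 1 ≤ i by omega) with h2 | h2
      · have hPi : P i = x := by rw [hxP, h2]
        rw [hPi]
        exact ⟨(hfx _).ne, iff_of_true (hfx _) (by omega)⟩
      · have hPi : P i ∈ comp G {x} v := ConnIn.symm (hP.connIn hi le_rfl fun k hik hk => by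
          rw [hxP]
          exact fun h => hP.ne (by omega) (by omega) (by omega) (Set.mem_singleton_iff.1 h))
        have := hxs.isComp_left.ne_and_not_adj hxs.isComp_right hxs.ne _ hPi _ (hfu (φ j))
        exact ⟨this.1, iff_of_false this.2 (by omega)⟩
    · intro i j
      by_cases hij : φ i = φ j
      · rw [hij]
        exact G.loopless.irrefl _
      · exact (hfne _ _ hij).2

end BoneDeficiency

namespace BoneDeficiency

universe w

variable {V : Type*} {G : SimpleGraph V} {n N : ℕ} {A : Set ℕ}

/-! ### Reduction to critical graphs -/

theorem localIndepNum_le_of_forall {k : ℕ} (h : ∀ t, (starK t).IsIndContained G → t ≤ k) :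
    localIndepNum G ≤ k := by
  rcases Set.eq_empty_or_nonempty {t : ℕ | (starK t).IsIndContained G} with he | hne
  · rw [localIndepNum, he]
    simp
  · exact csSup_le hne h

theorem localIndepNum_induce_le [Finite V] (X : Set V) :
    localIndepNum (G.induce X) ≤ localIndepNum G :=
  localIndepNum_le_of_forall fun _ ht =>
    le_localIndepNum (ht.trans ⟨SimpleGraph.Embedding.induce X⟩)

theorem BonesIn.induce (hA : BonesIn A G) (X : Set V) : BonesIn A (G.induce X) :=
  fun i hi h => hA i hi (h.trans ⟨SimpleGraph.Embedding.induce X⟩)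

/-- Every connected graph has a deficiency-critical induced subgraph of at least the same
deficiency. -/
theorem exists_deficiencyCritical [Finite V] (hG : G.Connected) :
    ∃ X : Set V, DeficiencyCritical (G.induce X) ∧ deficiency G ≤ deficiency (G.induce X) := by
  classical
  -- A connected vertex set of least size without loss of deficiency is critical.
  have hex : ∃ k, ∃ X : Set V, X.ncard = k ∧ (G.induce X).Connected ∧
      deficiency G ≤ deficiency (G.induce X) := by
    refine ⟨_, Set.univ, rfl, ?_, ?_⟩
    · exact (SimpleGraph.induceUnivIso G).connected_iff.2 hG
    · exact (deficiency_congr (SimpleGraph.induceUnivIso G)).ge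
  obtain ⟨X, hX, hXc, hXd⟩ := Nat.find_spec hex
  refine ⟨X, ⟨hXc, fun s hs hsc => ?_⟩, hXd⟩
  by_contra! hcon
  let f : (G.induce X).induce s ↪g G :=
    (SimpleGraph.Embedding.induce X).comp (SimpleGraph.Embedding.induce s)
  obtain ⟨e⟩ := nonempty_iso_induce_range f
  have hlt : (Set.range f).ncard < X.ncard := by
    refine Set.ncard_lt_ncard ⟨?_, fun hsub => hs ?_⟩ (Set.toFinite _)
    · rintro _ ⟨a, rfl⟩
      exact a.1.2
    · ext a
      simp only [Set.mem_univ, iff_true]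
      obtain ⟨b, hb⟩ := hsub a.2
      have : b.1 = a := Subtype.ext hb
      exact this ▸ b.2
  refine Nat.find_min hex (hX ▸ hlt) ⟨_, rfl, e.connected_iff.1 hsc, ?_⟩
  rw [← deficiency_congr e]
  exact hXd.trans hcon

/-- If every critical graph of large deficiency in a class has small deficiency, then so has every
graph in the class. -/
theorem deficiency_le_of_critical [Finite V] (hG : InBoneClass A G) (hα : localIndepNum G < n)
    (key : ∀ X : Set V, DeficiencyCritical (G.induce X) → BonesIn A (G.induce X) →
      localIndepNum (G.induce X) < n → N ≤ deficiency (G.induce X) →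
      deficiency (G.induce X) ≤ N) : deficiency G ≤ N := by
  obtain ⟨X, hX, hXd⟩ := exists_deficiencyCritical hG.1
  rcases le_total (deficiency (G.induce X)) N with h | h
  · exact hXd.trans h
  · exact hXd.trans (key X hX (BonesIn.induce hG.2 X)
      ((localIndepNum_induce_le X).trans_lt hα) h)

/-- A graph that embeds in all critical graphs of large deficiency in a class is the extremal
graph of the class. -/
theorem extremal_of_embeds {W : Type*} [Finite W] {H : SimpleGraph W} (hH : H.Connected)
    (hN : N ≤ deficiency H)
    (key : ∀ (U : Type w) [Finite U] (K : SimpleGraph U), DeficiencyCritical K → BonesIn A K →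
      localIndepNum K < n → N ≤ deficiency K → deficiency K ≤ N ∧ Nonempty (H ↪g K))
    (U : Type w) [Finite U] (K : SimpleGraph U) (hK : InBoneClass A K)
    (hα : localIndepNum K < n) :
    deficiency K ≤ N ∧ (DeficiencyCritical K → (deficiency K = N ↔ Nonempty (K ≃g H))) := by
  have hle : deficiency K ≤ N := deficiency_le_of_critical hK hα
    fun X hX hXA hXα hXN => (key X _ hX hXA hXα hXN).1
  refine ⟨hle, fun hc => ⟨fun he => ?_, fun ⟨e⟩ => ?_⟩⟩
  · obtain ⟨f⟩ := (key U K hc hK.2 hα he.ge).2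
    exact hc.iso_of_embedding hH f (he.le.trans hN)
  · have := deficiency_congr e
    omega

/-- A violating proper subgraph contains a critical graph of large deficiency, which by `key`
contains all of `H`; there are too few vertices for that. -/
theorem deficiencyCritical_of_embeds {W : Type w} [Finite W] {H : SimpleGraph W}
    (hH : InBoneClass A H) (hα : localIndepNum H < n) (hN : N ≤ deficiency H)
    (key : ∀ (U : Type w) [Finite U] (K : SimpleGraph U), DeficiencyCritical K → BonesIn A K →
      localIndepNum K < n → N ≤ deficiency K → deficiency K ≤ N ∧ Nonempty (H ↪g K)) :
    DeficiencyCritical H := by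
  refine ⟨hH.1, fun s hs hsc => ?_⟩
  by_contra! hcon
  obtain ⟨X, hX, hXd⟩ := exists_deficiencyCritical hsc
  obtain ⟨f⟩ := (key X _ hX ((BonesIn.induce hH.2 s).induce X)
    (((localIndepNum_induce_le X).trans (localIndepNum_induce_le s)).trans_lt hα)
    (hN.trans (hcon.trans hXd))).2
  have h1 := Nat.card_le_card_of_injective f f.injective
  have h2 : Nat.card X ≤ Nat.card s := Nat.card_le_card_of_injective _ Subtype.val_injective
  have h3 : s.ncard < Nat.card W := by
    rw [← Set.ncard_univ]
    exact Set.ncard_lt_ncard (Set.ssubset_univ_iff.2 hs) (Set.toFinite _)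
  rw [← Nat.card_coe_set_eq] at h3
  omega

end BoneDeficiency

namespace BoneDeficiency

variable {V : Type*} {G : SimpleGraph V} {n p m : ℕ}

/-! ### Bounds for the local independence number and the deficiency -/

theorem localIndepNum_le_of_ncard_neighborSet_le [Finite V] {k : ℕ}
    (h : ∀ x, (G.neighborSet x).ncard ≤ k) : localIndepNum G ≤ k := by
  refine localIndepNum_le_of_forall fun t ⟨f⟩ => ?_
  have hinj : Function.Injective fun j : Fin t => f (.inr j) :=
    f.injective.comp Sum.inr_injective
  have hsub : Set.range (fun j : Fin t => f (.inr j)) ⊆ G.neighborSet (f (.inl 0)) := by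
    rintro _ ⟨j, rfl⟩
    exact f.map_rel_iff.2 (by simp)
  have := Set.ncard_le_ncard hsub (Set.toFinite _)
  rw [← Nat.card_coe_set_eq, Nat.card_range_of_injective hinj, Nat.card_fin] at this
  exact this.trans (h _)

/-- The vertices of even parity exceed those of odd parity by at most the deficiency. -/
theorem sum_neg_one_pow_le_deficiency [Fintype V] (c : V → ℕ)
    (hc : ∀ x y, G.Adj x y → Odd (c x + c y)) : ∑ v, (-1 : ℤ) ^ c v ≤ deficiency G := by
  classical
  -- The odd class serves as barrier and each even vertex as an odd component of its own.
  have h := ncard_le_deficiency_add G {v | Odd (c v)} ((fun v => {v}) '' {v | Even (c v)}) ?_ ?_ ?_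
  · rw [Set.ncard_image_of_injective _ Set.singleton_injective] at h
    have hs : ∑ v, (-1 : ℤ) ^ c v = ({v | Even (c v)}.ncard : ℤ) - ({v | Odd (c v)}.ncard : ℤ) := by
      rw [Set.ncard_eq_toFinset_card', Set.ncard_eq_toFinset_card',
        ← Finset.sum_filter_add_sum_filter_not Finset.univ (fun v => Even (c v)),
        Finset.sum_congr rfl (g := fun _ => (1 : ℤ)) fun v hv => (Finset.mem_filter.1 hv).2.neg_one_pow,
        Finset.sum_congr (s₁ := Finset.univ.filter fun v => ¬ Even (c v)) rfl
          (g := fun _ => (-1 : ℤ)) fun v hv =>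
          (Nat.not_even_iff_odd.1 (Finset.mem_filter.1 hv).2).neg_one_pow]
      simp [sub_eq_add_neg]
    omega
  · rintro _ ⟨a, -, rfl⟩ _ ⟨b, -, rfl⟩ w hw hw'
    rw [← Set.mem_singleton_iff.1 hw, ← Set.mem_singleton_iff.1 hw']
  · rintro _ ⟨a, -, rfl⟩
    simp
  · rintro _ ⟨a, ha, rfl⟩ b hb d hbd
    obtain rfl : b = a := hb
    right
    have h1 := hc _ _ hbd
    have h2 : Even (c b) := ha
    by_contra hcon
    exact Nat.not_odd_iff_even.2 (h2.add (Nat.not_odd_iff_even.1 hcon)) h1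

/-! ### Layered graphs -/

/-- A sequence with steps of size one that does not turn is monotone. -/
theorem eq_add_or_add_eq_of_steps {f : ℕ → ℕ} {l : ℕ}
    (h1 : ∀ k < l, f k + 1 = f (k + 1) ∨ f (k + 1) + 1 = f k)
    (h2 : ∀ k, k + 2 ≤ l → f k ≠ f (k + 2)) :
    (∀ k ≤ l, f k = f 0 + k) ∨ ∀ k ≤ l, f k + k = f 0 := by
  rcases Nat.eq_zero_or_pos l with rfl | hl
  · left
    intro k hk
    obtain rfl : k = 0 := by omega
    rfl
  rcases h1 0 hl with h0 | h0
  · left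
    have key : ∀ k, k + 1 ≤ l → f k = f 0 + k ∧ f (k + 1) = f 0 + (k + 1) := by
      intro k
      induction k with
      | zero => exact fun _ => ⟨rfl, h0.symm⟩
      | succ k ih =>
        intro hk
        have := ih (by omega)
        have h3 := h1 (k + 1) (by omega)
        have h4 := h2 k (by omega)
        rw [show k + 1 + 1 = k + 2 from rfl] at *
        omega
    intro k hk
    cases k with
    | zero => rfl
    | succ k => exact (key k hk).2
  · right
    have key : ∀ k, k + 1 ≤ l → f k + k = f 0 ∧ f (k + 1) + (k + 1) = f 0 := by
      intro k
      induction k with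
      | zero => exact fun _ => ⟨rfl, h0⟩
      | succ k ih =>
        intro hk
        have := ih (by omega)
        have h3 := h1 (k + 1) (by omega)
        have h4 := h2 k (by omega)
        rw [show k + 1 + 1 = k + 2 from rfl] at *
        omega
    intro k hk
    cases k with
    | zero => rfl
    | succ k => exact (key k hk).2

/-- In a graph whose adjacency is given by the distance of layers, the pendent vertices of an
induced bone lie in two layers at distance `i + 1`. -/
theorem exists_layers_of_bone {pos : V → ℕ}
    (hpos : ∀ x y, G.Adj x y ↔ pos x + 1 = pos y ∨ pos y + 1 = pos x) {i : ℕ} (hi : 2 ≤ i)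
    (h : (bone i).IsIndContained G) :
    ∃ j, (∃ x y, x ≠ y ∧ pos x = j ∧ pos y = j) ∧
      ∃ x y, x ≠ y ∧ pos x = j + i + 1 ∧ pos y = j + i + 1 := by
  obtain ⟨f⟩ := h
  have hadj : ∀ x y, (bone i).Adj x y ↔ pos (f x) + 1 = pos (f y) ∨ pos (f y) + 1 = pos (f x) :=
    fun x y => f.map_rel_iff.symm.trans (hpos _ _)
  -- Vertices of one layer have the same neighbours, and within a bone only pendent vertices at the
  -- same end do.
  have htwin : ∀ x y z, pos (f x) = pos (f y) → (bone i).Adj x z → (bone i).Adj y z := by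
    intro x y z he hxz
    rw [hadj] at hxz ⊢
    rwa [← he]
  let x : ℕ → Fin i ⊕ Bool × Fin 2 := fun k =>
    if hk : 1 ≤ k ∧ k ≤ i then .inl ⟨k - 1, by omega⟩
    else if k = 0 then .inr (false, 0) else .inr (true, 0)
  have hx : ∀ k (hk : k < i), x (k + 1) = .inl ⟨k, hk⟩ := by
    intro k hk
    simp only [x]
    rw [dif_pos (by omega)]
    simp
  have hx0 : x 0 = .inr (false, 0) := by simp [x]
  have hxl : x (i + 1) = .inr (true, 0) := by simp [x]
  have hstep : ∀ k < i + 1, (bone i).Adj (x k) (x (k + 1)) := by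
    intro k hk
    rcases Nat.eq_zero_or_pos k with rfl | hk0
    · rw [hx0, hx 0 (by omega)]
      exact (bone_adj_inl_false.2 rfl).symm
    obtain ⟨k, rfl⟩ : ∃ k', k = k' + 1 := ⟨k - 1, by omega⟩
    rw [hx k (by omega)]
    rcases Nat.eq_or_lt_of_le (show k + 1 ≤ i by omega) with h | h
    · rw [h, hxl]
      exact bone_adj_inl_true.2 h
    · rw [hx (k + 1) h]
      exact bone_adj_inl_inl.2 (Or.inl rfl)
  -- Along `x`, the path extended by one pendent vertex at each end, a return to the same layer
  -- would create forbidden twins. So the layers are monotone and span `i + 1` steps.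
  have hturn : ∀ k, k + 2 ≤ i + 1 → pos (f (x k)) ≠ pos (f (x (k + 2))) := by
    intro k hk he
    rcases Nat.eq_zero_or_pos k with rfl | hk0
    · have := htwin _ _ _ he.symm (hstep 2 (by omega))
      rw [hx0] at this
      rcases Nat.eq_or_lt_of_le hi with h | h
      · rw [show 2 + 1 = i + 1 by omega, hxl] at this
        exact not_bone_adj_inr_inr this
      · rw [hx 2 h] at this
        have := bone_adj_inl_false.1 this.symm
        simp at this
    · obtain ⟨k, rfl⟩ : ∃ k', k = k' + 1 := ⟨k - 1, by omega⟩
      have := htwin _ _ _ he (hstep k (by omega)).symm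
      rcases Nat.eq_zero_or_pos k with rfl | hk0
      · rw [hx0] at this
        rcases Nat.eq_or_lt_of_le hi with h | h
        · rw [show 0 + 1 + 2 = i + 1 by omega, hxl] at this
          exact not_bone_adj_inr_inr this
        · rw [show 0 + 1 + 2 = 2 + 1 by omega, hx 2 h] at this
          have := bone_adj_inl_false.1 this
          simp at this
      · obtain ⟨k, rfl⟩ : ∃ k', k = k' + 1 := ⟨k - 1, by omega⟩
        rw [hx k (by omega)] at this
        rcases Nat.eq_or_lt_of_le (show k + 4 ≤ i + 1 by omega) with h | h
        · rw [show k + 1 + 1 + 2 = i + 1 by omega, hxl] at this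
          have := bone_adj_inl_true.1 this.symm
          simp at this
          omega
        · rw [show k + 1 + 1 + 2 = (k + 3) + 1 by omega, hx (k + 3) (by omega)] at this
          have := bone_adj_inl_inl.1 this
          simp at this
          omega
  have hmono := eq_add_or_add_eq_of_steps (f := fun k => pos (f (x k))) (l := i + 1)
    (fun k hk => (hadj _ _).1 (hstep k hk)) hturn
  have hfalse : pos (f (.inr (false, 1))) = pos (f (.inr (false, 0))) := by
    have h1 := (hadj _ _).1 ((bone_adj_inl_false (i := i) (a := ⟨0, by omega⟩) (k := 1)).2 rfl)
    have h0 := (hadj _ _).1 ((bone_adj_inl_false (i := i) (a := ⟨0, by omega⟩) (k := 0)).2 rfl)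
    by_contra hne
    have h2 := (hadj _ _).1 (hstep 1 (by omega))
    have h3 := hturn 0 (by omega)
    rw [hx0] at h3
    rw [hx 0 (by omega)] at h2
    have he : pos (f (x (1 + 1))) = pos (f (.inr (false, 1))) := by
      rw [show 0 + 2 = 1 + 1 from rfl] at h3
      omega
    have := htwin _ _ _ he (hstep 2 (by omega))
    rcases Nat.eq_or_lt_of_le hi with h | h
    · rw [show 2 + 1 = i + 1 by omega, hxl] at this
      exact not_bone_adj_inr_inr this
    · rw [hx 2 h] at this
      have := bone_adj_inl_false.1 this.symm
      simp at this
  have htrue : pos (f (.inr (true, 1))) = pos (f (.inr (true, 0))) := by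
    have h1 := (hadj _ _).1
      ((bone_adj_inl_true (i := i) (a := ⟨i - 1, by omega⟩) (k := 1)).2 (by simp; omega))
    have h0 := (hadj _ _).1
      ((bone_adj_inl_true (i := i) (a := ⟨i - 1, by omega⟩) (k := 0)).2 (by simp; omega))
    by_contra hne
    obtain ⟨i, rfl⟩ : ∃ i', i = i' + 2 := ⟨i - 2, by omega⟩
    have h2 := (hadj _ _).1 (hstep (i + 1) (by omega))
    have h3 := hturn (i + 1) (by omega)
    rw [hxl] at h3
    rw [hx (i + 1) (by omega)] at h2
    have he : pos (f (x (i + 1))) = pos (f (.inr (true, 1))) := by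
      simp only [show i + 2 - 1 = i + 1 by omega] at h0 h1
      omega
    have := htwin _ _ _ he (hstep i (by omega)).symm
    rcases Nat.eq_zero_or_pos i with h | h
    · subst h
      rw [hx0] at this
      exact not_bone_adj_inr_inr this
    · obtain ⟨i, rfl⟩ : ∃ i', i = i' + 1 := ⟨i - 1, by omega⟩
      rw [hx i (by omega)] at this
      have := bone_adj_inl_true.1 this.symm
      simp at this
  have hdf : f (.inr (false, 0)) ≠ f (.inr (false, 1)) := fun h => by simpa using f.injective h
  have hdt : f (.inr (true, 0)) ≠ f (.inr (true, 1)) := fun h => by simpa using f.injective h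
  rcases hmono with h | h
  · have := h (i + 1) le_rfl
    simp only [hx0, hxl] at this
    exact ⟨_, ⟨_, _, hdf, rfl, hfalse⟩, _, _, hdt, this, htrue.trans this⟩
  · have := h (i + 1) le_rfl
    simp only [hx0, hxl] at this
    exact ⟨_, ⟨_, _, hdt, rfl, htrue⟩, _, _, hdf, this.symm, hfalse.trans this.symm⟩

end BoneDeficiency

namespace BoneDeficiency

variable {n p m : ℕ}

/-! ### The graph `T` is in the class -/

/-- The layer of a vertex of `T_m^p`. -/
def layerT (p : ℕ) {m : ℕ} : TVertex p m → ℕ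
  | .inl x => armPos p x + 1
  | .inr (.inl _) => p + 1
  | .inr (.inr (false, _)) => 0
  | .inr (.inr (true, _)) => 2 * p + 2

theorem T_adj_iff_layerT (hp : 3 ≤ p) (x y : TVertex p m) :
    (T p m).Adj x y ↔ layerT p x + 1 = layerT p y ∨ layerT p y + 1 = layerT p x := by
  have hle := armPos_le (p := p)
  have hne := armPos_ne (p := p)
  rcases x with (x | i | ⟨_ | _, i⟩) <;> rcases y with (y | j | ⟨_ | _, j⟩) <;>
    simp only [layerT]
  · rw [T_adj_arm_arm]
    omega
  · have := hne x
    rw [T_adj_arm_mid]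
    omega
  · rw [T_adj_arm_leaf_false]
    omega
  · have := hle x
    rw [T_adj_arm_leaf_true]
    omega
  · have := hne y
    rw [SimpleGraph.adj_comm, T_adj_arm_mid]
    omega
  · exact iff_of_false not_T_adj_inr_inr (by omega)
  · exact iff_of_false not_T_adj_inr_inr (by omega)
  · exact iff_of_false not_T_adj_inr_inr (by omega)
  · rw [SimpleGraph.adj_comm, T_adj_arm_leaf_false]
    omega
  · exact iff_of_false not_T_adj_inr_inr (by omega)
  · exact iff_of_false not_T_adj_inr_inr (by omega)
  · exact iff_of_false not_T_adj_inr_inr (by omega)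
  · have := hle y
    rw [SimpleGraph.adj_comm, T_adj_arm_leaf_true]
    omega
  · exact iff_of_false not_T_adj_inr_inr (by omega)
  · exact iff_of_false not_T_adj_inr_inr (by omega)
  · exact iff_of_false not_T_adj_inr_inr (by omega)

/-- The layers of more than one vertex. -/
theorem layerT_eq_of_ne {x y : TVertex p m} (hxy : x ≠ y) (h : layerT p x = layerT p y) :
    layerT p x = 0 ∨ layerT p x = p + 1 ∨ layerT p x = 2 * p + 2 := by
  have hle := armPos_le (p := p)
  have hne := armPos_ne (p := p)
  rcases x with (x | i | ⟨_ | _, i⟩)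
  · rcases y with (y | j | ⟨_ | _, j⟩)
    · simp only [layerT] at h
      exact absurd (congrArg _ (armPos_injective (by omega))) hxy
    · simp only [layerT] at h
      have := hne x
      omega
    · simp only [layerT] at h
      omega
    · simp only [layerT] at h
      have := hle x
      omega
  · simp [layerT]
  · simp [layerT]
  · simp [layerT]

theorem ncard_layerT_le (hm : 1 ≤ m) (k : ℕ) : {x : TVertex p m | layerT p x = k}.ncard ≤ m := by
  have hle := armPos_le (p := p)
  have hne := armPos_ne (p := p)
  by_cases h : {x : TVertex p m | layerT p x = k}.ncard ≤ 1
  · omega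
  rw [not_le, Set.one_lt_ncard (Set.toFinite _)] at h
  obtain ⟨x, hx, y, hy, hxy⟩ := h
  have hk := layerT_eq_of_ne hxy (hx.trans hy.symm)
  rw [show layerT p x = k from hx] at hk
  obtain ⟨g, hg⟩ : ∃ g : Fin m → TVertex p m, {x : TVertex p m | layerT p x = k} ⊆ Set.range g := by
    rcases hk with rfl | rfl | rfl
    · refine ⟨fun j => .inr (.inr (false, j)), ?_⟩
      rintro (x | i | ⟨_ | _, i⟩) hx
      · simp [layerT] at hx
      · simp [layerT] at hx
      · exact ⟨i, rfl⟩
      · simp [layerT] at hx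
    · refine ⟨fun j => .inr (.inl j), ?_⟩
      rintro (x | i | ⟨_ | _, i⟩) hx
      · simp only [layerT, Set.mem_ofPred_eq] at hx
        exact absurd (by omega) (hne x)
      · exact ⟨i, rfl⟩
      · simp [layerT] at hx
      · simp only [layerT, Set.mem_ofPred_eq] at hx
        omega
    · refine ⟨fun j => .inr (.inr (true, j)), ?_⟩
      rintro (x | i | ⟨_ | _, i⟩) hx
      · simp only [layerT, Set.mem_ofPred_eq] at hx
        have := hle x
        omega
      · simp only [layerT, Set.mem_ofPred_eq] at hx
        omega
      · simp [layerT] at hx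
      · exact ⟨i, rfl⟩
  refine (Set.ncard_le_ncard hg (Set.toFinite _)).trans ?_
  rw [← Set.image_univ]
  exact (Set.ncard_image_le (Set.toFinite _)).trans (by simp [Set.ncard_univ])

/-- Neighbours lie in the two adjacent layers. Layers with several vertices are `p + 1` apart, so at
most one of the two is large. -/
theorem localIndepNum_T_le (hp : 3 ≤ p) (hm : 1 ≤ m) : localIndepNum (T p m) ≤ m + 1 := by
  refine localIndepNum_le_of_ncard_neighborSet_le fun x => ?_
  have hsub : (T p m).neighborSet x ⊆
      {y | layerT p y = layerT p x + 1} ∪ {y | layerT p y + 1 = layerT p x} := by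
    intro y hy
    rw [SimpleGraph.mem_neighborSet, T_adj_iff_layerT hp] at hy
    exact hy.imp (fun h => h.symm) fun h => h
  refine (Set.ncard_le_ncard hsub (Set.toFinite _)).trans ((Set.ncard_union_le _ _).trans ?_)
  have hone : ∀ k, k ≠ 0 → k ≠ p + 1 → k ≠ 2 * p + 2 →
      {x : TVertex p m | layerT p x = k}.ncard ≤ 1 := by
    intro k h0 h1 h2
    rw [Set.ncard_le_one (Set.toFinite _)]
    intro y hy z hz
    by_contra hne
    have := layerT_eq_of_ne hne (hy.trans hz.symm)
    rw [show layerT p y = k from hy] at this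
    omega
  have hle1 := ncard_layerT_le (p := p) hm (layerT p x + 1)
  rcases Nat.eq_zero_or_pos (layerT p x) with h0 | h0
  · have : {y : TVertex p m | layerT p y + 1 = layerT p x} = ∅ := by
      ext y
      simp [h0]
    rw [this, Set.ncard_empty]
    omega
  · have he : {y : TVertex p m | layerT p y + 1 = layerT p x} =
        {y | layerT p y = layerT p x - 1} := by
      ext y
      simp only [Set.mem_ofPred_eq]
      omega
    have hle2 := ncard_layerT_le (p := p) hm (layerT p x - 1)
    rw [he]
    by_cases hb : layerT p x + 1 = p + 1 ∨ layerT p x + 1 = 2 * p + 2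
    · have := hone (layerT p x - 1) (by omega) (by omega) (by omega)
      omega
    · have := hone (layerT p x + 1) (by omega) (by omega) (by omega)
      omega

/-- Both pairs of pendent vertices lie in layers with several vertices, namely `0`, `p + 1`, `2 * p
+ 2`; their distance `i + 1` is thus `p + 1` or `2 * p + 2`. -/
theorem bonesIn_T (hp : 3 ≤ p) : BonesIn {p, 2 * p + 1} (T p m) := by
  intro i hi h
  obtain ⟨j, ⟨x, y, hxy, hx, hy⟩, z, w, hzw, hz, hw⟩ :=
    exists_layers_of_bone (T_adj_iff_layerT hp) hi h
  have h1 := layerT_eq_of_ne hxy (hx.trans hy.symm)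
  have h2 := layerT_eq_of_ne hzw (hz.trans hw.symm)
  simp only [Set.mem_insert_iff, Set.mem_singleton_iff]
  omega

theorem connected_T (hp : 1 ≤ p) (hm : 1 ≤ m) : (T p m).Connected := by
  have hmid : ∀ s j, (T p m).Adj (.inl (s, ⟨0, by omega⟩)) (.inr (.inl j)) := by
    intro s j
    simp [T, SimpleGraph.fromRel_adj]
  have harm : ∀ s a (ha : a < p),
      (T p m).Reachable (.inl (s, ⟨a, ha⟩)) (.inr (.inl ⟨0, by omega⟩)) := by
    intro s a
    induction a with
    | zero => exact fun _ => (hmid s _).reachable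
    | succ a ih =>
      intro ha
      refine SimpleGraph.Reachable.trans (SimpleGraph.Adj.reachable ?_) (ih (by omega))
      simp [T, SimpleGraph.fromRel_adj]
  have hall : ∀ x, (T p m).Reachable x (.inr (.inl ⟨0, by omega⟩)) := by
    rintro (⟨s, a⟩ | j | ⟨s, j⟩)
    · exact harm s a a.2
    · exact (hmid true j).symm.reachable.trans (harm _ _ _)
    · refine SimpleGraph.Reachable.trans (SimpleGraph.Adj.reachable ?_)
        (harm s (p - 1) (by omega))
      simp [T, SimpleGraph.fromRel_adj]
      omega
  have : Nonempty (TVertex p m) := ⟨.inr (.inl ⟨0, by omega⟩)⟩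
  exact ⟨fun x y => (hall x).trans (hall y).symm⟩

theorem inBoneClass_T (hp : 3 ≤ p) (hm : 1 ≤ m) : InBoneClass {p, 2 * p + 1} (T p m) :=
  ⟨connected_T (by omega) hm, bonesIn_T hp⟩

/-- In the two-colouring all `3 * m` vertices off the arms are even, and each arm, of odd order and
starting odd, contributes `-1`. -/
theorem le_deficiency_T (hodd : Odd p) : 3 * m - 2 ≤ deficiency (T p m) := by
  have h := sum_neg_one_pow_le_deficiency (G := T p m) (fun x => match x with
    | .inl (_, a) => a.val + 1
    | .inr (.inl _) => 0
    | .inr (.inr _) => p + 1) ?_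
  · simp only [Fintype.sum_sum_type, Fintype.sum_prod_type, Finset.sum_const, Finset.card_univ,
      pow_succ, ← Finset.sum_mul, hodd.neg_one_pow, Fin.sum_univ_eq_sum_range (fun a => (-1 : ℤ) ^ a),
      neg_one_geom_sum, Nat.not_even_iff_odd.2 hodd, Fintype.card_bool, Fintype.card_fin] at h
    simp at h
    omega
  · rintro (⟨s, a⟩ | j | ⟨s, j⟩) (⟨t, b⟩ | k | ⟨t, k⟩) hadj <;>
      simp [T, SimpleGraph.fromRel_adj] at hadj ⊢
    all_goals rw [Nat.odd_iff] at *
    all_goals omega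

end BoneDeficiency

namespace BoneDeficiency

variable {n p m : ℕ}

/-! ### The graph `S` is in the class -/

theorem connected_S (hp : 2 ≤ p) : (S p m).Connected := by
  have hleg : ∀ i a (ha : a < p - 1),
      (S p m).Reachable (.inr (.inl (i, ⟨a, ha⟩))) (.inl ()) := by
    intro i a
    induction a with
    | zero => exact fun _ => (S_adj_center_leg.2 rfl).symm.reachable
    | succ a ih =>
      intro ha
      refine SimpleGraph.Reachable.trans (SimpleGraph.Adj.reachable ?_) (ih (by omega))
      simp [S, SimpleGraph.fromRel_adj]
  have hall : ∀ x, (S p m).Reachable x (.inl ()) := by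
    rintro (_ | ⟨i, a⟩ | ⟨i, k⟩)
    · exact SimpleGraph.Reachable.refl _
    · exact hleg i a a.2
    · refine SimpleGraph.Reachable.trans (SimpleGraph.Adj.reachable ?_)
        (hleg i (p - 2) (by omega))
      exact (S_adj_leg_leaf.2 ⟨rfl, by simp; omega⟩).symm
  have : Nonempty (SVertex p m) := ⟨.inl ()⟩
  exact ⟨fun x y => (hall x).trans (hall y).symm⟩

/-- The `p - 1` further vertices of a branch cancel in pairs, leaving the leaves against the centre.
-/
theorem le_deficiency_S (hodd : Odd p) (hm : 1 ≤ m) : m * (m - 1) - 1 ≤ deficiency (S p m) := by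
  have h := sum_neg_one_pow_le_deficiency (G := S p m) (fun x => match x with
    | .inl _ => 1
    | .inr (.inl (_, a)) => a.val + 2
    | .inr (.inr _) => p + 1) ?_
  · have hev : Even (p - 1) := by
      obtain ⟨c, hc⟩ := hodd
      exact ⟨c, by omega⟩
    simp only [Fintype.sum_sum_type, Fintype.sum_prod_type, Finset.sum_const, Finset.card_univ,
      pow_succ, ← Finset.sum_mul, hodd.neg_one_pow, Fin.sum_univ_eq_sum_range (fun a => (-1 : ℤ) ^ a),
      neg_one_geom_sum, hev, Fintype.card_fin] at h
    simp at h
    obtain ⟨m, rfl⟩ : ∃ k, m = k + 1 := ⟨m - 1, by omega⟩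
    push_cast at h
    rw [Nat.add_sub_cancel, tsub_le_iff_right]
    zify
    linarith
  · rintro (_ | ⟨i, a⟩ | ⟨i, a⟩) (_ | ⟨j, b⟩ | ⟨j, b⟩) hadj <;>
      simp [S, SimpleGraph.fromRel_adj] at hadj ⊢
    all_goals rw [Nat.odd_iff] at *
    all_goals omega

theorem localIndepNum_S_le (hp : 2 ≤ p) (hm : 2 ≤ m) : localIndepNum (S p m) ≤ m := by
  have hcard : ∀ (x : SVertex p m) (ι : Type) [Fintype ι] (g : ι → SVertex p m),
      Fintype.card ι ≤ m → (S p m).neighborSet x ⊆ Set.range g →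
      ((S p m).neighborSet x).ncard ≤ m := by
    intro x ι _ g hι hg
    refine (Set.ncard_le_ncard hg (Set.toFinite _)).trans ?_
    rw [← Set.image_univ]
    refine (Set.ncard_image_le (Set.toFinite _)).trans ?_
    rwa [Set.ncard_univ, Nat.card_eq_fintype_card]
  refine localIndepNum_le_of_ncard_neighborSet_le fun x => ?_
  rcases x with (_ | ⟨i, a⟩ | ⟨i, k⟩)
  · refine hcard _ (Fin m) (fun j => .inr (.inl (j, ⟨0, by omega⟩))) (by simp) ?_
    rintro (_ | ⟨j, b⟩ | ⟨j, k⟩) hadj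
    · exact absurd hadj ((S p m).loopless.irrefl _)
    · exact ⟨j, by rw [show b = ⟨0, by omega⟩ from Fin.ext (S_adj_center_leg.1 hadj)]⟩
    · exact absurd hadj not_S_adj_center_leaf
  · refine hcard _ (Option (Fin (m - 1))) (fun o => match o with
      | none => if a.val = 0 then .inl () else .inr (.inl (i, ⟨a - 1, by omega⟩))
      | some k => if h : a.val + 2 = p then .inr (.inr (i, k))
          else .inr (.inl (i, ⟨a + 1, by omega⟩))) (by simp; omega) ?_
    rintro (_ | ⟨j, b⟩ | ⟨j, k⟩) hadj
    · refine ⟨none, ?_⟩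
      simp [S_adj_center_leg.1 hadj.symm]
    · obtain ⟨rfl, h | h⟩ := S_adj_leg_leg.1 hadj
      · refine ⟨some ⟨0, by omega⟩, ?_⟩
        have : ¬ a.val + 2 = p := by omega
        simp only [this, dite_false]
        congr 3
        exact Fin.ext h
      · refine ⟨none, ?_⟩
        have : ¬ a.val = 0 := by omega
        simp only [this, if_false]
        congr 3
        exact Fin.ext (by simp; omega)
    · obtain ⟨rfl, h⟩ := S_adj_leg_leaf.1 hadj
      exact ⟨some k, by simp [h]⟩
  · refine hcard _ Unit (fun _ => .inr (.inl (i, ⟨p - 2, by omega⟩))) (by simp; omega) ?_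
    rintro (_ | ⟨j, b⟩ | ⟨j, k⟩) hadj
    · exact absurd hadj.symm not_S_adj_center_leaf
    · obtain ⟨rfl, h⟩ := S_adj_leg_leaf.1 hadj.symm
      refine ⟨(), ?_⟩
      rw [show b = ⟨p - 2, by omega⟩ from Fin.ext (by simp; omega)]
    · exact absurd hadj not_S_adj_leaf_leaf

/-- A path from the centre through vertices that are not leaves runs along a leg. -/
theorem IPath.exists_leg {P : ℕ → SVertex p m} {l : ℕ} (hP : IPath (S p m) P l) (hl1 : 1 ≤ l)
    (h0 : P 0 = .inl ()) (hl : ∀ i ≤ l, ∀ x, P i ≠ .inr (.inr x)) :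
    ∃ i, ∀ k, 1 ≤ k → k ≤ l → ∃ a : Fin (p - 1), P k = .inr (.inl (i, a)) ∧ a.val + 1 = k := by
  have h1 : ∃ i, ∃ a : Fin (p - 1), P 1 = .inr (.inl (i, a)) ∧ a.val + 1 = 1 := by
    have hadj := hP.adj_succ (i := 0) hl1
    rw [h0] at hadj
    rcases hx : P (0 + 1) with (_ | ⟨i, a⟩ | y) <;> rw [hx] at hadj
    · exact absurd rfl hadj.ne
    · exact ⟨i, a, rfl, by rw [S_adj_center_leg.1 hadj]⟩
    · exact absurd hx (hl _ hl1 y)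
  obtain ⟨i, hi⟩ := h1
  refine ⟨i, fun k => ?_⟩
  induction k using Nat.strong_induction_on with
  | _ k ih =>
    intro hk hkl
    rcases Nat.eq_or_lt_of_le hk with rfl | hk1
    · exact hi
    obtain ⟨k, rfl⟩ : ∃ k', k = k' + 1 := ⟨k - 1, by omega⟩
    obtain ⟨a, ha, hak⟩ := ih k (by omega) (by omega) (by omega)
    have hadj := hP.adj_succ (i := k) hkl
    rw [ha] at hadj
    rcases hx : P (k + 1) with (_ | ⟨j, b⟩ | y) <;> rw [hx] at hadj
    · exact absurd (hx.trans h0.symm) (hP.ne hkl (Nat.zero_le _) (by omega))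
    · obtain ⟨rfl, h | h⟩ := S_adj_leg_leg.1 hadj
      · exact ⟨b, rfl, by omega⟩
      · obtain ⟨c, hc, hck⟩ := ih (k - 1) (by omega) (by omega) (by omega)
        have hbc : b = c := Fin.ext (by omega)
        subst hbc
        exact absurd (hc.trans hx.symm) (hP.ne (by omega) hkl (by omega))
    · exact absurd hx (hl _ hkl y)

theorem S_eq_of_adj_leaf {x : Fin m × Fin (m - 1)} {y y' : SVertex p m}
    (h : (S p m).Adj (.inr (.inr x)) y) (h' : (S p m).Adj (.inr (.inr x)) y') : y = y' := by
  rcases y with (_ | ⟨j, b⟩ | y)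
  · exact absurd h.symm not_S_adj_center_leaf
  · rcases y' with (_ | ⟨j', b'⟩ | y')
    · exact absurd h'.symm not_S_adj_center_leaf
    · obtain ⟨rfl, h⟩ := S_adj_leg_leaf.1 h.symm
      obtain ⟨rfl, h'⟩ := S_adj_leg_leaf.1 h'.symm
      rw [show b = b' from Fin.ext (by omega)]
    · exact absurd h' not_S_adj_leaf_leaf
  · exact absurd h not_S_adj_leaf_leaf

/-- The vertices with three neighbours are the centre and the feet. -/
theorem S_center_or_foot {x y y' y'' : SVertex p m} (h : (S p m).Adj x y) (h' : (S p m).Adj x y')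
    (h'' : (S p m).Adj x y'') (h1 : y ≠ y') (h2 : y ≠ y'') (h3 : y' ≠ y'') :
    x = .inl () ∨ ∃ i, ∃ a : Fin (p - 1), x = .inr (.inl (i, a)) ∧ a.val + 2 = p := by
  rcases x with (_ | ⟨i, a⟩ | x)
  · exact Or.inl rfl
  · refine Or.inr ⟨i, a, rfl, ?_⟩
    by_contra ha
    have key : ∀ z, (S p m).Adj (.inr (.inl (i, a))) z → (z = .inl () ∧ a.val = 0) ∨
        ∃ b : Fin (p - 1), z = .inr (.inl (i, b)) ∧ (a.val + 1 = b.val ∨ b.val + 1 = a.val) := by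
      rintro (_ | ⟨j, b⟩ | ⟨j, k⟩) hz
      · exact Or.inl ⟨rfl, S_adj_center_leg.1 hz.symm⟩
      · obtain ⟨rfl, hb⟩ := S_adj_leg_leg.1 hz
        exact Or.inr ⟨b, rfl, hb⟩
      · exact absurd (S_adj_leg_leaf.1 hz).2 ha
    have hleg : ∀ b c : Fin (p - 1), (.inr (.inl (i, b)) : SVertex p m) ≠ .inr (.inl (i, c)) →
        b.val ≠ c.val := fun b c hne he => hne (by rw [Fin.ext he])
    rcases key y h with ⟨rfl, h⟩ | ⟨b, rfl, h⟩ <;> rcases key y' h' with ⟨rfl, h'⟩ | ⟨b', rfl, h'⟩ <;>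
      rcases key y'' h'' with ⟨rfl, h''⟩ | ⟨b'', rfl, h''⟩ <;>
      first
      | exact absurd rfl h1
      | exact absurd rfl h2
      | exact absurd rfl h3
      | skip
    · have := hleg _ _ h3; omega
    · have := hleg _ _ h2; omega
    · have := hleg _ _ h1; omega
    · have := hleg _ _ h1; have := hleg _ _ h2; have := hleg _ _ h3; omega
  · exact absurd (S_eq_of_adj_leaf h h') h1

/-- Each end of the bone's path has three neighbours, so it is the centre or a foot. The path must
meet the centre, and each nontrivial part from there is a full leg; there are one or two such parts.
-/
theorem bonesIn_S (hp : 3 ≤ p) : BonesIn {p, 2 * p - 1} (S p m) := by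
  rintro i hi ⟨f⟩
  have hadj : ∀ {x y}, (bone i).Adj x y → (S p m).Adj (f x) (f y) := fun h => f.map_rel_iff.2 h
  let P : ℕ → SVertex p m := fun k => if h : k < i then f (.inl ⟨k, h⟩) else .inl ()
  have hPk : ∀ k (h : k < i), P k = f (.inl ⟨k, h⟩) := fun k h => dif_pos h
  have hP : IPath (S p m) P (i - 1) := by
    constructor
    · intro j k hj hk he
      rw [hPk j (by omega), hPk k (by omega)] at he
      simpa using f.injective he
    · intro j k hj hk
      rw [hPk j (by omega), hPk k (by omega)]
      exact f.map_rel_iff.trans bone_adj_inl_inl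
  have hleaf : ∀ k ≤ i - 1, ∀ x, P k ≠ .inr (.inr x) := by
    intro k hk x hx
    have key : ∀ y y', y ≠ y' → (bone i).Adj (.inl ⟨k, by omega⟩) y →
        (bone i).Adj (.inl ⟨k, by omega⟩) y' → False := by
      intro y y' hne h h'
      have h := hadj h
      have h' := hadj h'
      rw [← hPk, hx] at h h'
      exact hne (f.injective (S_eq_of_adj_leaf h h'))
    rcases Nat.eq_zero_or_pos k with rfl | hk0
    · exact key (.inr (false, 0)) (.inr (false, 1)) (by simp) (bone_adj_inl_false.2 rfl)
        (bone_adj_inl_false.2 rfl)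
    · rcases Nat.eq_or_lt_of_le hk with h | h
      · exact key (.inr (true, 0)) (.inr (true, 1)) (by simp)
          (bone_adj_inl_true.2 (by simp; omega)) (bone_adj_inl_true.2 (by simp; omega))
      · exact key (.inl ⟨k - 1, by omega⟩) (.inl ⟨k + 1, by omega⟩) (by simp)
          (bone_adj_inl_inl.2 (by simp; omega)) (bone_adj_inl_inl.2 (by simp))
  have hstart : P 0 = .inl () ∨ ∃ j, ∃ a : Fin (p - 1), P 0 = .inr (.inl (j, a)) ∧ a.val + 2 = p := by
    rw [hPk 0 (by omega)]
    refine S_center_or_foot (hadj (y := .inr (false, 0)) (bone_adj_inl_false.2 rfl))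
      (hadj (y := .inr (false, 1)) (bone_adj_inl_false.2 rfl))
      (hadj (y := .inl ⟨1, by omega⟩) (bone_adj_inl_inl.2 (by simp))) ?_ ?_ ?_ <;>
      exact fun h => by simpa using f.injective h
  have hend : P (i - 1) = .inl () ∨
      ∃ j, ∃ a : Fin (p - 1), P (i - 1) = .inr (.inl (j, a)) ∧ a.val + 2 = p := by
    rw [hPk (i - 1) (by omega)]
    refine S_center_or_foot
      (hadj (y := .inr (true, 0)) (bone_adj_inl_true.2 (by simp; omega)))
      (hadj (y := .inr (true, 1)) (bone_adj_inl_true.2 (by simp; omega)))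
      (hadj (y := .inl ⟨i - 2, by omega⟩) (bone_adj_inl_inl.2 (by simp; omega))) ?_ ?_ ?_ <;>
      exact fun h => by simpa using f.injective h
  -- from the centre to a foot
  have hlen : ∀ {Q : ℕ → SVertex p m} {l : ℕ}, IPath (S p m) Q l → 1 ≤ l → Q 0 = .inl () →
      (∀ i ≤ l, ∀ x, Q i ≠ .inr (.inr x)) →
      (Q l = .inl () ∨ ∃ j, ∃ a : Fin (p - 1), Q l = .inr (.inl (j, a)) ∧ a.val + 2 = p) →
      l + 1 = p := by
    intro Q l hQ hl h0 hQl he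
    obtain ⟨j, hj⟩ := hQ.exists_leg hl h0 hQl
    obtain ⟨a, ha, hal⟩ := hj l hl le_rfl
    rcases he with he | ⟨j', a', he, ha'⟩
    · exact absurd (h0.trans he.symm) (hQ.ne (Nat.zero_le _) le_rfl (by omega))
    · rw [ha] at he
      simp only [Sum.inr.injEq, Sum.inl.injEq, Prod.mk.injEq] at he
      obtain ⟨-, rfl⟩ := he
      omega
  -- A path avoiding the centre stays in one leg, where both of its ends would be the same foot.
  have hcenter : ∃ k ≤ i - 1, P k = .inl () := by
    by_contra! hcon
    rcases hstart with h0 | ⟨j, a, h0, ha⟩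
    · exact hcon 0 (by omega) h0
    have hsame : ∀ k ≤ i - 1, ∃ b, P k = .inr (.inl (j, b)) := by
      intro k
      induction k with
      | zero => exact fun _ => ⟨a, h0⟩
      | succ k ih =>
        intro hk
        obtain ⟨b, hb⟩ := ih (by omega)
        have h := hP.adj_succ (i := k) (by omega)
        rw [hb] at h
        rcases hx : P (k + 1) with (_ | ⟨j', c⟩ | y)
        · exact absurd hx (hcon _ hk)
        · rw [hx] at h
          obtain ⟨rfl, -⟩ := S_adj_leg_leg.1 h
          exact ⟨c, rfl⟩
        · exact absurd hx (hleaf _ hk y)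
    obtain ⟨b, hb⟩ := hsame (i - 1) le_rfl
    rcases hend with h1 | ⟨j', a', h1, ha'⟩
    · exact hcon _ le_rfl h1
    · have hba : b = a' := by
        rw [hb] at h1
        simp only [Sum.inr.injEq, Sum.inl.injEq, Prod.mk.injEq] at h1
        exact h1.2
      have haa : a = a' := Fin.ext (by omega)
      refine hP.ne (i := 0) (j := i - 1) (by omega) le_rfl (by omega) ?_
      rw [h0, hb, hba, haa]
  obtain ⟨k, hk, hkc⟩ := hcenter
  have hup : k < i - 1 → i - 1 - k + 1 = p := fun h =>
    hlen (hP.shift (a := k) (m := i - 1 - k) (by omega)) (by omega) hkc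
      (fun j hj => hleaf _ (by omega)) (by rwa [Nat.add_sub_cancel' hk])
  have hdown : 0 < k → k + 1 = p := fun h =>
    hlen (hP.down (a := k) (m := k) le_rfl hk) h hkc (fun j hj => hleaf _ (by omega))
      (by rwa [Nat.sub_self])
  simp only [Set.mem_insert_iff, Set.mem_singleton_iff]
  omega

theorem inBoneClass_S (hp : 3 ≤ p) : InBoneClass {p, 2 * p - 1} (S p m) :=
  ⟨connected_S (by omega), bonesIn_S hp⟩

end BoneDeficiency

/-! ### Assembly of the two cases. -/

theorem theorem1p5 (n p : ℕ) (hn : 3 < n) (hp : 3 ≤ p) (hodd : Odd p) :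
    -- the case `q = 2p + 1`
    ((∀ (V : Type*) [Finite V] (G : SimpleGraph V),
        BoneDeficiency.InBoneClass {p, 2 * p + 1} G →
        BoneDeficiency.localIndepNum G < n →
          BoneDeficiency.deficiency G ≤ 3 * n - 8 ∧
          (BoneDeficiency.DeficiencyCritical G →
            (BoneDeficiency.deficiency G = 3 * n - 8 ↔
              Nonempty (G ≃g BoneDeficiency.T p (n - 2))))) ∧
      BoneDeficiency.InBoneClass {p, 2 * p + 1} (BoneDeficiency.T p (n - 2)) ∧
      BoneDeficiency.localIndepNum (BoneDeficiency.T p (n - 2)) < n ∧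
      BoneDeficiency.DeficiencyCritical (BoneDeficiency.T p (n - 2))) ∧
    -- the case `q = 2p - 1`
    ((∀ (V : Type*) [Finite V] (G : SimpleGraph V),
        BoneDeficiency.InBoneClass {p, 2 * p - 1} G →
        BoneDeficiency.localIndepNum G < n →
          BoneDeficiency.deficiency G ≤ n ^ 2 - 3 * n + 1 ∧
          (BoneDeficiency.DeficiencyCritical G →
            (BoneDeficiency.deficiency G = n ^ 2 - 3 * n + 1 ↔
              Nonempty (G ≃g BoneDeficiency.S p (n - 1))))) ∧
      BoneDeficiency.InBoneClass {p, 2 * p - 1} (BoneDeficiency.S p (n - 1)) ∧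
      BoneDeficiency.localIndepNum (BoneDeficiency.S p (n - 1)) < n ∧
      BoneDeficiency.DeficiencyCritical (BoneDeficiency.S p (n - 1))) := by
  have hT : BoneDeficiency.localIndepNum (BoneDeficiency.T p (n - 2)) < n := by
    have := BoneDeficiency.localIndepNum_T_le (m := n - 2) hp (by omega)
    omega
  have hTd : 3 * n - 8 ≤ BoneDeficiency.deficiency (BoneDeficiency.T p (n - 2)) := by
    have := BoneDeficiency.le_deficiency_T (m := n - 2) hodd
    omega
  have hTc := BoneDeficiency.inBoneClass_T (m := n - 2) hp (by omega)
  have hS : BoneDeficiency.localIndepNum (BoneDeficiency.S p (n - 1)) < n := by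
    have := BoneDeficiency.localIndepNum_S_le (p := p) (m := n - 1) (by omega) (by omega)
    omega
  have hSd : n ^ 2 - 3 * n + 1 ≤ BoneDeficiency.deficiency (BoneDeficiency.S p (n - 1)) := by
    have := BoneDeficiency.le_deficiency_S (m := n - 1) hodd (by omega)
    obtain ⟨m, rfl⟩ : ∃ m, n = m + 4 := ⟨n - 4, by omega⟩
    rw [BoneDeficiency.sq_sub_eq]
    have h : (m + 3) * (m + 2) - 1 = m ^ 2 + 5 * m + 5 := by
      rw [show (m + 3) * (m + 2) = m ^ 2 + 5 * m + 5 + 1 by ring, Nat.add_sub_cancel]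
    exact h ▸ this
  have hSc := BoneDeficiency.inBoneClass_S (m := n - 1) hp
  refine ⟨⟨?_, hTc, hT, ?_⟩, ?_, hSc, hS, ?_⟩
  · exact BoneDeficiency.extremal_of_embeds hTc.1 hTd
      fun _ _ _ hc hA hα hd => BoneDeficiency.embeds_T hn hp hodd hc hA hα hd
  · exact BoneDeficiency.deficiencyCritical_of_embeds hTc hT hTd
      fun _ _ _ hc hA hα hd => BoneDeficiency.embeds_T hn hp hodd hc hA hα hd
  · exact BoneDeficiency.extremal_of_embeds hSc.1 hSd
      fun _ _ _ hc hA hα hd => BoneDeficiency.embeds_S hn hp hodd hc hA hα hd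
  · exact BoneDeficiency.deficiencyCritical_of_embeds hSc hS hSd
      fun _ _ _ hc hA hα hd => BoneDeficiency.embeds_S hn hp hodd hc hA hα hd
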